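/- All graphs are finite and simple, and $k\ge 1$. An equitable $k$-coloring of a graph $G$ with $n$ vertices is a proper coloring $V(G)\to\{1,\dots,k\}$ in which every color class has at least $\lfloor n/k\rfloor$ and at most $\lceil n/k\rceil$ vertices; \textsc{Equitable Coloring} asks, given $(G,k)$, whether $G$ has an equitable $k$-coloring. A clique modulator of $G$ is a set $U\subseteq V(G)$ such that $G-U$ is complete, and the distance to clique $d=d(G)$ is the minimum size of a clique modulator. A greedy modulator is a clique modulator obtained from $G$ by repeatedly choosing two distinct non-adjacent remaining vertices and removing both of them, until no such pair remains. Polynomial time means a number of steps polynomial in the bit length of $(G,k)$ (adjacency matrix, and $k$ in binary) on a random access machine with addition, subtraction and comparison at unit cost. Theorem. \textsc{Equitable Coloring} parameterized by the distance to clique $d$ has a kernel with at most $4d$ vertices (at most $2$ vertices if $d=0$): there is a polynomial-time algorithm that, given $(G,k)$, computes an instance $(G',k')$ with $k'\ge1$ such that $G'$ has an equitable $k'$-coloring if and only if $G$ has an equitable $k$-coloring, $|V(G')|\le\max\{4d(G),2\}$, and the length of $(G',k')$ is bounded by a function of $d(G)$ alone. Moreover: (a) A greedy modulator can be computed in polynomial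 time, and every greedy modulator $U$ satisfies $|U|\le 2d$. (b) There is a polynomial-time algorithm that correctly decides every instance $(G,k)$ for which $G$ has a clique modulator $U$ with $|U|<k$ (no modulator being given). For such instances, $G$ has an equitable $k$-coloring if and only if $|V(G)|\le k+\nu(\overline G)$, where $\nu(\overline G)$ is the size of a maximum matching of the complement of $G$. (c) If $U$ is a greedy modulator with $k\le|U|$, then $|U|+k\le 4d$, and $G$ has no equitable $k$-coloring if $|V(G)|>|U|+k$; so either $(G,k)$ is a no-instance or $|V(G)|\le 4d$. -/

import Mathlib

namespace EqCol

/-! ### Graph notions -/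

section Graph

variable {V : Type*} [Fintype V]

/-- `G` has an equitable (proper) `k`-coloring: every colour class has at least `⌊n / k⌋` and at
most `⌈n / k⌉` vertices, where `n` is the number of vertices. -/
def EquitablyColorable (G : SimpleGraph V) (k : ℕ) : Prop :=
  ∃ C : G.Coloring (Fin k), ∀ i : Fin k,
    Fintype.card V / k ≤ (C.colorClass i).ncard ∧
      (C.colorClass i).ncard ≤ Fintype.card V ⌈/⌉ k

/-- `U` is a clique modulator of `G`: the graph `G - U` is complete. -/
def IsCliqueModulator (G : SimpleGraph V) (U : Finset V) : Prop :=
  G.IsClique {v | v ∉ U}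

/-- The distance to clique of `G`: the size of a smallest clique modulator
(the set of all vertices is one, so the infimum is attained). -/
noncomputable def distToClique (G : SimpleGraph V) : ℕ :=
  sInf {m | ∃ U : Finset V, IsCliqueModulator G U ∧ U.card = m}

/-- `GreedyRemoved G U`: starting from `G`, one can remove exactly the vertices of `U` by
repeatedly picking two distinct non-adjacent remaining vertices and removing both. -/
inductive GreedyRemoved [DecidableEq V] (G : SimpleGraph V) : Finset V → Prop
  | start : GreedyRemoved G ∅
  | step {U : Finset V} {u v : V} : GreedyRemoved G U → u ∉ U → v ∉ U → u ≠ v → ¬ G.Adj u v →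
      GreedyRemoved G (insert u (insert v U))

/-- `U` is a possible outcome of the greedy procedure, run until no non-edge remains. -/
def IsGreedyModulator [DecidableEq V] (G : SimpleGraph V) (U : Finset V) : Prop :=
  GreedyRemoved G U ∧ IsCliqueModulator G U

/-- The number of edges of a maximum matching of `G`. -/
noncomputable def matchingNumber (G : SimpleGraph V) : ℕ :=
  sSup {m | ∃ M : G.Subgraph, M.IsMatching ∧ M.edgeSet.ncard = m}

end Graph

/-! ### Instances of the problem -/

/-- An instance `(G, k)` of Equitable Coloring: a graph with vertex set `{0, …, n - 1}` and a
positive number of colours. -/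
structure Inst where
  n : ℕ
  G : SimpleGraph (Fin n)
  k : ℕ
  k_pos : 1 ≤ k

/-- `I` is a yes-instance. -/
def Inst.Yes (I : Inst) : Prop := EquitablyColorable I.G I.k

/-- The number of bits of the instance: an adjacency matrix and `k` in binary. -/
def Inst.length (I : Inst) : ℕ := I.n * I.n + Nat.size I.k

/-! ### The machine model

A random access machine with unit cost, given by structured programs. The memory consists of
scalar variables and of two-dimensional arrays, all holding natural numbers. The only arithmetic
operations are addition, truncated subtraction and comparison (there is no multiplication), so
one operation lengthens numbers by at most one bit, and polynomial time on this machine is the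
same as polynomial time on a Turing machine. -/

/-- Memory contents. -/
structure Mem where
  /-- the value of the scalar variable with a given name -/
  var : ℕ → ℕ
  /-- the entry of the array with a given name at a given row and column -/
  arr : ℕ → ℕ → ℕ → ℕ

/-- Expressions. -/
inductive Expr
  | lit (c : ℕ)
  | var (x : ℕ)
  | get (a : ℕ) (i j : Expr)
  | add (e f : Expr)
  | sub (e f : Expr)
  | lt (e f : Expr)
  | eq (e f : Expr)

/-- The value of an expression; truth values are `1` and `0`. -/
def Expr.eval (m : Mem) : Expr → ℕ
  | .lit c => c
  | .var x => m.var x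
  | .get a i j => m.arr a (i.eval m) (j.eval m)
  | .add e f => e.eval m + f.eval m
  | .sub e f => e.eval m - f.eval m
  | .lt e f => if e.eval m < f.eval m then 1 else 0
  | .eq e f => if e.eval m = f.eval m then 1 else 0

/-- The number of steps for evaluating an expression. -/
def Expr.cost : Expr → ℕ
  | .lit _ => 1
  | .var _ => 1
  | .get _ i j => i.cost + j.cost + 1
  | .add e f => e.cost + f.cost + 1
  | .sub e f => e.cost + f.cost + 1
  | .lt e f => e.cost + f.cost + 1
  | .eq e f => e.cost + f.cost + 1

/-- Programs. -/
inductive Prog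
  | skip
  /-- assignment to a scalar variable -/
  | set (x : ℕ) (e : Expr)
  /-- assignment to an array entry -/
  | put (a : ℕ) (i j e : Expr)
  | seq (p q : Prog)
  /-- if `e` is nonzero then `p` else `q` -/
  | branch (e : Expr) (p q : Prog)
  /-- while `e` is nonzero do `p` -/
  | loop (e : Expr) (p : Prog)

def Mem.setVar (m : Mem) (x v : ℕ) : Mem :=
  { m with var := fun y => if y = x then v else m.var y }

def Mem.setArr (m : Mem) (a i j v : ℕ) : Mem :=
  { m with arr := fun b r s => if b = a ∧ r = i ∧ s = j then v else m.arr b r s }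

/-- `Exec p m t m'`: started in memory `m`, the program `p` halts after exactly `t` steps in
memory `m'`. -/
inductive Exec : Prog → Mem → ℕ → Mem → Prop
  | skip (m : Mem) : Exec .skip m 1 m
  | set (m : Mem) (x : ℕ) (e : Expr) :
      Exec (.set x e) m (e.cost + 1) (m.setVar x (e.eval m))
  | put (m : Mem) (a : ℕ) (i j e : Expr) :
      Exec (.put a i j e) m (i.cost + j.cost + e.cost + 1)
        (m.setArr a (i.eval m) (j.eval m) (e.eval m))
  | seq {p q : Prog} {m₁ m₂ m₃ : Mem} {t₁ t₂ : ℕ} :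
      Exec p m₁ t₁ m₂ → Exec q m₂ t₂ m₃ → Exec (.seq p q) m₁ (t₁ + t₂) m₃
  | branchTrue {e : Expr} {p q : Prog} {m m' : Mem} {t : ℕ} :
      e.eval m ≠ 0 → Exec p m t m' → Exec (.branch e p q) m (e.cost + t + 1) m'
  | branchFalse {e : Expr} {p q : Prog} {m m' : Mem} {t : ℕ} :
      e.eval m = 0 → Exec q m t m' → Exec (.branch e p q) m (e.cost + t + 1) m'
  | loopTrue {e : Expr} {p : Prog} {m₁ m₂ m₃ : Mem} {t₁ t₂ : ℕ} :
      e.eval m₁ ≠ 0 → Exec p m₁ t₁ m₂ → Exec (.loop e p) m₂ t₂ m₃ →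
      Exec (.loop e p) m₁ (e.cost + t₁ + t₂ + 1) m₃
  | loopFalse {e : Expr} {p : Prog} {m : Mem} :
      e.eval m = 0 → Exec (.loop e p) m (e.cost + 1) m

open Classical in
/-- The initial memory on input `I`: variable `0` holds `n`, variable `1` holds `k`, array `0`
holds the adjacency matrix, and everything else is `0`. -/
noncomputable def Inst.input (I : Inst) : Mem where
  var x := if x = 0 then I.n else if x = 1 then I.k else 0
  arr a i j :=
    if a = 0 ∧ ∃ (hi : i < I.n) (hj : j < I.n), I.G.Adj ⟨i, hi⟩ ⟨j, hj⟩ then 1 else 0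

open Classical in
/-- The memory `m` holds the instance `J` as a result (in the format of the input; work space
outside of the relevant cells is ignored). -/
def Mem.HoldsInst (m : Mem) (J : Inst) : Prop :=
  m.var 0 = J.n ∧ m.var 1 = J.k ∧
    ∀ i j : Fin J.n, m.arr 0 i j = if J.G.Adj i j then 1 else 0

open Classical in
/-- The memory `m` holds the truth value of `P` as a result. -/
def Mem.HoldsAnswer (m : Mem) (P : Prop) : Prop :=
  m.var 0 = if P then 1 else 0

/-- The memory `m` holds the characteristic vector of the vertex set `U` as a result. -/
def Mem.HoldsSet {n : ℕ} (m : Mem) (U : Finset (Fin n)) : Prop :=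
  ∀ i : Fin n, m.arr 1 0 i = if i ∈ U then 1 else 0

/-- There is a program that, on every input `I` with `Dom I`, halts within a number of steps
polynomial in the length of `I`, in a memory with the property `Post I`. -/
def PolyTime (Dom : Inst → Prop) (Post : Inst → Mem → Prop) : Prop :=
  ∃ (p : Prog) (T : Polynomial ℕ), ∀ I : Inst, Dom I →
    ∃ (t : ℕ) (m : Mem), Exec p I.input t m ∧ t ≤ T.eval I.length ∧ Post I m

/-- Equitable Coloring, parameterized by `κ`, has a kernel with at most `f d` vertices, `d` being
the parameter: a polynomial-time computable map takes each instance to an equivalent instance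
with at most `f d` vertices, whose length (thus also its number of colours) is bounded by a
function of `d` alone. The value of the parameter is not part of the input. -/
def HasKernel (κ : Inst → ℕ) (f : ℕ → ℕ) : Prop :=
  ∃ K : Inst → Inst,
    PolyTime (fun _ => True) (fun I m => m.HoldsInst (K I)) ∧
    (∀ I, (K I).Yes ↔ I.Yes) ∧
    (∀ I, (K I).n ≤ f (κ I)) ∧
    ∃ g : ℕ → ℕ, ∀ I, (K I).length ≤ g (κ I)

end EqCol

/-!
Let `U` be a clique modulator with `|U| < k`. Some colour misses `U`, so its class is an independent
set in the clique outside `U` and has at most one vertex. In an equitable colouring all classes then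
have at most two vertices, so that the non-empty ones are the edges and the exposed vertices of a
matching of the complement. Conversely, a maximum matching of the complement loses edges until
exactly `k` classes remain, or empty classes are added. Hence the answer is yes iff `|V| ≤ k +
ν(Gᶜ)`.

Every clique modulator meets each non-adjacent pair that a greedy modulator consists of, whence
`|U| ≤ 2d`. The vertices outside `U` have distinct colours, so there are at most `k` of them in a
yes-instance, and if `k ≤ |U|` such an instance has at most `4d` vertices. The kernel therefore
solves the instance if `|U| < k`, rejects it if `|V| > |U| + k`, and keeps it otherwise.

The maximum matching is found by Edmonds' search. The alternating forest keeps for each outer vertex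
`x` a matching that exposes `x` instead of the root of its tree, which makes the lifting of
augmenting paths through contracted blossoms trivial. When the search is stuck, every edge at an
outer vertex ends in its own blossom or in an inner vertex. Blossoms are odd, so every matching
exposes a vertex of each blossom or matches one to an inner vertex, and there are too few inner
vertices for any matching to expose less than the present one.

A program whose loops all run over the vertices takes polynomial time, and nested loops of this kind
suffice for the search, since each step enlarges the matching or the set of outer vertices.
-/

namespace EqCol

section Mates

variable {V : Type*} {G : SimpleGraph V} {f g : V → V} {v w x : V}

/-- A matching of `G`, encoded as the involution that swaps the ends of each of its edges and fixes
the vertices that it leaves exposed. -/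
structure IsMate (G : SimpleGraph V) (f : V → V) : Prop where
  involutive : Function.Involutive f
  adj : ∀ x, f x ≠ x → G.Adj x (f x)

theorem IsMate.id (G : SimpleGraph V) : IsMate G id :=
  ⟨fun _ => rfl, fun _ h => absurd rfl h⟩

variable [DecidableEq V]

theorem IsMate.piecewise (hf : IsMate G f) (hg : IsMate G g) {S : Finset V}
    (hfS : ∀ x ∈ S, f x ∈ S) (hgS : ∀ x ∈ S, g x ∈ S) : IsMate G (S.piecewise f g) := by
  have hgS' : ∀ x ∉ S, g x ∉ S := fun x hx h => hx (hg.involutive x ▸ hgS _ h)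
  refine ⟨fun x => ?_, fun x => ?_⟩ <;> by_cases hx : x ∈ S
  · rw [S.piecewise_eq_of_mem _ _ hx, S.piecewise_eq_of_mem _ _ (hfS x hx), hf.involutive]
  · rw [S.piecewise_eq_of_notMem _ _ hx, S.piecewise_eq_of_notMem _ _ (hgS' x hx), hg.involutive]
  · rw [S.piecewise_eq_of_mem _ _ hx]
    exact hf.adj x
  · rw [S.piecewise_eq_of_notMem _ _ hx]
    exact hg.adj x

/-- The matching `f` without its edge at `x`. -/
def dropMate (f : V → V) (x y : V) : V := if y = x ∨ y = f x then y else f y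

theorem dropMate_of_eq {y : V} (h : y = x ∨ y = f x) : dropMate f x y = y := if_pos h

theorem dropMate_of_ne {y : V} (h : ¬(y = x ∨ y = f x)) : dropMate f x y = f y := if_neg h

theorem IsMate.dropMate (hf : IsMate G f) (x : V) : IsMate G (dropMate f x) := by
  refine ⟨fun y => ?_, fun y hy => ?_⟩ <;> by_cases h : y = x ∨ y = f x
  · rw [dropMate_of_eq h, dropMate_of_eq h]
  · rw [dropMate_of_ne h, dropMate_of_ne, hf.involutive]
    rintro (h' | h')
    · exact h (.inr (by rw [← h', hf.involutive]))
    · exact h (.inl (hf.involutive.injective h'))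
  · exact absurd (dropMate_of_eq h) hy
  · rw [dropMate_of_ne h] at hy ⊢
    exact hf.adj y hy

/-- The matching `f` with the additional edge `vw`, for exposed vertices `v` and `w`. -/
def joinMate (f : V → V) (v w x : V) : V := Equiv.swap v w (f x)

theorem joinMate_left (hv : f v = v) : joinMate f v w v = w := by
  rw [joinMate, hv, Equiv.swap_apply_left]

theorem joinMate_right (hw : f w = w) : joinMate f v w w = v := by
  rw [joinMate, hw, Equiv.swap_apply_right]

theorem joinMate_of_ne (hf : Function.Involutive f) (hv : f v = v) (hw : f w = w) (hxv : x ≠ v)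
    (hxw : x ≠ w) : joinMate f v w x = f x :=
  Equiv.swap_apply_of_ne_of_ne (fun h => hxv (hf.injective (h.trans hv.symm)))
    (fun h => hxw (hf.injective (h.trans hw.symm)))

theorem IsMate.joinMate (hf : IsMate G f) (hv : f v = v) (hw : f w = w) (hvw : G.Adj v w) :
    IsMate G (joinMate f v w) := by
  have hne {x : V} := joinMate_of_ne (x := x) hf.involutive hv hw
  have hinv : ∀ x, x ≠ v → x ≠ w → f x ≠ v ∧ f x ≠ w := fun x hxv hxw =>
    ⟨fun h => hxv (hf.involutive.injective (h.trans hv.symm)),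
      fun h => hxw (hf.involutive.injective (h.trans hw.symm))⟩
  refine ⟨fun x => ?_, fun x hx => ?_⟩ <;> rcases eq_or_ne x v with rfl | hxv <;>
    [skip; rcases eq_or_ne x w with rfl | hxw; skip; rcases eq_or_ne x w with rfl | hxw]
  · rw [joinMate_left hv, joinMate_right hw]
  · rw [joinMate_right hw, joinMate_left hv]
  · rw [hne hxv hxw, hne (hinv x hxv hxw).1 (hinv x hxv hxw).2, hf.involutive]
  · rwa [joinMate_left hv]
  · rw [joinMate_right hw]
    exact hvw.symm
  · rw [hne hxv hxw] at hx ⊢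
    exact hf.adj x hx

variable [Fintype V]

/-- The vertices that the matching `f` leaves exposed. -/
def exposed (f : V → V) : Finset V := Finset.univ.filter fun x => f x = x

theorem mem_exposed : x ∈ exposed f ↔ f x = x := by simp [exposed]

/-- `f` is a maximum matching of `G`. -/
structure IsMaxMate (G : SimpleGraph V) (f : V → V) : Prop extends IsMate G f where
  card_exposed_le : ∀ g, IsMate G g → (exposed f).card ≤ (exposed g).card

theorem card_add_card_exposed {α : Type*} [DecidableEq α] {c : V → α}
    (hc : ∀ a b, c a = c b ↔ a = b ∨ a = f b) :
    Fintype.card V + (exposed f).card = 2 * (Finset.univ.image c).card := by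
  have himage : ∀ s : Finset V, (s : Set V).MapsTo c (Finset.univ.image c) := fun s a _ =>
    Finset.mem_coe.2 (Finset.mem_image_of_mem c (Finset.mem_univ a))
  rw [← Finset.card_univ, Finset.card_eq_sum_card_fiberwise (himage Finset.univ),
    Finset.card_eq_sum_card_fiberwise (himage (exposed f)), ← Finset.sum_add_distrib, mul_comm]
  refine Finset.sum_const_nat (Finset.forall_mem_image.2 fun x _ => ?_)
  have hfiber : (Finset.univ.filter fun a => c a = c x) = {x, f x} := by ext a; simp [hc]
  have hffx : f (f x) = x := by
    rcases (hc x (f x)).1 ((hc (f x) x).2 (.inr rfl)).symm with h | h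
    · rw [← h, ← h]
    · exact h.symm
  rw [hfiber]
  by_cases hx : f x = x
  · have : ((exposed f).filter fun a => c a = c x) = {x} := by
      ext a
      simp only [Finset.mem_filter, mem_exposed, hc, hx, or_self, Finset.mem_singleton]
      exact ⟨And.right, fun h => ⟨by rw [h, hx], h⟩⟩
    rw [this, hx, Finset.pair_eq_singleton]
    rfl
  · have : ((exposed f).filter fun a => c a = c x) = ∅ := by
      refine Finset.filter_eq_empty_iff.2 fun a ha => ?_
      rw [hc]
      rintro (rfl | rfl)
      · exact hx (mem_exposed.1 ha)
      · exact hx ((mem_exposed.1 ha).symm.trans hffx)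
    rw [this, Finset.card_pair (Ne.symm hx), Finset.card_empty]

theorem card_exposed_dropMate (hf : Function.Involutive f) (hx : f x ≠ x) :
    (exposed (dropMate f x)).card = (exposed f).card + 2 := by
  have hset : exposed (dropMate f x) = insert x (insert (f x) (exposed f)) := by
    ext y
    by_cases hy : y = x ∨ y = f x
    · simpa [mem_exposed, dropMate_of_eq hy, ← or_assoc] using .inl hy
    · simp [mem_exposed, dropMate_of_ne hy, ← or_assoc, hy]
  rw [hset, Finset.card_insert_of_notMem, Finset.card_insert_of_notMem]
  · rw [mem_exposed, hf]
    exact Ne.symm hx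
  · simp [mem_exposed, hx, Ne.symm hx]

end Mates

section EquitableColoring

open Function

theorem mk_mate_eq_mk_mate_iff {V : Type*} {f : V → V} (hf : Involutive f) (a b : V) :
    s(a, f a) = s(b, f b) ↔ a = b ∨ a = f b := by
  rw [Sym2.eq_iff]
  exact ⟨fun h => h.imp And.left And.left, by rintro (rfl | rfl) <;> simp [hf _]⟩

theorem exists_involutive_of_ncard_fiber_le_two {V α : Type*} [Finite V] {c : V → α}
    (hc : ∀ x, {y | c y = c x}.ncard ≤ 2) :
    ∃ f : V → V, Involutive f ∧ ∀ a b, c a = c b ↔ a = b ∨ a = f b := by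
  have hpartner : ∀ x, ∃ y, c y = c x ∧ ∀ z, c z = c x → z = x ∨ z = y := by
    intro x
    by_cases hx : ∃ y, c y = c x ∧ y ≠ x
    · obtain ⟨y, hy, hyx⟩ := hx
      refine ⟨y, hy, fun z hz => ?_⟩
      by_contra! h
      have : ({x, y, z} : Set V).ncard ≤ 2 := (Set.ncard_le_ncard (by
        rintro _ (rfl | rfl | rfl) <;> first | rfl | assumption)).trans (hc x)
      rw [Set.ncard_eq_three.2 ⟨x, y, z, hyx.symm, h.1.symm, h.2.symm, rfl⟩] at this
      omega
    · push Not at hx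
      exact ⟨x, rfl, fun z hz => .inl (hx z hz)⟩
  choose f hcf hf using hpartner
  refine ⟨f, fun x => ?_, fun a b => ⟨hf b a, ?_⟩⟩
  · rcases hf (f x) x (hcf x).symm with h | h
    · rw [← h, ← h]
    · exact h.symm
  · rintro (rfl | rfl)
    · rfl
    · exact hcf b

variable {V : Type*} [Fintype V] {G : SimpleGraph V} {f : V → V} {k : ℕ}

theorem equitablyColorable_of_card_lt (h : Fintype.card V < k) : EquitablyColorable G k := by
  let e : V ↪ Fin k := (Fintype.equivFin V).toEmbedding.trans (Fin.castLEEmb h.le)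
  refine ⟨.mk e fun hab he => hab.ne (e.injective he), fun i => ?_⟩
  have hsub : {x | e x = i}.Subsingleton := fun a ha b hb => e.injective (ha.trans hb.symm)
  refine ⟨by simp [Nat.div_eq_of_lt h], ?_⟩
  rcases isEmpty_or_nonempty V with hV | hV
  · exact (Set.ncard_le_card _).trans (by simp)
  · refine (Set.ncard_le_one_iff_subsingleton.2 hsub).trans ?_
    rw [Nat.ceilDiv_eq_add_pred_div, Nat.le_div_iff_mul_le (by omega)]
    have := Fintype.card_pos (α := V)
    omega

variable [DecidableEq V]

theorem IsMate.exists_card_add_card_exposed_eq (hf : IsMate G f)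
    (hle : Fintype.card V + (exposed f).card ≤ 2 * k) (hk : k ≤ Fintype.card V) :
    ∃ g, IsMate G g ∧ Fintype.card V + (exposed g).card = 2 * k := by
  induction hd : 2 * k - (exposed f).card using Nat.strong_induction_on generalizing f with
  | _ d ih =>
    rcases hle.eq_or_lt with heq | hlt
    · exact ⟨f, hf, heq⟩
    obtain ⟨x, hx⟩ : ∃ x, f x ≠ x := by
      by_contra! h
      have : exposed f = Finset.univ := Finset.filter_true_of_mem fun x _ => h x
      rw [this, Finset.card_univ] at hlt
      omega
    have hparity := card_add_card_exposed (mk_mate_eq_mk_mate_iff hf.involutive)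
    have hdrop := card_exposed_dropMate hf.involutive hx
    exact ih _ (by omega) (hf.dropMate x) (by omega) rfl

theorem IsMate.equitablyColorable_of_eq (hf : IsMate Gᶜ f)
    (heq : Fintype.card V + (exposed f).card = 2 * k) (hk : k ≤ Fintype.card V) :
    EquitablyColorable G k := by
  have horbit := mk_mate_eq_mk_mate_iff hf.involutive
  let e := (Finset.univ.image fun x => s(x, f x)).equivFinOfCardEq (n := k)
    (by have := card_add_card_exposed horbit; omega)
  let c : V → Fin k := fun x => e ⟨s(x, f x), Finset.mem_image_of_mem _ (Finset.mem_univ x)⟩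
  have hc : ∀ a b, c a = c b ↔ a = b ∨ a = f b := fun a b => by
    rw [← horbit, e.injective.eq_iff, Subtype.mk.injEq]
  refine ⟨.mk c fun {a b} hab h => ?_, fun i => ?_⟩
  · rcases (hc a b).1 h with rfl | rfl
    · exact hab.ne rfl
    · exact ((SimpleGraph.compl_adj ..).1 (hf.adj b hab.ne)).2 hab.symm
  · obtain ⟨⟨p, hp⟩, hpi⟩ := e.surjective i
    obtain ⟨x, -, rfl⟩ := Finset.mem_image.1 hp
    have hclass : {y | c y = i} = {x, f x} := by
      ext y
      rw [← hpi]
      exact hc y x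
    have hkpos : 0 < k := i.pos
    change _ ≤ {y | c y = i}.ncard ∧ {y | c y = i}.ncard ≤ _
    rw [hclass, Nat.ceilDiv_eq_add_pred_div, Nat.le_div_iff_mul_le hkpos]
    by_cases hx : f x = x
    · have : 0 < (exposed f).card := Finset.card_pos.2 ⟨x, mem_exposed.2 hx⟩
      rw [hx, Set.pair_eq_singleton, Set.ncard_singleton]
      exact ⟨Nat.le_of_lt_succ ((Nat.div_lt_iff_lt_mul hkpos).2 (by omega)), by omega⟩
    · have := Finset.card_lt_univ_of_notMem (mt mem_exposed.1 hx)
      rw [Set.ncard_pair (Ne.symm hx)]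
      exact ⟨Nat.div_le_of_le_mul (by omega), by omega⟩

theorem IsMate.equitablyColorable (hf : IsMate Gᶜ f)
    (hle : Fintype.card V + (exposed f).card ≤ 2 * k) : EquitablyColorable G k := by
  rcases lt_or_ge (Fintype.card V) k with hlt | hk
  · exact equitablyColorable_of_card_lt hlt
  · obtain ⟨g, hg, heq⟩ := hf.exists_card_add_card_exposed_eq hle hk
    exact hg.equitablyColorable_of_eq heq hk

theorem exists_isMate_of_coloring (C : G.Coloring (Fin k))
    (hC : ∀ i, (C.colorClass i).ncard ≤ 2) :
    ∃ f, IsMate Gᶜ f ∧ Fintype.card V + (exposed f).card ≤ 2 * k := by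
  obtain ⟨f, hf, hCf⟩ := exists_involutive_of_ncard_fiber_le_two fun x => hC (C x)
  refine ⟨f, ⟨hf, fun x hx => ?_⟩, ?_⟩
  · rw [SimpleGraph.compl_adj]
    exact ⟨Ne.symm hx, fun h => C.valid h ((hCf _ _).2 (.inr (hf x).symm))⟩
  · rw [card_add_card_exposed hCf]
    exact Nat.mul_le_mul_left 2 ((Finset.card_le_univ _).trans_eq (Fintype.card_fin k))

theorem EquitablyColorable.exists_isMate (h : EquitablyColorable G k) {U : Finset V}
    (hU : IsCliqueModulator G U) (hUk : U.card < k) :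
    ∃ f, IsMate Gᶜ f ∧ Fintype.card V + (exposed f).card ≤ 2 * k := by
  obtain ⟨C, hC⟩ := h
  obtain ⟨i, -, hi⟩ : ∃ i ∈ Finset.univ, i ∉ U.image C :=
    Finset.exists_mem_notMem_of_card_lt_card
      (Finset.card_image_le.trans_lt (by rwa [Finset.card_univ, Fintype.card_fin]))
  have hiU : ∀ x, C x = i → x ∉ U := fun x hx h => hi (Finset.mem_image.2 ⟨x, h, hx⟩)
  have hsmall : (C.colorClass i).ncard ≤ 1 := by
    rw [Set.ncard_le_one_iff]
    intro a b ha hb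
    by_contra hab
    exact C.valid (hU (hiU a ha) (hiU b hb) hab) (Eq.trans ha hb.symm)
  have hkpos : 0 < k := i.pos
  have hlt : Fintype.card V < 2 * k :=
    (Nat.div_lt_iff_lt_mul hkpos).1 (Nat.lt_succ_of_le ((hC i).1.trans hsmall))
  refine exists_isMate_of_coloring C fun j => (hC j).2.trans ?_
  rw [Nat.ceilDiv_eq_add_pred_div]
  exact Nat.le_of_lt_succ ((Nat.div_lt_iff_lt_mul hkpos).2 (by omega))

end EquitableColoring

section MatchingNumber

variable {V : Type*} {G : SimpleGraph V} {M : G.Subgraph} {f : V → V}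

theorem two_mul_ncard_edgeSet [Finite V] (hM : M.IsMatching) :
    2 * M.edgeSet.ncard = M.verts.ncard := by
  classical
  cases nonempty_fintype V
  have hedges : M.spanningCoe.edgeFinset.card = M.edgeSet.ncard := by
    rw [← SimpleGraph.Subgraph.edgeSet_spanningCoe, Set.ncard_eq_toFinset_card']
    rfl
  have hdegree : ∀ v, M.spanningCoe.degree v = if v ∈ M.verts then 1 else 0 := by
    intro v
    rw [SimpleGraph.Subgraph.degree_spanningCoe]
    split_ifs with hv
    · exact SimpleGraph.Subgraph.isMatching_iff_forall_degree.1 hM v hv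
    · exact SimpleGraph.Subgraph.degree_of_notMem_verts hv
  rw [← hedges, ← M.spanningCoe.sum_degrees_eq_twice_card_edges,
    Finset.sum_congr rfl fun v _ => hdegree v, Finset.sum_boole, Set.ncard_eq_toFinset_card']
  simp [Set.toFinset]

variable [Fintype V] [DecidableEq V]

theorem card_exposed_add_two_mul_ncard_edgeSet (hM : M.IsMatching)
    (hf : ∀ v, f v ≠ v ↔ v ∈ M.verts) :
    (exposed f).card + 2 * M.edgeSet.ncard = Fintype.card V := by
  have hverts : M.verts = ↑(exposed f)ᶜ := by
    ext v
    rw [← hf, Finset.coe_compl, Set.mem_compl_iff, Finset.mem_coe, mem_exposed]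
  rw [two_mul_ncard_edgeSet hM, hverts, Set.ncard_coe_finset, Finset.card_add_card_compl]

theorem IsMate.exists_isMatching (hf : IsMate G f) : ∃ M : G.Subgraph, M.IsMatching ∧
    (exposed f).card + 2 * M.edgeSet.ncard = Fintype.card V := by
  let M : G.Subgraph :=
    { verts := {v | f v ≠ v}
      Adj := fun x y => f x = y ∧ f x ≠ x
      adj_sub := by
        rintro x _ ⟨rfl, hx⟩
        exact hf.adj x hx
      edge_vert := fun h => h.2
      symm := ⟨by
        rintro x _ ⟨rfl, hx⟩
        exact ⟨hf.involutive x, by rw [hf.involutive]; exact Ne.symm hx⟩⟩ }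
  have hM : M.IsMatching := fun v hv => ⟨f v, ⟨rfl, hv⟩, fun w hw => hw.1.symm⟩
  exact ⟨M, hM, card_exposed_add_two_mul_ncard_edgeSet hM fun _ => Iff.rfl⟩

theorem exists_isMate_of_isMatching (hM : M.IsMatching) : ∃ f, IsMate G f ∧
    (exposed f).card + 2 * M.edgeSet.ncard = Fintype.card V := by
  classical
  have hpartner : ∀ v, ∃ w, (v ∈ M.verts → M.Adj v w) ∧ (v ∉ M.verts → w = v) := fun v => by
    by_cases hv : v ∈ M.verts
    · exact ⟨_, fun _ => (hM hv).choose_spec.1, fun h => absurd hv h⟩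
    · exact ⟨v, fun h => absurd h hv, fun _ => rfl⟩
  choose f hadj hfix using hpartner
  have hf : ∀ v, f v ≠ v ↔ v ∈ M.verts := fun v =>
    ⟨fun h => not_not.1 (mt (hfix v) h), fun hv => (hadj v hv).adj_sub.ne'⟩
  refine ⟨f, ⟨fun v => ?_, fun v hv => (hadj v ((hf v).1 hv)).adj_sub⟩,
    card_exposed_add_two_mul_ncard_edgeSet hM hf⟩
  by_cases hv : v ∈ M.verts
  · have hfv : f v ∈ M.verts := (hadj v hv).snd_mem
    exact (hM hfv).unique (hadj _ hfv) (hadj v hv).symm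
  · rw [hfix v hv, hfix v hv]

theorem bddAbove_ncard_edgeSet {V : Type*} [Finite V] (G : SimpleGraph V) :
    BddAbove {m | ∃ M : G.Subgraph, M.IsMatching ∧ M.edgeSet.ncard = m} := by
  classical
  cases nonempty_fintype V
  refine ⟨Fintype.card V, ?_⟩
  rintro m ⟨M, hM, rfl⟩
  obtain ⟨f, -, hf⟩ := exists_isMate_of_isMatching hM
  omega

theorem exists_isMate_card_exposed_add_matchingNumber (G : SimpleGraph V) :
    ∃ f, IsMate G f ∧ (exposed f).card + 2 * matchingNumber G = Fintype.card V := by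
  have hempty : (⊥ : G.Subgraph).IsMatching := fun v hv => absurd hv (by simp)
  obtain ⟨M, hM, h⟩ : matchingNumber G ∈ {m | ∃ M : G.Subgraph, _ ∧ _} :=
    Nat.sSup_mem ⟨_, ⊥, hempty, rfl⟩ (bddAbove_ncard_edgeSet G)
  rw [← h]
  exact exists_isMate_of_isMatching hM

theorem IsMate.card_le_card_exposed_add (hf : IsMate G f) :
    Fintype.card V ≤ (exposed f).card + 2 * matchingNumber G := by
  obtain ⟨M, hM, h⟩ := hf.exists_isMatching
  have : M.edgeSet.ncard ≤ matchingNumber G := le_csSup (bddAbove_ncard_edgeSet G) ⟨M, hM, rfl⟩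
  omega

end MatchingNumber

section CliqueModulator

variable {V : Type*} {G : SimpleGraph V} {U W : Finset V} {k : ℕ}

theorem GreedyRemoved.card_le [DecidableEq V] (h : GreedyRemoved G U) (hW : IsCliqueModulator G W) :
    U.card ≤ 2 * (U ∩ W).card := by
  induction h with
  | start => simp
  | @step U u v _ hu hv huv hadj ih =>
    have huvW : u ∈ W ∨ v ∈ W := by
      by_contra! h
      exact hadj (hW h.1 h.2 huv)
    have hU : (insert u (insert v U)).card = U.card + 2 := by
      rw [Finset.card_insert_of_notMem (by simp [hu, huv]), Finset.card_insert_of_notMem hv]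
    have hUW : (U ∩ W).card < (insert u (insert v U) ∩ W).card := by
      refine Finset.card_lt_card ((Finset.ssubset_iff_of_subset (Finset.inter_subset_inter_right
        ((Finset.subset_insert v U).trans (Finset.subset_insert u _)))).2 ?_)
      rcases huvW with h | h
      · exact ⟨u, by simp [h], by simp [hu]⟩
      · exact ⟨v, by simp [h], by simp [hv]⟩
    omega

theorem exists_card_eq_distToClique [Finite V] (G : SimpleGraph V) :
    ∃ W : Finset V, IsCliqueModulator G W ∧ W.card = distToClique G := by
  cases nonempty_fintype V
  exact Nat.sInf_mem (s := {m | ∃ U : Finset V, IsCliqueModulator G U ∧ U.card = m})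
    ⟨_, Finset.univ, fun x hx => absurd (Finset.mem_univ x) hx, rfl⟩

theorem IsGreedyModulator.card_le [Finite V] [DecidableEq V] (h : IsGreedyModulator G U) :
    U.card ≤ 2 * distToClique G := by
  obtain ⟨W, hW, hcard⟩ := exists_card_eq_distToClique G
  rw [← hcard]
  exact (h.1.card_le hW).trans
    (Nat.mul_le_mul_left 2 (Finset.card_le_card Finset.inter_subset_right))

variable [Fintype V]

theorem IsCliqueModulator.not_equitablyColorable (hU : IsCliqueModulator G U)
    (h : U.card + k < Fintype.card V) : ¬ EquitablyColorable G k := by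
  classical
  rintro ⟨C, -⟩
  have hcard : (Finset.univ : Finset (Fin k)).card < Uᶜ.card := by
    rw [Finset.card_compl, Finset.card_univ, Fintype.card_fin]
    omega
  obtain ⟨x, hx, y, hy, hxy, he⟩ := Finset.exists_ne_map_eq_of_card_lt_of_maps_to
    (f := C) hcard fun _ _ => Finset.mem_coe.2 (Finset.mem_univ _)
  exact C.valid (hU (Finset.mem_compl.1 hx) (Finset.mem_compl.1 hy) hxy) he

theorem equitablyColorable_iff_matchingNumber (hU : IsCliqueModulator G U) (hUk : U.card < k) :
    EquitablyColorable G k ↔ Fintype.card V ≤ k + matchingNumber Gᶜ := by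
  classical
  constructor
  · intro h
    obtain ⟨f, hf, hle⟩ := h.exists_isMate hU hUk
    have := hf.card_le_card_exposed_add
    omega
  · intro h
    obtain ⟨f, hf, hcard⟩ := exists_isMate_card_exposed_add_matchingNumber Gᶜ
    exact hf.equitablyColorable (by omega)

theorem IsMaxMate.equitablyColorable_iff [DecidableEq V] {f : V → V} (hf : IsMaxMate Gᶜ f)
    (hU : IsCliqueModulator G U) (hUk : U.card < k) :
    EquitablyColorable G k ↔ Fintype.card V + (exposed f).card ≤ 2 * k := by
  refine ⟨fun h => ?_, hf.toIsMate.equitablyColorable⟩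
  obtain ⟨g, hg, hle⟩ := h.exists_isMate hU hUk
  have := hf.card_exposed_le g hg
  omega

end CliqueModulator

/-- An alternating forest of a matching, with contracted blossoms: `outer` is the set of vertices
reached from an exposed vertex by an alternating walk of even length. For such a vertex `x`, the
set `stem x` is the union of the blossoms and inner vertices on the way from `x` to the root of its
tree, and `alt x` is a matching that leaves `x` exposed instead of the root. For an inner vertex
`u`, the set `stem u` is that of the outer vertex from which `u` was reached. Outer vertices belong
to the same blossom if they have the same stem. -/
structure AltForest (V : Type*) where
  mate : V → V
  outer : Finset V
  stem : V → Finset V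
  alt : V → V → V

namespace AltForest

variable {V : Type*}

/-- `u` is an inner vertex: it is not outer, but matched to an outer vertex. -/
def Inner (F : AltForest V) (u : V) : Prop := u ∉ F.outer ∧ F.mate u ∈ F.outer

/-- `b` is the base of its blossom: the only vertex not matched within the blossom. -/
def IsBase (F : AltForest V) (b : V) : Prop :=
  b ∈ F.outer ∧ (F.mate b = b ∨ F.mate b ∉ F.outer)

variable [DecidableEq V]

/-- The blossom of the outer vertex `x`. -/
def blossom (F : AltForest V) (x : V) : Finset V := F.outer.filter fun y => F.stem y = F.stem x

theorem mem_blossom {F : AltForest V} {x y : V} :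
    y ∈ F.blossom x ↔ y ∈ F.outer ∧ F.stem y = F.stem x := Finset.mem_filter

/-- `h` is a matching as required of `F.alt x`. -/
structure IsAlt (G : SimpleGraph V) (F : AltForest V) (x : V) (h : V → V) : Prop
    extends IsMate G h where
  fixed_iff : ∀ y ∈ F.stem x, (h y = y ↔ y = x)
  eq_mate : ∀ y ∉ F.stem x, h y = F.mate y
  insert_stem : ∀ u ∈ F.stem x, F.Inner u →
    ∀ y ∈ insert u (F.stem u), h y ∈ insert u (F.stem u)

end AltForest

open AltForest

/-- The properties of an alternating forest that the search for an augmenting path maintains. -/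
structure IsAltForest {V : Type*} [DecidableEq V] (G : SimpleGraph V) (F : AltForest V) :
    Prop where
  isMate : IsMate G F.mate
  exposed_outer : ∀ x, F.mate x = x → x ∈ F.outer
  exists_parent : ∀ u, F.Inner u → ∃ p ∈ F.outer, G.Adj u p ∧ F.stem p = F.stem u
  notMem_stem : ∀ u, F.Inner u → u ∉ F.stem u
  mem_stem : ∀ x ∈ F.outer, x ∈ F.stem x
  stem_mate : ∀ x ∈ F.outer, F.mate x ∈ F.outer → F.stem (F.mate x) = F.stem x
  exists_base : ∀ x ∈ F.outer, ∃ b, F.IsBase b ∧ F.stem b = F.stem x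
  base_unique : ∀ b b', F.IsBase b → F.IsBase b' → F.stem b = F.stem b' → b = b'
  stem_root : ∀ b, F.mate b = b → F.stem b = F.blossom b
  stem_base : ∀ b ∈ F.outer, F.mate b ∉ F.outer →
    F.stem b = F.blossom b ∪ insert (F.mate b) (F.stem (F.mate b))
  isAlt : ∀ x ∈ F.outer, IsAlt G F x (F.alt x)

namespace IsAltForest

variable {V : Type*} [DecidableEq V] {G : SimpleGraph V} {F : AltForest V}
  {b e u v w x y z : V}

theorem inner_mate (hF : IsAltForest G F) (hb : b ∈ F.outer) (h : F.mate b ∉ F.outer) :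
    F.Inner (F.mate b) := ⟨h, by rwa [hF.isMate.involutive]⟩

theorem stem_mate_inner (hF : IsAltForest G F) (hu : F.Inner u) :
    F.stem (F.mate u) = F.blossom (F.mate u) ∪ insert u (F.stem u) := by
  have := hF.stem_base (F.mate u) hu.2
  rw [hF.isMate.involutive] at this
  exact this hu.1

theorem stem_cases (hF : IsAltForest G F) (hx : x ∈ F.outer) :
    (∃ b ∈ F.blossom x, F.mate b = b ∧ F.stem x = F.blossom x) ∨
    ∃ u, F.Inner u ∧ F.mate u ∈ F.blossom x ∧ ∃ p ∈ F.outer, F.stem p = F.stem u ∧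
      F.stem x = F.blossom x ∪ insert u (F.stem p) := by
  obtain ⟨b, ⟨hb, hbase⟩, hbx⟩ := hF.exists_base x hx
  have hblossom : F.blossom b = F.blossom x := by simp only [blossom, hbx]
  by_cases hmate : F.mate b = b
  · exact .inl ⟨b, mem_blossom.2 ⟨hb, hbx⟩, hmate, by rw [← hbx, ← hblossom, hF.stem_root b hmate]⟩
  · have hu := hF.inner_mate hb (hbase.resolve_left hmate)
    obtain ⟨p, hp, -, hpu⟩ := hF.exists_parent _ hu
    refine .inr ⟨F.mate b, hu, ?_, p, hp, hpu, ?_⟩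
    · rw [hF.isMate.involutive]
      exact mem_blossom.2 ⟨hb, hbx⟩
    · rw [hpu, ← hbx, ← hblossom, ← hF.stem_base b hb hu.1]

theorem outer_induction (hF : IsAltForest G F) {P : ∀ x, x ∈ F.outer → Prop}
    (root : ∀ x b hx, b ∈ F.blossom x → F.mate b = b → F.stem x = F.blossom x → P x hx)
    (step : ∀ x u p hx hp, F.Inner u → F.mate u ∈ F.blossom x → F.stem p = F.stem u →
      F.stem x = F.blossom x ∪ insert u (F.stem p) → P p hp → P x hx) (x : V) (hx : x ∈ F.outer) :
    P x hx := by
  induction hn : (F.stem x).card using Nat.strong_induction_on generalizing x with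
  | _ n ih =>
    rcases hF.stem_cases hx with ⟨b, hb, hmate, hstem⟩ | ⟨u, hu, hub, p, hp, hpu, hstem⟩
    · exact root x b hx hb hmate hstem
    · refine step x u p hx hp hu hub hpu hstem (ih _ ?_ p hp rfl)
      have hlt : F.stem p ⊂ insert u (F.stem p) :=
        Finset.ssubset_insert (hpu ▸ hF.notMem_stem u hu)
      rw [← hn, hstem]
      exact Finset.card_lt_card (hlt.trans_subset Finset.subset_union_right)

theorem outer_or_inner (hF : IsAltForest G F) (hx : x ∈ F.outer) :
    ∀ y ∈ F.stem x, y ∈ F.outer ∨ F.Inner y := by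
  induction x, hx using hF.outer_induction with
  | root x _ _ _ _ hstem =>
    exact fun y hy => .inl (mem_blossom.1 (hstem ▸ hy)).1
  | step x u p _ _ hu _ _ hstem ih =>
    intro y hy
    rw [hstem, Finset.mem_union, Finset.mem_insert, mem_blossom] at hy
    rcases hy with hy | rfl | hy
    · exact .inl hy.1
    · exact .inr hu
    · exact ih y hy

theorem exists_outer_stem_eq (hF : IsAltForest G F) (hx : x ∈ F.outer ∨ F.Inner x) :
    ∃ p ∈ F.outer, F.stem p = F.stem x := by
  rcases hx with hx | hx
  · exact ⟨x, hx, rfl⟩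
  · obtain ⟨p, hp, -, hpx⟩ := hF.exists_parent x hx
    exact ⟨p, hp, hpx⟩

theorem stem_subset (hF : IsAltForest G F) (hx : x ∈ F.outer) :
    ∀ y ∈ F.stem x, F.stem y ⊆ F.stem x := by
  induction x, hx using hF.outer_induction with
  | root x _ _ _ _ hstem =>
    exact fun y hy => (mem_blossom.1 (hstem ▸ hy)).2.subset
  | step x u p _ _ _ _ hpu hstem ih =>
    intro y hy
    have hsub : F.stem p ⊆ F.stem x :=
      hstem ▸ (Finset.subset_insert u _).trans Finset.subset_union_right
    rw [hstem, Finset.mem_union, Finset.mem_insert, mem_blossom] at hy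
    rcases hy with hy | rfl | hy
    · exact hy.2.subset
    · exact hpu ▸ hsub
    · exact (ih y hy).trans hsub

theorem mate_mem_stem (hF : IsAltForest G F) (hx : x ∈ F.outer) :
    ∀ y ∈ F.stem x, F.mate y ∈ F.stem x := by
  have hmate_blossom : ∀ x y, y ∈ F.blossom x → F.mate y ∈ F.outer → F.mate y ∈ F.blossom x :=
    fun x y hy h => mem_blossom.2 ⟨h, (hF.stem_mate y (mem_blossom.1 hy).1 h).trans
      (mem_blossom.1 hy).2⟩
  have hbase : ∀ x y b, y ∈ F.blossom x → b ∈ F.blossom x → F.IsBase b → F.mate y ∉ F.outer →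
      y = b := fun x y b hy hb hbase h => hF.base_unique y b ⟨(mem_blossom.1 hy).1, .inr h⟩ hbase
        ((mem_blossom.1 hy).2.trans (mem_blossom.1 hb).2.symm)
  induction x, hx using hF.outer_induction with
  | root x b _ hb hmate hstem =>
    rw [hstem]
    intro y hy
    by_cases h : F.mate y ∈ F.outer
    · exact hmate_blossom x y hy h
    · obtain rfl := hbase x y b hy hb ⟨(mem_blossom.1 hb).1, .inl hmate⟩ h
      rwa [hmate]
  | step x u p _ _ hu hub _ hstem ih =>
    rw [hstem]
    intro y hy
    rw [Finset.mem_union, Finset.mem_insert] at hy ⊢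
    rcases hy with hy | rfl | hy
    · by_cases h : F.mate y ∈ F.outer
      · exact .inl (hmate_blossom x y hy h)
      · rw [hbase x y _ hy hub ⟨hu.2, .inr (by rw [hF.isMate.involutive]; exact hu.1)⟩ h,
          hF.isMate.involutive]
        exact .inr (.inl rfl)
    · exact .inl hub
    · exact .inr (.inr (ih y hy))

theorem stem_linear (hF : IsAltForest G F) (hx : x ∈ F.outer) (hy : y ∈ F.stem x)
    (hz : z ∈ F.stem x) : z ∈ F.stem y ∨ y ∈ insert z (F.stem z) := by
  induction x, hx using hF.outer_induction with
  | root x _ _ _ _ hstem =>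
    exact .inl ((mem_blossom.1 (hstem ▸ hy)).2 ▸ hz)
  | step x u p _ _ hu _ hpu hstem ih =>
    by_cases hyx : F.stem y = F.stem x
    · exact .inl (hyx ▸ hz)
    by_cases hzx : F.stem z = F.stem x
    · exact .inr (Finset.mem_insert_of_mem (hzx ▸ hy))
    rw [hstem, Finset.mem_union, mem_blossom, Finset.mem_insert] at hy hz
    replace hy := hy.resolve_left fun h => hyx h.2
    replace hz := hz.resolve_left fun h => hzx h.2
    rcases hy with rfl | hy <;> rcases hz with rfl | hz
    · exact .inr (Finset.mem_insert_self _ _)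
    · exact .inl (hpu ▸ hz)
    · exact .inr (Finset.mem_insert_of_mem (hpu ▸ hy))
    · exact ih hy hz

theorem exists_exposed_mem_stem (hF : IsAltForest G F) (hx : x ∈ F.outer) :
    ∃ e ∈ F.stem x, F.mate e = e := by
  induction x, hx using hF.outer_induction with
  | root x b _ hb hmate hstem => exact ⟨b, hstem ▸ hb, hmate⟩
  | step x u p _ _ _ _ _ hstem ih =>
    obtain ⟨e, he, hmate⟩ := ih
    exact ⟨e, hstem ▸ Finset.mem_union_right _ (Finset.mem_insert_of_mem he), hmate⟩

theorem exposed_mem_stem (hF : IsAltForest G F) (hv : v ∈ F.outer) (he : e ∈ F.stem v)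
    (hmate : F.mate e = e) (hx : x ∈ F.stem v) : e ∈ F.stem x := by
  have hee := hF.mem_stem e (hF.exposed_outer e hmate)
  rcases hF.stem_linear hv hx he with h | h
  · exact h
  · rcases Finset.mem_insert.1 h with rfl | h
    · exact hee
    · rw [hF.stem_root e hmate, mem_blossom] at h
      rwa [h.2]

theorem exists_stem_eq_inter (hF : IsAltForest G F) (hx : x ∈ F.outer) (hy : y ∈ F.outer)
    (h : (F.stem x ∩ F.stem y).Nonempty) : ∃ c ∈ F.outer, F.stem c = F.stem x ∩ F.stem y := by
  have hblossom : ∀ x, x ∈ F.outer → x ∉ F.stem y → Disjoint (F.blossom x) (F.stem y) :=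
    fun x hx hxy => Finset.disjoint_left.2 fun z hz hzy =>
      hxy (hF.stem_subset hy z hzy ((mem_blossom.1 hz).2 ▸ hF.mem_stem x hx))
  induction x, hx using hF.outer_induction with
  | root x _ hx _ _ hstem =>
    by_cases hxy : x ∈ F.stem y
    · exact ⟨x, hx, (Finset.inter_eq_left.2 (hF.stem_subset hy x hxy)).symm⟩
    · rw [hstem, Finset.disjoint_iff_inter_eq_empty.1 (hblossom x hx hxy)] at h
      exact absurd h Finset.not_nonempty_empty
  | step x u p hx _ _ hub _ hstem ih =>
    by_cases hxy : x ∈ F.stem y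
    · exact ⟨x, hx, (Finset.inter_eq_left.2 (hF.stem_subset hy x hxy)).symm⟩
    · have huy : u ∉ F.stem y := fun huy =>
        Finset.disjoint_left.1 (hblossom x hx hxy) hub (hF.mate_mem_stem hy u huy)
      have hinter : F.stem x ∩ F.stem y = F.stem p ∩ F.stem y := by
        rw [hstem, Finset.union_inter_distrib_right, Finset.insert_inter_of_notMem huy,
          Finset.disjoint_iff_inter_eq_empty.1 (hblossom x hx hxy), Finset.empty_union]
      rw [hinter] at h ⊢
      exact ih h

theorem notMem_insert_stem (hF : IsAltForest G F) (hv : v ∈ F.outer) (hu : F.Inner u)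
    (huv : u ∈ F.stem v) : v ∉ insert u (F.stem u) := by
  obtain ⟨p, hp, hpu⟩ := hF.exists_outer_stem_eq (.inr hu)
  rw [Finset.mem_insert, not_or]
  refine ⟨fun h => hu.1 (h ▸ hv), fun h => hF.notMem_stem u hu ?_⟩
  rw [← hpu] at h ⊢
  exact hF.stem_subset hp v h huv

theorem alt_mem_stem (hF : IsAltForest G F) (hx : x ∈ F.outer) {h : V → V} (hh : IsAlt G F x h)
    (hy : y ∈ F.stem x) : h y ∈ F.stem x := by
  by_contra hhy
  have hmate : F.mate (h y) = y := (hh.eq_mate _ hhy).symm.trans (hh.involutive y)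
  have := hF.mate_mem_stem hx y hy
  rw [← hmate, hF.isMate.involutive] at this
  exact hhy this

end IsAltForest

section Init

variable {V : Type*} [DecidableEq V] [Fintype V] {G : SimpleGraph V} {f : V → V}

/-- The forest of the matching `f` in which every exposed vertex is a tree of its own. -/
def AltForest.init (f : V → V) : AltForest V where
  mate := f
  outer := exposed f
  stem x := {x}
  alt _ := f

theorem isAltForest_init (hf : IsMate G f) : IsAltForest G (init f) := by
  have houter : ∀ x, x ∈ (init f).outer ↔ f x = x := fun x => mem_exposed
  have hmate : ∀ x, f x ∈ (init f).outer ↔ x ∈ (init f).outer := fun x => by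
    rw [houter, houter, hf.involutive, eq_comm]
  have hinner : ∀ u, ¬ (init f).Inner u := fun u hu => hu.1 ((hmate u).1 hu.2)
  refine
    { isMate := hf
      exposed_outer := fun x hx => (houter x).2 hx
      exists_parent := fun u hu => absurd hu (hinner u)
      notMem_stem := fun u hu => absurd hu (hinner u)
      mem_stem := fun x _ => Finset.mem_singleton_self x
      stem_mate := fun x hx _ => congrArg singleton ((houter x).1 hx)
      exists_base := fun x hx => ⟨x, ⟨hx, .inl ((houter x).1 hx)⟩, rfl⟩
      base_unique := fun b b' _ _ h => Finset.singleton_injective h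
      stem_root := fun b hb => ?_
      stem_base := fun b hb h => absurd ((hmate b).2 hb) h
      isAlt := fun x hx =>
        ⟨hf, fun y hy => ?_, fun _ _ => rfl, fun u _ hu => absurd hu (hinner u)⟩ }
  · ext y
    rw [mem_blossom, houter, show (init f).stem y = {y} from rfl,
      show (init f).stem b = {b} from rfl, Finset.singleton_inj, Finset.mem_singleton]
    exact ⟨fun h => ⟨h ▸ hb, h⟩, And.right⟩
  · obtain rfl := Finset.mem_singleton.1 hy
    exact iff_of_true ((houter y).1 hx) rfl

end Init

section Augment

variable {V : Type*} [DecidableEq V] {G : SimpleGraph V} {F : AltForest V} {v w x : V}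

/-- The matching obtained by augmenting along the edge `vw` between two trees. -/
def AltForest.augment (F : AltForest V) (v w : V) : V → V :=
  joinMate ((F.stem v).piecewise (F.alt v) ((F.stem w).piecewise (F.alt w) F.mate)) v w

theorem IsAltForest.isMate_piecewise (hF : IsAltForest G F) (hv : v ∈ F.outer) (hw : w ∈ F.outer)
    (hdisj : Disjoint (F.stem v) (F.stem w)) :
    IsMate G ((F.stem v).piecewise (F.alt v) ((F.stem w).piecewise (F.alt w) F.mate)) := by
  have hv' := hF.isAlt v hv
  have hw' := hF.isAlt w hw
  refine hv'.toIsMate.piecewise (hw'.toIsMate.piecewise hF.isMate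
    (fun x hx => hF.alt_mem_stem hw hw' hx) (hF.mate_mem_stem hw))
    (fun x hx => hF.alt_mem_stem hv hv' hx) fun x hx => ?_
  rw [Finset.piecewise_eq_of_notMem _ _ _ (Finset.disjoint_left.1 hdisj hx)]
  exact hF.mate_mem_stem hv x hx

theorem IsAltForest.piecewise_eq_self_iff (hF : IsAltForest G F) (hv : v ∈ F.outer)
    (hw : w ∈ F.outer) (hdisj : Disjoint (F.stem v) (F.stem w)) :
    (F.stem v).piecewise (F.alt v) ((F.stem w).piecewise (F.alt w) F.mate) x = x ↔
      x = v ∨ x = w ∨ F.mate x = x ∧ x ∉ F.stem v ∧ x ∉ F.stem w := by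
  have hne : ∀ {y z}, y ∈ F.outer → z ∉ F.stem y → z ≠ y := by
    rintro y _ hy hz rfl
    exact hz (hF.mem_stem _ hy)
  by_cases hxv : x ∈ F.stem v
  · have hxw := hne hw (Finset.disjoint_left.1 hdisj hxv)
    rw [Finset.piecewise_eq_of_mem _ _ _ hxv, (hF.isAlt v hv).fixed_iff x hxv]
    simp only [hxw, hxv, not_true_eq_false, false_and, and_false, or_false]
  · have hxv' := hne hv hxv
    rw [Finset.piecewise_eq_of_notMem _ _ _ hxv]
    by_cases hxw : x ∈ F.stem w
    · rw [Finset.piecewise_eq_of_mem _ _ _ hxw, (hF.isAlt w hw).fixed_iff x hxw]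
      simp only [hxv', hxw, not_true_eq_false, and_false, or_false, false_or]
    · rw [Finset.piecewise_eq_of_notMem _ _ _ hxw]
      simp only [hxv', hne hw hxw, hxv, hxw, not_false_eq_true, and_true, false_or]

theorem IsAltForest.isMate_augment (hF : IsAltForest G F) (hv : v ∈ F.outer) (hw : w ∈ F.outer)
    (hvw : G.Adj v w) (hdisj : Disjoint (F.stem v) (F.stem w)) : IsMate G (F.augment v w) :=
  (hF.isMate_piecewise hv hw hdisj).joinMate
    ((hF.piecewise_eq_self_iff hv hw hdisj).2 (.inl rfl))
    ((hF.piecewise_eq_self_iff hv hw hdisj).2 (.inr (.inl rfl))) hvw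

theorem IsAltForest.card_exposed_augment_lt [Fintype V] (hF : IsAltForest G F) (hv : v ∈ F.outer)
    (hw : w ∈ F.outer) (hvw : G.Adj v w) (hdisj : Disjoint (F.stem v) (F.stem w)) :
    (exposed (F.augment v w)).card < (exposed F.mate).card := by
  have hiff {x : V} := hF.piecewise_eq_self_iff (x := x) hv hw hdisj
  have hv' := hiff.2 (.inl rfl : v = v ∨ _)
  have hw' := hiff.2 (.inr (.inl rfl) : w = v ∨ w = w ∨ _)
  obtain ⟨e, he, hmate⟩ := hF.exists_exposed_mem_stem hv
  have hexposed : ∀ x, F.augment v w x = x → F.mate x = x ∧ x ∉ F.stem v := by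
    intro x hx
    have hxv : x ≠ v := fun h => hvw.ne' (by rwa [h, augment, joinMate_left hv'] at hx)
    have hxw : x ≠ w := fun h => hvw.ne (by rwa [h, augment, joinMate_right hw'] at hx)
    rw [augment, joinMate_of_ne (hF.isMate_piecewise hv hw hdisj).involutive hv' hw' hxv hxw,
      hiff] at hx
    obtain ⟨h, h', -⟩ := (hx.resolve_left hxv).resolve_left hxw
    exact ⟨h, h'⟩
  refine Finset.card_lt_card (Finset.ssubset_iff_of_subset ?_ |>.2
    ⟨e, mem_exposed.2 hmate, fun h => (hexposed e (mem_exposed.1 h)).2 he⟩)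
  exact fun x hx => mem_exposed.2 (hexposed x (mem_exposed.1 hx)).1

end Augment

section Grow

variable {V : Type*} [DecidableEq V] {G : SimpleGraph V} {F : AltForest V} {b u v w x y : V}

/-- The matching obtained from `F.alt v` by replacing the edge at `w` by the edge `vw`. -/
def AltForest.growMate (F : AltForest V) (v w : V) : V → V :=
  joinMate (dropMate (F.alt v) w) v w

/-- The forest in which the matched edge at `w` hangs from the outer vertex `v`. -/
def AltForest.grow (F : AltForest V) (v w : V) : AltForest V where
  mate := F.mate
  outer := insert (F.mate w) F.outer
  stem := Function.update (Function.update F.stem w (F.stem v)) (F.mate w)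
    (insert (F.mate w) (insert w (F.stem v)))
  alt := Function.update F.alt (F.mate w) (F.growMate v w)

namespace IsAltForest

theorem mate_ne_self (hF : IsAltForest G F) (hw : w ∉ F.outer) : F.mate w ≠ w :=
  fun h => hw (hF.exposed_outer w h)

theorem stem_grow_mate : (F.grow v w).stem (F.mate w) = insert (F.mate w) (insert w (F.stem v)) :=
  Function.update_self ..

theorem stem_grow_self (hF : IsAltForest G F) (hw : w ∉ F.outer) :
    (F.grow v w).stem w = F.stem v := by
  simp only [grow, Function.update_of_ne (hF.mate_ne_self hw).symm, Function.update_self]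

theorem stem_grow_of_ne (hxw : x ≠ w) (hx : x ≠ F.mate w) : (F.grow v w).stem x = F.stem x := by
  simp only [grow, Function.update_of_ne hx, Function.update_of_ne hxw]

theorem mem_outer_grow : x ∈ (F.grow v w).outer ↔ x = F.mate w ∨ x ∈ F.outer := Finset.mem_insert

theorem inner_grow (hF : IsAltForest G F) (hw : w ∉ F.outer) (hw' : F.mate w ∉ F.outer) :
    (F.grow v w).Inner u ↔ u = w ∨ F.Inner u := by
  have hmate : F.mate u = F.mate w ↔ u = w := hF.isMate.involutive.injective.eq_iff
  simp only [AltForest.Inner, mem_outer_grow, not_or, hmate,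
    show (F.grow v w).mate = F.mate from rfl]
  constructor
  · rintro ⟨⟨-, hu⟩, h⟩
    exact h.imp_right fun h => ⟨hu, h⟩
  · rintro (rfl | ⟨hu, h⟩)
    · exact ⟨⟨(hF.mate_ne_self hw).symm, hw⟩, .inl rfl⟩
    · exact ⟨⟨fun huw => hw (by rwa [huw, hF.isMate.involutive] at h), hu⟩, .inr h⟩

theorem isBase_grow (hF : IsAltForest G F) (hw : w ∉ F.outer) :
    (F.grow v w).IsBase b ↔ b = F.mate w ∨ F.IsBase b := by
  have hmate : F.mate b = F.mate w ↔ b = w := hF.isMate.involutive.injective.eq_iff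
  have hinv := hF.isMate.involutive w
  simp only [IsBase, mem_outer_grow, not_or, show (F.grow v w).mate = F.mate from rfl, hmate]
  constructor
  · rintro ⟨rfl | hb, h⟩
    · exact .inl rfl
    · exact .inr ⟨hb, h.imp_right And.right⟩
  · rintro (rfl | ⟨hb, h⟩)
    · rw [hinv]
      exact ⟨.inl rfl, .inr ⟨hF.mate_ne_self hw, hw⟩⟩
    · exact ⟨.inr hb, h.imp_right fun h => ⟨fun hbw => hw (hbw ▸ hb), h⟩⟩

theorem notMem_stem_of_free (hF : IsAltForest G F) (hw : w ∉ F.outer) (hw' : F.mate w ∉ F.outer)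
    (hx : x ∈ F.outer ∨ F.Inner x) : w ∉ F.stem x := by
  obtain ⟨p, hp, hpx⟩ := hF.exists_outer_stem_eq hx
  exact hpx ▸ fun h => (hF.outer_or_inner hp w h).elim hw fun h => hw' h.2

theorem mate_notMem_stem_of_free (hF : IsAltForest G F) (hw : w ∉ F.outer)
    (hw' : F.mate w ∉ F.outer) (hx : x ∈ F.outer ∨ F.Inner x) : F.mate w ∉ F.stem x :=
  hF.notMem_stem_of_free hw' (by rwa [hF.isMate.involutive]) hx

theorem ne_mate_of_inner (hF : IsAltForest G F) (hw : w ∉ F.outer) (hu : F.Inner u) :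
    u ≠ F.mate w :=
  fun h => hw (by simpa only [h, hF.isMate.involutive w] using hu.2)

theorem stem_grow (hF : IsAltForest G F) (hw : w ∉ F.outer) (hw' : F.mate w ∉ F.outer)
    (hx : x ∈ F.outer ∨ F.Inner x) : (F.grow v w).stem x = F.stem x := by
  refine stem_grow_of_ne ?_ ?_ <;> rintro rfl
  · exact hx.elim hw fun h => hw' h.2
  · exact hx.elim hw' fun h => hF.ne_mate_of_inner hw h rfl

theorem blossom_grow (hF : IsAltForest G F) (hw : w ∉ F.outer) (hw' : F.mate w ∉ F.outer)
    (hx : x ∈ F.outer) : (F.grow v w).blossom x = F.blossom x := by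
  ext y
  rw [mem_blossom, mem_blossom, hF.stem_grow hw hw' (.inl hx)]
  refine ⟨fun ⟨hy, h⟩ => ?_, fun ⟨hy, h⟩ => ⟨mem_outer_grow.2 (.inr hy), ?_⟩⟩
  · rcases mem_outer_grow.1 hy with rfl | hy
    · have hmem : F.mate w ∈ F.stem x := h ▸ stem_grow_mate (v := v) ▸ Finset.mem_insert_self _ _
      exact absurd hmem (hF.mate_notMem_stem_of_free hw hw' (.inl hx))
    · exact ⟨hy, by rwa [hF.stem_grow hw hw' (.inl hy)] at h⟩
  · rwa [hF.stem_grow hw hw' (.inl hy)]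

theorem blossom_grow_mate (hF : IsAltForest G F) (hw : w ∉ F.outer) (hw' : F.mate w ∉ F.outer) :
    (F.grow v w).blossom (F.mate w) = {F.mate w} := by
  ext y
  rw [mem_blossom, Finset.mem_singleton]
  refine ⟨fun ⟨hy, h⟩ => ?_, ?_⟩
  swap
  · rintro rfl
    exact ⟨mem_outer_grow.2 (.inl rfl), rfl⟩
  refine (mem_outer_grow.1 hy).resolve_right fun hy => ?_
  have hmem : F.mate w ∈ F.stem y := by
    rw [← hF.stem_grow (v := v) hw hw' (.inl hy), h, stem_grow_mate]
    exact Finset.mem_insert_self _ _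
  exact hF.mate_notMem_stem_of_free hw hw' (.inl hy) hmem

theorem growMate_spec (hF : IsAltForest G F) (hv : v ∈ F.outer) (hw : w ∉ F.outer)
    (hw' : F.mate w ∉ F.outer) (hvw : G.Adj v w) :
    IsMate G (F.growMate v w) ∧ F.growMate v w v = w ∧ F.growMate v w w = v ∧
      F.growMate v w (F.mate w) = F.mate w ∧
      ∀ y, y ≠ v → y ≠ w → y ≠ F.mate w → F.growMate v w y = F.alt v y := by
  have halt := hF.isAlt v hv
  have hw_alt : F.alt v w = F.mate w := halt.eq_mate w (hF.notMem_stem_of_free hw hw' (.inl hv))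
  have hdrop := halt.toIsMate.dropMate w
  have hdrop_of_ne : ∀ y, y ≠ w → y ≠ F.mate w → dropMate (F.alt v) w y = F.alt v y :=
    fun y h h' => dropMate_of_ne (not_or.2 ⟨h, hw_alt ▸ h'⟩)
  have hv_ne_mate : v ≠ F.mate w := fun h => hw' (h ▸ hv)
  have hdrop_v : dropMate (F.alt v) w v = v :=
    (hdrop_of_ne v hvw.ne hv_ne_mate).trans ((halt.fixed_iff v (hF.mem_stem v hv)).2 rfl)
  have hdrop_w : dropMate (F.alt v) w w = w := dropMate_of_eq (.inl rfl)
  have hne {y : V} := joinMate_of_ne (x := y) hdrop.involutive hdrop_v hdrop_w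
  exact ⟨hdrop.joinMate hdrop_v hdrop_w hvw, joinMate_left hdrop_v, joinMate_right hdrop_w,
    (hne hv_ne_mate.symm (hF.mate_ne_self hw)).trans (dropMate_of_eq (.inr hw_alt.symm)),
    fun y hyv hyw hy => (hne hyv hyw).trans (hdrop_of_ne y hyw hy)⟩

theorem ne_of_mem_stem (hF : IsAltForest G F) (hv : v ∈ F.outer) (hw : w ∉ F.outer)
    (hw' : F.mate w ∉ F.outer) (hy : y ∈ F.stem v) : y ≠ w ∧ y ≠ F.mate w :=
  ⟨fun h => hF.notMem_stem_of_free hw hw' (.inl hv) (h ▸ hy),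
    fun h => hF.mate_notMem_stem_of_free hw hw' (.inl hv) (h ▸ hy)⟩

theorem growMate_eq_self_iff (hF : IsAltForest G F) (hv : v ∈ F.outer) (hw : w ∉ F.outer)
    (hw' : F.mate w ∉ F.outer) (hvw : G.Adj v w) (hy : y ∈ (F.grow v w).stem (F.mate w)) :
    F.growMate v w y = y ↔ y = F.mate w := by
  obtain ⟨-, h_v, h_w, h_mate, h_of_ne⟩ := hF.growMate_spec hv hw hw' hvw
  rw [stem_grow_mate, Finset.mem_insert, Finset.mem_insert] at hy
  rcases hy with rfl | rfl | hy
  · exact iff_of_true h_mate rfl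
  · exact iff_of_false (fun h => hvw.ne (h_w.symm.trans h)) (hF.mate_ne_self hw).symm
  · obtain ⟨hyw, hymate⟩ := hF.ne_of_mem_stem hv hw hw' hy
    refine iff_of_false (fun hfix => ?_) hymate
    by_cases hyv : y = v
    · exact hvw.ne' (by rwa [hyv, h_v] at hfix)
    · exact hyv (((hF.isAlt v hv).fixed_iff y hy).1 (h_of_ne y hyv hyw hymate ▸ hfix))

theorem isAlt_growMate (hF : IsAltForest G F) (hv : v ∈ F.outer) (hw : w ∉ F.outer)
    (hw' : F.mate w ∉ F.outer) (hvw : G.Adj v w) :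
    IsAlt G (F.grow v w) (F.mate w) (F.growMate v w) := by
  have halt := hF.isAlt v hv
  have hvv := hF.mem_stem v hv
  obtain ⟨hmatch, h_v, h_w, -, h_of_ne⟩ := hF.growMate_spec hv hw hw' hvw
  have h_stem : ∀ y ∈ F.stem v, y ≠ v → F.growMate v w y = F.alt v y := fun y hy hyv =>
    h_of_ne y hyv (hF.ne_of_mem_stem hv hw hw' hy).1 (hF.ne_of_mem_stem hv hw hw' hy).2
  refine ⟨hmatch, fun y hy => hF.growMate_eq_self_iff hv hw hw' hvw hy, fun y hy => ?_,
    fun u hu hinner => ?_⟩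
  · simp only [stem_grow_mate, Finset.mem_insert, not_or] at hy
    rw [h_of_ne y (fun h => hy.2.2 (h ▸ hvv)) hy.2.1 hy.1]
    exact halt.eq_mate y hy.2.2
  · rcases (hF.inner_grow hw hw').1 hinner with rfl | hinner
    · rw [hF.stem_grow_self hw]
      intro y hy
      rcases Finset.mem_insert.1 hy with rfl | hy
      · rw [h_w]
        exact Finset.mem_insert_of_mem hvv
      by_cases hyv : y = v
      · rw [hyv, h_v]
        exact Finset.mem_insert_self _ _
      · rw [h_stem y hy hyv]
        exact Finset.mem_insert_of_mem (hF.alt_mem_stem hv halt hy)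
    · rw [hF.stem_grow hw hw' (.inr hinner)]
      simp only [stem_grow_mate, Finset.mem_insert] at hu
      have huv : u ∈ F.stem v := (hu.resolve_left (hF.ne_mate_of_inner hw hinner)).resolve_left
        fun h => hw' (h ▸ hinner.2)
      intro y hy
      have hyv : y ∈ F.stem v := (Finset.mem_insert.1 hy).elim (· ▸ huv) (hF.stem_subset hv u huv ·)
      rw [h_stem y hyv fun h => hF.notMem_insert_stem hv hinner huv (h ▸ hy)]
      exact halt.insert_stem u huv hinner y hy

theorem isAlt_grow (hF : IsAltForest G F) (hw : w ∉ F.outer) (hw' : F.mate w ∉ F.outer)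
    (hx : x ∈ F.outer) : IsAlt G (F.grow v w) x (F.alt x) := by
  have halt := hF.isAlt x hx
  have hstem := hF.stem_grow (v := v) hw hw' (.inl hx)
  refine ⟨halt.toIsMate, hstem ▸ halt.fixed_iff, hstem ▸ halt.eq_mate, fun u hu hinner => ?_⟩
  rw [hstem] at hu
  have hinner := ((hF.inner_grow hw hw').1 hinner).resolve_left
    fun h => hF.notMem_stem_of_free hw hw' (.inl hx) (h ▸ hu)
  rw [hF.stem_grow hw hw' (.inr hinner)]
  exact halt.insert_stem u hu hinner

theorem exists_parent_grow (hF : IsAltForest G F) (hv : v ∈ F.outer) (hw : w ∉ F.outer)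
    (hw' : F.mate w ∉ F.outer) (hvw : G.Adj v w) (hu : (F.grow v w).Inner u) :
    ∃ p ∈ (F.grow v w).outer, G.Adj u p ∧ (F.grow v w).stem p = (F.grow v w).stem u := by
  rcases (hF.inner_grow hw hw').1 hu with rfl | hu
  · exact ⟨v, mem_outer_grow.2 (.inr hv), hvw.symm,
      (hF.stem_grow hw hw' (.inl hv)).trans (hF.stem_grow_self hw).symm⟩
  · obtain ⟨p, hp, hup, hpu⟩ := hF.exists_parent u hu
    exact ⟨p, mem_outer_grow.2 (.inr hp), hup,
      by rw [hF.stem_grow hw hw' (.inl hp), hF.stem_grow hw hw' (.inr hu), hpu]⟩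

theorem base_unique_grow (hF : IsAltForest G F) (hw : w ∉ F.outer) (hw' : F.mate w ∉ F.outer)
    (hb : (F.grow v w).IsBase b) (hx : (F.grow v w).IsBase x)
    (h : (F.grow v w).stem b = (F.grow v w).stem x) : b = x := by
  have hne : ∀ b, F.IsBase b → (F.grow v w).stem b ≠ (F.grow v w).stem (F.mate w) := by
    intro b hb h
    rw [hF.stem_grow hw hw' (.inl hb.1), stem_grow_mate] at h
    exact hF.mate_notMem_stem_of_free hw hw' (.inl hb.1) (h ▸ Finset.mem_insert_self _ _)
  rcases (hF.isBase_grow hw).1 hb with rfl | hb <;> rcases (hF.isBase_grow hw).1 hx with rfl | hx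
  · rfl
  · exact absurd h.symm (hne x hx)
  · exact absurd h (hne b hb)
  · rw [hF.stem_grow hw hw' (.inl hb.1), hF.stem_grow hw hw' (.inl hx.1)] at h
    exact hF.base_unique b x hb hx h

theorem stem_base_grow (hF : IsAltForest G F) (hw : w ∉ F.outer) (hw' : F.mate w ∉ F.outer)
    (hb : b ∈ (F.grow v w).outer) (h : F.mate b ∉ (F.grow v w).outer) :
    (F.grow v w).stem b =
      (F.grow v w).blossom b ∪ insert (F.mate b) ((F.grow v w).stem (F.mate b)) := by
  rcases mem_outer_grow.1 hb with rfl | hb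
  · rw [hF.blossom_grow_mate hw hw', stem_grow_mate, hF.isMate.involutive w, hF.stem_grow_self hw]
    rfl
  · have h' : F.mate b ∉ F.outer := fun h' => h (mem_outer_grow.2 (.inr h'))
    rw [hF.stem_grow hw hw' (.inl hb), hF.blossom_grow hw hw' hb,
      hF.stem_grow hw hw' (.inr (hF.inner_mate hb h'))]
    exact hF.stem_base b hb h'

theorem grow (hF : IsAltForest G F) (hv : v ∈ F.outer) (hw : w ∉ F.outer)
    (hw' : F.mate w ∉ F.outer) (hvw : G.Adj v w) : IsAltForest G (F.grow v w) := by
  have hstem : ∀ x ∈ F.outer, (F.grow v w).stem x = F.stem x :=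
    fun x hx => hF.stem_grow hw hw' (.inl hx)
  have hmate_mate : (F.grow v w).mate (F.mate w) = w := hF.isMate.involutive w
  refine
    { isMate := hF.isMate
      exposed_outer := fun x hx => mem_outer_grow.2 (.inr (hF.exposed_outer x hx))
      exists_parent := fun u => hF.exists_parent_grow hv hw hw' hvw
      notMem_stem := fun u hu => ?_
      mem_stem := fun x hx => ?_
      stem_mate := fun x hx h => ?_
      exists_base := fun x hx => ?_
      base_unique := fun b b' => hF.base_unique_grow hw hw'
      stem_root := fun b hb => ?_
      stem_base := fun b hb h => hF.stem_base_grow hw hw' hb h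
      isAlt := fun x hx => ?_ }
  · rcases (hF.inner_grow hw hw').1 hu with rfl | hu
    · exact hF.stem_grow_self hw ▸ hF.notMem_stem_of_free hw hw' (.inl hv)
    · exact hF.stem_grow hw hw' (.inr hu) ▸ hF.notMem_stem u hu
  · rcases mem_outer_grow.1 hx with rfl | hx
    · exact stem_grow_mate (v := v) ▸ Finset.mem_insert_self _ _
    · exact hstem x hx ▸ hF.mem_stem x hx
  · rcases mem_outer_grow.1 hx with rfl | hx
    · rw [hmate_mate] at h
      exact absurd h fun h => (mem_outer_grow.1 h).elim (hF.mate_ne_self hw).symm hw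
    · have h : F.mate x ∈ F.outer := (mem_outer_grow.1 h).resolve_left
        fun h => hw (hF.isMate.involutive.injective h ▸ hx)
      exact (hstem _ h).trans ((hF.stem_mate x hx h).trans (hstem x hx).symm)
  · rcases mem_outer_grow.1 hx with rfl | hx
    · exact ⟨F.mate w, (hF.isBase_grow hw).2 (.inl rfl), rfl⟩
    · obtain ⟨b, hb, hbx⟩ := hF.exists_base x hx
      exact ⟨b, (hF.isBase_grow hw).2 (.inr hb), by rw [hstem b hb.1, hstem x hx, hbx]⟩
  · have hb' := hF.exposed_outer b hb
    rw [hstem b hb', hF.blossom_grow hw hw' hb']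
    exact hF.stem_root b hb
  · rcases mem_outer_grow.1 hx with rfl | hx
    · simpa only [AltForest.grow, Function.update_self] using hF.isAlt_growMate hv hw hw' hvw
    · have hne : x ≠ F.mate w := fun h => hw' (h ▸ hx)
      simpa only [AltForest.grow, Function.update_of_ne hne] using hF.isAlt_grow hw hw' hx

end IsAltForest

end Grow

section Contract

variable {V : Type*} [DecidableEq V] {G : SimpleGraph V} {F : AltForest V} {b u v w x y z : V}

/-- The blossom that arises from the edge `vw`: the odd cycle closed by `vw`, together with the
blossoms on it. -/
def AltForest.newBlossom (F : AltForest V) (v w : V) : Finset V :=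
  (F.stem v ∪ F.stem w).filter (F.stem v ∩ F.stem w ⊆ F.stem ·)

/-- The matching that leaves `x` exposed by an alternating walk through the edge `vw`, for an inner
vertex `x` in the stem of `v`. -/
def AltForest.bypass (F : AltForest V) (v w x : V) : V → V :=
  joinMate ((F.stem v \ insert x (F.stem x)).piecewise (F.alt v)
    ((F.stem w).piecewise (F.alt w) (dropMate F.mate x))) v w

/-- The forest in which the odd cycle closed by the edge `vw` is contracted to a blossom. -/
def AltForest.contract (F : AltForest V) (v w : V) : AltForest V where
  mate := F.mate
  outer := F.outer ∪ F.newBlossom v w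
  stem x := if F.stem v ∩ F.stem w ⊆ F.stem x then F.stem x ∪ (F.stem v ∪ F.stem w) else F.stem x
  alt x := if x ∈ F.outer then F.alt x else
    if x ∈ F.stem v then F.bypass v w x else F.bypass w v x

theorem AltForest.mem_newBlossom :
    x ∈ F.newBlossom v w ↔ x ∈ F.stem v ∪ F.stem w ∧ F.stem v ∩ F.stem w ⊆ F.stem x :=
  Finset.mem_filter

theorem AltForest.newBlossom_comm : F.newBlossom v w = F.newBlossom w v := by
  rw [newBlossom, newBlossom, Finset.union_comm, Finset.inter_comm]

theorem AltForest.mem_outer_contract :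
    x ∈ (F.contract v w).outer ↔ x ∈ F.outer ∨ x ∈ F.newBlossom v w := Finset.mem_union

theorem AltForest.stem_contract_of_subset (h : F.stem v ∩ F.stem w ⊆ F.stem x) :
    (F.contract v w).stem x = F.stem x ∪ (F.stem v ∪ F.stem w) := if_pos h

theorem AltForest.stem_contract_of_not_subset (h : ¬ F.stem v ∩ F.stem w ⊆ F.stem x) :
    (F.contract v w).stem x = F.stem x := if_neg h

theorem AltForest.stem_contract_congr (h : F.stem x = F.stem y) :
    (F.contract v w).stem x = (F.contract v w).stem y := by simp only [contract, h]

theorem AltForest.mem_newBlossom_congr (hx : x ∈ F.stem x) (h : F.stem x = F.stem y)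
    (hsub : F.stem y ⊆ F.stem v ∪ F.stem w) (hy : y ∈ F.newBlossom v w) : x ∈ F.newBlossom v w :=
  mem_newBlossom.2 ⟨hsub (h ▸ hx), h ▸ (mem_newBlossom.1 hy).2⟩

namespace IsAltForest

theorem inter_subset_stem (hF : IsAltForest G F) (hv : v ∈ F.outer) (hw : w ∈ F.outer)
    (hz : z ∈ F.stem v) (hzw : z ∉ F.stem w) : F.stem v ∩ F.stem w ⊆ F.stem z := by
  intro y hy
  obtain ⟨hyv, hyw⟩ := Finset.mem_inter.1 hy
  refine (hF.stem_linear hv hz hyv).resolve_right fun h => hzw ?_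
  exact (Finset.mem_insert.1 h).elim (· ▸ hyw) (hF.stem_subset hw y hyw ·)

theorem stem_subset_union (hF : IsAltForest G F) (hv : v ∈ F.outer) (hw : w ∈ F.outer)
    (hx : x ∈ F.stem v ∪ F.stem w) : F.stem x ⊆ F.stem v ∪ F.stem w :=
  (Finset.mem_union.1 hx).elim
    (fun h => (hF.stem_subset hv x h).trans Finset.subset_union_left)
    (fun h => (hF.stem_subset hw x h).trans Finset.subset_union_right)

theorem stem_subset_inter (hF : IsAltForest G F) (hv : v ∈ F.outer) (hw : w ∈ F.outer)
    (hx : x ∈ F.stem v ∩ F.stem w) : F.stem x ⊆ F.stem v ∩ F.stem w :=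
  Finset.subset_inter (hF.stem_subset hv x (Finset.mem_inter.1 hx).1)
    (hF.stem_subset hw x (Finset.mem_inter.1 hx).2)

theorem mem_newBlossom_or_mem_inter (hF : IsAltForest G F) (hv : v ∈ F.outer) (hw : w ∈ F.outer)
    (hx : x ∈ F.stem v ∪ F.stem w) : x ∈ F.newBlossom v w ∨ x ∈ F.stem v ∩ F.stem w := by
  by_cases hxv : x ∈ F.stem v <;> by_cases hxw : x ∈ F.stem w
  · exact .inr (Finset.mem_inter.2 ⟨hxv, hxw⟩)
  · exact .inl (mem_newBlossom.2 ⟨hx, hF.inter_subset_stem hv hw hxv hxw⟩)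
  · exact .inl (mem_newBlossom.2 ⟨hx, Finset.inter_comm (F.stem w) _ ▸
      hF.inter_subset_stem hw hv hxw hxv⟩)
  · exact absurd hx fun h => (Finset.mem_union.1 h).elim hxv hxw

theorem outer_of_mem_newBlossom (hF : IsAltForest G F) (hv : v ∈ F.outer) (hw : w ∈ F.outer)
    (hx : x ∈ F.newBlossom v w) (hxC : x ∈ F.stem v ∩ F.stem w) :
    x ∈ F.outer ∧ F.stem x = F.stem v ∩ F.stem w := by
  have hsub := (mem_newBlossom.1 hx).2
  exact ⟨(hF.outer_or_inner hv x (Finset.mem_inter.1 hxC).1).resolve_right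
    fun h => hF.notMem_stem x h (hsub hxC), (hF.stem_subset_inter hv hw hxC).antisymm hsub⟩

theorem outer_or_inner_of_mem_union (hF : IsAltForest G F) (hv : v ∈ F.outer) (hw : w ∈ F.outer)
    (hx : x ∈ F.stem v ∪ F.stem w) : x ∈ F.outer ∨ F.Inner x :=
  (Finset.mem_union.1 hx).elim (hF.outer_or_inner hv x) (hF.outer_or_inner hw x)

theorem mate_mem_union (hF : IsAltForest G F) (hv : v ∈ F.outer) (hw : w ∈ F.outer)
    (hx : x ∈ F.stem v ∪ F.stem w) : F.mate x ∈ F.stem v ∪ F.stem w :=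
  Finset.mem_union.2 ((Finset.mem_union.1 hx).imp (hF.mate_mem_stem hv x) (hF.mate_mem_stem hw x))

theorem exposed_mem_inter (hF : IsAltForest G F) (hv : v ∈ F.outer) (hw : w ∈ F.outer)
    (hC : (F.stem v ∩ F.stem w).Nonempty) (hx : x ∈ F.stem v ∪ F.stem w) (hmate : F.mate x = x) :
    x ∈ F.stem v ∩ F.stem w := by
  obtain ⟨c, hc⟩ := hC
  obtain ⟨hcv, hcw⟩ := Finset.mem_inter.1 hc
  exact hF.stem_subset_inter hv hw hc <| (Finset.mem_union.1 hx).elim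
    (fun h => hF.exposed_mem_stem hv h hmate hcv) (fun h => hF.exposed_mem_stem hw h hmate hcw)

theorem stem_contract_of_mem (hF : IsAltForest G F) (hv : v ∈ F.outer) (hw : w ∈ F.outer)
    (hx : x ∈ F.newBlossom v w) : (F.contract v w).stem x = F.stem v ∪ F.stem w := by
  obtain ⟨hxD, hsub⟩ := mem_newBlossom.1 hx
  rw [stem_contract_of_subset hsub, Finset.union_eq_right.2 (hF.stem_subset_union hv hw hxD)]

theorem stem_contract_eq_iff (hF : IsAltForest G F) (hv : v ∈ F.outer) (hw : w ∈ F.outer)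
    (hx : x ∈ (F.contract v w).outer) (hy : y ∈ F.outer) (hyB : y ∉ F.newBlossom v w) :
    (F.contract v w).stem x = (F.contract v w).stem y ↔ x ∈ F.outer ∧ F.stem x = F.stem y := by
  have houtside : ∀ z ∈ F.outer, z ∉ F.newBlossom v w → F.stem v ∩ F.stem w ⊆ F.stem z →
      z ∈ (F.contract v w).stem z ∧ z ∉ F.stem v ∪ F.stem w := fun z hz hzB hsub =>
    ⟨stem_contract_of_subset hsub ▸ Finset.mem_union_left _ (hF.mem_stem z hz),
      fun h => hzB (mem_newBlossom.2 ⟨h, hsub⟩)⟩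
  have hmem : ∀ z t, F.stem v ∩ F.stem w ⊆ F.stem z →
      (F.contract v w).stem z = (F.contract v w).stem t → F.stem v ∩ F.stem w ⊆ F.stem t := by
    intro z t hz h
    by_contra ht
    rw [stem_contract_of_not_subset ht, stem_contract_of_subset hz] at h
    exact ht (h ▸ hz.trans Finset.subset_union_left)
  refine ⟨fun h => ?_, fun h => stem_contract_congr h.2⟩
  have hxB : x ∉ F.newBlossom v w := by
    intro hxB
    obtain ⟨hyy, hyD⟩ := houtside y hy hyB (hmem x y (mem_newBlossom.1 hxB).2 h)
    exact hyD (hF.stem_contract_of_mem hv hw hxB ▸ h ▸ hyy)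
  have hx := (mem_outer_contract.1 hx).resolve_right hxB
  refine ⟨hx, ?_⟩
  by_cases hxC : F.stem v ∩ F.stem w ⊆ F.stem x
  · have hyC := hmem x y hxC h
    obtain ⟨hxx, hxD⟩ := houtside x hx hxB hxC
    obtain ⟨hyy, hyD⟩ := houtside y hy hyB hyC
    rw [h, stem_contract_of_subset hyC] at hxx
    rw [← h, stem_contract_of_subset hxC] at hyy
    exact (hF.stem_subset hy x ((Finset.mem_union.1 hxx).resolve_right hxD)).antisymm
      (hF.stem_subset hx y ((Finset.mem_union.1 hyy).resolve_right hyD))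
  · have hyC : ¬ F.stem v ∩ F.stem w ⊆ F.stem y := fun hyC => hxC (hmem y x hyC h.symm)
    rwa [stem_contract_of_not_subset hxC, stem_contract_of_not_subset hyC] at h

theorem blossom_contract_of_mem (hF : IsAltForest G F) (hv : v ∈ F.outer) (hw : w ∈ F.outer)
    (hx : x ∈ F.newBlossom v w) : (F.contract v w).blossom x = F.newBlossom v w := by
  ext y
  rw [mem_blossom]
  refine ⟨fun ⟨hy, h⟩ => ?_, fun hy => ⟨mem_outer_contract.2 (.inr hy), ?_⟩⟩
  · refine (mem_outer_contract.1 hy).elim (fun hy => ?_) id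
    by_contra hyB
    obtain ⟨-, hxy⟩ := (hF.stem_contract_eq_iff hv hw (mem_outer_contract.2 (.inr hx)) hy hyB).1
      h.symm
    exact hyB (mem_newBlossom_congr (hF.mem_stem y hy) hxy.symm
      (hF.stem_subset_union hv hw (mem_newBlossom.1 hx).1) hx)
  · rw [hF.stem_contract_of_mem hv hw hx, hF.stem_contract_of_mem hv hw hy]

theorem blossom_contract_of_notMem (hF : IsAltForest G F) (hv : v ∈ F.outer) (hw : w ∈ F.outer)
    (hx : x ∈ F.outer) (hxB : x ∉ F.newBlossom v w) :
    (F.contract v w).blossom x = F.blossom x := by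
  ext y
  rw [mem_blossom, mem_blossom]
  refine ⟨fun ⟨hy, h⟩ => (hF.stem_contract_eq_iff hv hw hy hx hxB).1 h, fun h => ?_⟩
  have hy : y ∈ (F.contract v w).outer := mem_outer_contract.2 (.inl h.1)
  exact ⟨hy, (hF.stem_contract_eq_iff hv hw hy hx hxB).2 h⟩

theorem inner_contract (hF : IsAltForest G F) (hv : v ∈ F.outer) (hw : w ∈ F.outer) :
    (F.contract v w).Inner u ↔ F.Inner u ∧ u ∉ F.newBlossom v w := by
  simp only [AltForest.Inner, mem_outer_contract, not_or,
    show (F.contract v w).mate = F.mate from rfl]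
  refine ⟨fun ⟨⟨hu, huB⟩, h⟩ => ⟨⟨hu, h.elim id fun h => ?_⟩, huB⟩,
    fun ⟨⟨hu, h⟩, huB⟩ => ⟨⟨hu, huB⟩, .inl h⟩⟩
  refine (hF.outer_or_inner_of_mem_union hv hw (mem_newBlossom.1 h).1).resolve_right fun h => ?_
  exact hu (by simpa only [hF.isMate.involutive u] using h.2)

theorem mate_mem_newBlossom (hF : IsAltForest G F) (hv : v ∈ F.outer) (hw : w ∈ F.outer)
    (hx : x ∈ F.newBlossom v w) (h : F.mate x ∈ (F.contract v w).outer) :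
    F.mate x ∈ F.newBlossom v w := by
  obtain ⟨hxD, hsub⟩ := mem_newBlossom.1 hx
  refine (mem_outer_contract.1 h).elim (fun h => ?_) id
  refine mem_newBlossom.2 ⟨hF.mate_mem_union hv hw hxD, ?_⟩
  rcases hF.outer_or_inner_of_mem_union hv hw hxD with hx | hx
  · rwa [hF.stem_mate x hx h]
  · rw [hF.stem_mate_inner hx]
    exact hsub.trans ((Finset.subset_insert _ _).trans Finset.subset_union_right)

theorem isBase_contract_of_notMem (hF : IsAltForest G F) (hv : v ∈ F.outer) (hw : w ∈ F.outer)
    (hb : b ∉ F.newBlossom v w) : (F.contract v w).IsBase b ↔ F.IsBase b := by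
  have hmate : (F.contract v w).mate = F.mate := rfl
  simp only [IsBase, mem_outer_contract, hb, or_false, not_or, hmate]
  refine and_congr_right fun hb' => or_congr_right ⟨And.left, fun h => ⟨h, fun hB => hb ?_⟩⟩
  have := hF.mate_mem_newBlossom hv hw hB
    (by rw [hF.isMate.involutive]; exact mem_outer_contract.2 (.inl hb'))
  rwa [hF.isMate.involutive] at this

theorem isBase_contract_of_mem (hF : IsAltForest G F) (hv : v ∈ F.outer) (hw : w ∈ F.outer)
    (hC : (F.stem v ∩ F.stem w).Nonempty) (hb : b ∈ F.newBlossom v w) :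
    (F.contract v w).IsBase b ↔ F.IsBase b ∧ F.stem b = F.stem v ∩ F.stem w := by
  obtain ⟨hbD, -⟩ := mem_newBlossom.1 hb
  constructor
  · rintro ⟨-, h⟩
    have hbC : b ∈ F.stem v ∩ F.stem w := by
      refine h.elim (hF.exposed_mem_inter hv hw hC hbD) fun h => ?_
      have hmate := (hF.mem_newBlossom_or_mem_inter hv hw
        (hF.mate_mem_union hv hw hbD)).resolve_left fun h' => h (mem_outer_contract.2 (.inr h'))
      rw [← hF.isMate.involutive b]
      exact Finset.mem_inter.2 ((Finset.mem_inter.1 hmate).imp (hF.mate_mem_stem hv _)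
        (hF.mate_mem_stem hw _))
    obtain ⟨hb, hstem⟩ := hF.outer_of_mem_newBlossom hv hw hb hbC
    exact ⟨⟨hb, h.imp_right fun h h' => h (mem_outer_contract.2 (.inl h'))⟩, hstem⟩
  · rintro ⟨⟨hb, h⟩, hstem⟩
    refine ⟨mem_outer_contract.2 (.inl hb), h.imp_right fun h h' => ?_⟩
    have hmate := (mem_newBlossom.1 ((mem_outer_contract.1 h').resolve_left h)).2
    refine hF.notMem_stem _ (hF.inner_mate hb h) (hmate ?_)
    exact hstem ▸ hF.mate_mem_stem hb b (hF.mem_stem b hb)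

theorem exists_base_contract (hF : IsAltForest G F) (hv : v ∈ F.outer) (hw : w ∈ F.outer)
    (hC : (F.stem v ∩ F.stem w).Nonempty) (hx : x ∈ (F.contract v w).outer) :
    ∃ b, (F.contract v w).IsBase b ∧ (F.contract v w).stem b = (F.contract v w).stem x := by
  by_cases hxB : x ∈ F.newBlossom v w
  · obtain ⟨c, hc, hcC⟩ := hF.exists_stem_eq_inter hv hw hC
    obtain ⟨b, hb, hbc⟩ := hF.exists_base c hc
    have hstem : F.stem b = F.stem v ∩ F.stem w := hbc.trans hcC
    have hbB : b ∈ F.newBlossom v w := mem_newBlossom.2 ⟨Finset.mem_union_left _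
      (Finset.mem_inter.1 (hstem ▸ hF.mem_stem b hb.1)).1, hstem.superset⟩
    refine ⟨b, (hF.isBase_contract_of_mem hv hw hC hbB).2 ⟨hb, hstem⟩, ?_⟩
    rw [hF.stem_contract_of_mem hv hw hbB, hF.stem_contract_of_mem hv hw hxB]
  · have hx := (mem_outer_contract.1 hx).resolve_right hxB
    obtain ⟨b, hb, hbx⟩ := hF.exists_base x hx
    have hbB : b ∉ F.newBlossom v w := fun hbB => hxB (mem_newBlossom_congr (hF.mem_stem x hx)
      hbx.symm (hF.stem_subset_union hv hw (mem_newBlossom.1 hbB).1) hbB)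
    exact ⟨b, (hF.isBase_contract_of_notMem hv hw hbB).2 hb, stem_contract_congr hbx⟩

theorem base_unique_contract (hF : IsAltForest G F) (hv : v ∈ F.outer) (hw : w ∈ F.outer)
    (hC : (F.stem v ∩ F.stem w).Nonempty) (hb : (F.contract v w).IsBase b)
    (hx : (F.contract v w).IsBase x) (h : (F.contract v w).stem b = (F.contract v w).stem x) :
    b = x := by
  have hblossom : b ∈ F.newBlossom v w ↔ x ∈ F.newBlossom v w := by
    have hmem : b ∈ (F.contract v w).blossom x := mem_blossom.2 ⟨hb.1, h⟩
    have hmem' : x ∈ (F.contract v w).blossom b := mem_blossom.2 ⟨hx.1, h.symm⟩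
    exact ⟨fun h => hF.blossom_contract_of_mem hv hw h ▸ hmem',
      fun h => hF.blossom_contract_of_mem hv hw h ▸ hmem⟩
  by_cases hbB : b ∈ F.newBlossom v w
  · obtain ⟨hb, hbC⟩ := (hF.isBase_contract_of_mem hv hw hC hbB).1 hb
    obtain ⟨hx, hxC⟩ := (hF.isBase_contract_of_mem hv hw hC (hblossom.1 hbB)).1 hx
    exact hF.base_unique b x hb hx (hbC.trans hxC.symm)
  · have hxB := fun hxB => hbB (hblossom.2 hxB)
    have hx' := (hF.isBase_contract_of_notMem hv hw hxB).1 hx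
    exact hF.base_unique b x ((hF.isBase_contract_of_notMem hv hw hbB).1 hb) hx'
      ((hF.stem_contract_eq_iff hv hw hb.1 hx'.1 hxB).1 h).2

theorem stem_root_contract (hF : IsAltForest G F) (hv : v ∈ F.outer) (hw : w ∈ F.outer)
    (hC : (F.stem v ∩ F.stem w).Nonempty) (hb : F.mate b = b) :
    (F.contract v w).stem b = (F.contract v w).blossom b := by
  have hbo := hF.exposed_outer b hb
  have hroot := hF.stem_root b hb
  by_cases hbB : b ∈ F.newBlossom v w
  · rw [hF.stem_contract_of_mem hv hw hbB, hF.blossom_contract_of_mem hv hw hbB]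
    refine (Finset.filter_true_of_mem fun y hy => ?_).symm
    refine (hF.mem_newBlossom_or_mem_inter hv hw hy).elim (fun h => (mem_newBlossom.1 h).2)
      fun hyC => ?_
    have hsub := (mem_newBlossom.1 hbB).2
    have hyb : y ∈ F.blossom b := hroot ▸ hsub hyC
    rwa [(mem_blossom.1 hyb).2]
  · rw [hF.blossom_contract_of_notMem hv hw hbo hbB, stem_contract_of_not_subset, hroot]
    intro hsub
    obtain ⟨c, hc⟩ := hC
    have hcb := (mem_blossom.1 (hroot ▸ hsub hc)).2
    have hbC := hF.stem_subset_inter hv hw hc (hcb ▸ hF.mem_stem b hbo)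
    exact hbB (mem_newBlossom.2 ⟨Finset.mem_union_left _ (Finset.mem_inter.1 hbC).1, hsub⟩)

theorem stem_base_contract_of_mem (hF : IsAltForest G F) (hv : v ∈ F.outer) (hw : w ∈ F.outer)
    (hC : (F.stem v ∩ F.stem w).Nonempty) (hb : b ∈ F.newBlossom v w)
    (h : F.mate b ∉ (F.contract v w).outer) : (F.contract v w).stem b =
      (F.contract v w).blossom b ∪ insert (F.mate b) ((F.contract v w).stem (F.mate b)) := by
  obtain ⟨hbase, hstem⟩ := (hF.isBase_contract_of_mem hv hw hC hb).1
    ⟨mem_outer_contract.2 (.inr hb), .inr h⟩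
  obtain ⟨hmate, hmateB⟩ := not_or.1 (mt mem_outer_contract.2 h)
  have hmateC : F.mate b ∈ F.stem v ∩ F.stem w :=
    hstem ▸ hF.mate_mem_stem hbase.1 b (hF.mem_stem b hbase.1)
  have hmateD := Finset.inter_subset_union hmateC
  have hsub : ¬ F.stem v ∩ F.stem w ⊆ F.stem (F.mate b) :=
    fun hsub => hmateB (mem_newBlossom.2 ⟨hmateD, hsub⟩)
  rw [hF.stem_contract_of_mem hv hw hb, hF.blossom_contract_of_mem hv hw hb,
    stem_contract_of_not_subset hsub]
  apply Finset.Subset.antisymm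
  · intro y hy
    refine Finset.mem_union.2 (or_iff_not_imp_left.2 fun hyB => ?_)
    have hyC := (hF.mem_newBlossom_or_mem_inter hv hw hy).resolve_left hyB
    rw [← hstem, hF.stem_base b hbase.1 hmate, Finset.mem_union, mem_blossom] at hyC
    exact hyC.resolve_left fun h => hyB (mem_newBlossom.2 ⟨hy, (h.2.trans hstem).superset⟩)
  · exact Finset.union_subset (Finset.filter_subset _ _)
      (Finset.insert_subset hmateD (hF.stem_subset_union hv hw hmateD))

theorem stem_base_contract_of_notMem (hF : IsAltForest G F) (hv : v ∈ F.outer) (hw : w ∈ F.outer)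
    (hC : (F.stem v ∩ F.stem w).Nonempty) (hb : b ∈ F.outer) (hbB : b ∉ F.newBlossom v w)
    (h : F.mate b ∉ F.outer) : (F.contract v w).stem b =
      (F.contract v w).blossom b ∪ insert (F.mate b) ((F.contract v w).stem (F.mate b)) := by
  have hstem := hF.stem_base b hb h
  have hinner := hF.inner_mate hb h
  have hsub : F.stem v ∩ F.stem w ⊆ F.stem b ↔ F.stem v ∩ F.stem w ⊆ F.stem (F.mate b) := by
    refine ⟨fun hsub => ?_, fun hsub => hstem ▸ hsub.trans
      ((Finset.subset_insert _ _).trans Finset.subset_union_right)⟩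
    obtain ⟨c, hc, hcC⟩ := hF.exists_stem_eq_inter hv hw hC
    have hcb := hstem ▸ hsub (hcC ▸ hF.mem_stem c hc)
    rw [Finset.mem_union, Finset.mem_insert, mem_blossom] at hcb
    rcases hcb with ⟨-, hcb⟩ | rfl | hcb
    · refine absurd (mem_newBlossom.2 ⟨?_, hsub⟩) hbB
      exact Finset.inter_subset_union (hcC ▸ hcb ▸ hF.mem_stem b hb)
    · exact absurd hc h
    · obtain ⟨p, hp, hpu⟩ := hF.exists_outer_stem_eq (.inr hinner)
      exact hcC ▸ hpu ▸ hF.stem_subset hp c (hpu ▸ hcb)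
  rw [hF.blossom_contract_of_notMem hv hw hb hbB]
  by_cases hb' : F.stem v ∩ F.stem w ⊆ F.stem b
  · rw [stem_contract_of_subset hb', stem_contract_of_subset (hsub.1 hb'), hstem,
      Finset.union_assoc, Finset.insert_union]
  · rw [stem_contract_of_not_subset hb', stem_contract_of_not_subset (mt hsub.2 hb'), hstem]

theorem isAlt_contract_of_outer (hF : IsAltForest G F) (hv : v ∈ F.outer) (hw : w ∈ F.outer)
    (hC : (F.stem v ∩ F.stem w).Nonempty) (hx : x ∈ F.outer) :
    IsAlt G (F.contract v w) x (F.alt x) := by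
  have halt := hF.isAlt x hx
  have hxx := hF.mem_stem x hx
  by_cases hsub : F.stem v ∩ F.stem w ⊆ F.stem x
  · have hstem := stem_contract_of_subset hsub
    refine ⟨halt.toIsMate, fun y hy => ?_, fun y hy => ?_, fun u hu hinner y hy => ?_⟩
    · by_cases hyx : y ∈ F.stem x
      · exact halt.fixed_iff y hyx
      · have hyD := (Finset.mem_union.1 (hstem ▸ hy)).resolve_left hyx
        rw [halt.eq_mate y hyx]
        exact iff_of_false (fun h => hyx (hsub (hF.exposed_mem_inter hv hw hC hyD h)))
          fun h => hyx (h ▸ hxx)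
    · exact halt.eq_mate y fun h => hy (hstem ▸ Finset.mem_union_left _ h)
    · obtain ⟨hinner, huB⟩ := (hF.inner_contract hv hw).1 hinner
      have hux : u ∈ F.stem x := (Finset.mem_union.1 (hstem ▸ hu)).elim id fun huD =>
        hsub ((hF.mem_newBlossom_or_mem_inter hv hw huD).resolve_left huB)
      by_cases hsub_u : F.stem v ∩ F.stem w ⊆ F.stem u
      · rw [stem_contract_of_subset hsub_u, ← Finset.insert_union] at hy ⊢
        by_cases hyu : y ∈ insert u (F.stem u)
        · exact Finset.mem_union_left _ (halt.insert_stem u hux hinner y hyu)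
        have hyD := (Finset.mem_union.1 hy).resolve_left hyu
        have hyx : y ∉ F.stem x := by
          intro hyx
          have huy := (hF.stem_linear hx hux hyx).resolve_left (hyu <| Finset.mem_insert_of_mem ·)
          refine huB (mem_newBlossom.2 ⟨?_, hsub_u⟩)
          exact (Finset.mem_insert.1 huy).elim (· ▸ hyD) (hF.stem_subset_union hv hw hyD ·)
        rw [halt.eq_mate y hyx]
        exact Finset.mem_union_right _ (hF.mate_mem_union hv hw hyD)
      · rw [stem_contract_of_not_subset hsub_u] at hy ⊢
        exact halt.insert_stem u hux hinner y hy
  · have hstem := stem_contract_of_not_subset hsub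
    refine ⟨halt.toIsMate, hstem ▸ halt.fixed_iff, hstem ▸ halt.eq_mate, fun u hu hinner => ?_⟩
    rw [hstem] at hu
    rw [stem_contract_of_not_subset fun h => hsub (h.trans (hF.stem_subset hx u hu))]
    exact halt.insert_stem u hu ((hF.inner_contract hv hw).1 hinner).1

theorem mate_notMem_insert_stem (hF : IsAltForest G F) (hu : F.Inner u) :
    F.mate u ∉ insert u (F.stem u) := by
  rw [Finset.mem_insert, not_or]
  refine ⟨fun h => hu.1 (h ▸ hu.2), fun h => hF.notMem_stem u hu ?_⟩
  obtain ⟨p, hp, hpu⟩ := hF.exists_outer_stem_eq (.inr hu)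
  have := hF.mate_mem_stem hp (F.mate u) (hpu ▸ h)
  rwa [hF.isMate.involutive, hpu] at this

theorem disjoint_sdiff_stem (h : F.stem v ∩ F.stem w ⊆ F.stem x) :
    Disjoint (F.stem v \ insert x (F.stem x)) (F.stem w) :=
  Finset.disjoint_left.2 fun _ hy hyw => (Finset.mem_sdiff.1 hy).2
    (Finset.mem_insert_of_mem (h (Finset.mem_inter.2 ⟨(Finset.mem_sdiff.1 hy).1, hyw⟩)))

theorem dropMate_mem_sdiff (hF : IsAltForest G F) (hv : v ∈ F.outer) (hx : F.Inner x)
    (hy : y ∈ F.stem v \ insert x (F.stem x)) :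
    dropMate F.mate x y ∈ F.stem v \ insert x (F.stem x) := by
  by_cases h : y = x ∨ y = F.mate x
  · rwa [dropMate_of_eq h]
  obtain ⟨hyv, hyx⟩ := Finset.mem_sdiff.1 hy
  rw [dropMate_of_ne h, Finset.mem_sdiff]
  refine ⟨hF.mate_mem_stem hv y hyv, fun hmate => hyx ?_⟩
  rcases Finset.mem_insert.1 hmate with hmate | hmate
  · exact absurd (by rw [← hmate, hF.isMate.involutive]) (not_or.1 h).2
  · obtain ⟨p, hp, hpx⟩ := hF.exists_outer_stem_eq (.inr hx)
    have := hF.mate_mem_stem hp _ (hpx ▸ hmate)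
    rw [hF.isMate.involutive, hpx] at this
    exact Finset.mem_insert_of_mem this

theorem alt_mem_sdiff (hF : IsAltForest G F) (hv : v ∈ F.outer) (hx : F.Inner x)
    (hxv : x ∈ F.stem v) (hy : y ∈ F.stem v \ insert x (F.stem x)) :
    F.alt v y ∈ F.stem v \ insert x (F.stem x) := by
  have halt := hF.isAlt v hv
  obtain ⟨hyv, hyx⟩ := Finset.mem_sdiff.1 hy
  refine Finset.mem_sdiff.2 ⟨hF.alt_mem_stem hv halt hyv, fun h => hyx ?_⟩
  have := halt.insert_stem x hxv hx _ h
  rwa [halt.involutive] at this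

theorem isMate_piecewise_dropMate (hF : IsAltForest G F) (hv : v ∈ F.outer) (hw : w ∈ F.outer)
    (hx : F.Inner x) (hxv : x ∈ F.stem v) (hxw : x ∉ F.stem w) :
    IsMate G ((F.stem v \ insert x (F.stem x)).piecewise (F.alt v)
      ((F.stem w).piecewise (F.alt w) (dropMate F.mate x))) := by
  have hdisj := disjoint_sdiff_stem (hF.inter_subset_stem hv hw hxv hxw)
  refine (hF.isAlt v hv).toIsMate.piecewise ((hF.isAlt w hw).toIsMate.piecewise
    (hF.isMate.dropMate x) (fun y hy => hF.alt_mem_stem hw (hF.isAlt w hw) hy) fun y hy => ?_)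
    (fun y hy => hF.alt_mem_sdiff hv hx hxv hy) fun y hy => ?_
  · unfold dropMate
    split_ifs
    exacts [hy, hF.mate_mem_stem hw y hy]
  · rw [Finset.piecewise_eq_of_notMem _ _ _ (Finset.disjoint_left.1 hdisj hy)]
    exact hF.dropMate_mem_sdiff hv hx hy

theorem bypass_spec (hF : IsAltForest G F) (hv : v ∈ F.outer) (hw : w ∈ F.outer)
    (hvw : G.Adj v w) (hx : F.Inner x) (hxv : x ∈ F.stem v) (hxw : x ∉ F.stem w) :
    IsMate G (F.bypass v w x) ∧ F.bypass v w x v = w ∧ F.bypass v w x w = v ∧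
      ∀ y, y ≠ v → y ≠ w → F.bypass v w x y = (F.stem v \ insert x (F.stem x)).piecewise (F.alt v)
        ((F.stem w).piecewise (F.alt w) (dropMate F.mate x)) y := by
  have hmatch := hF.isMate_piecewise_dropMate hv hw hx hxv hxw
  have hvS : v ∈ F.stem v \ insert x (F.stem x) :=
    Finset.mem_sdiff.2 ⟨hF.mem_stem v hv, hF.notMem_insert_stem hv hx hxv⟩
  have hwS := Finset.disjoint_right.1 (disjoint_sdiff_stem (hF.inter_subset_stem hv hw hxv hxw))
    (hF.mem_stem w hw)
  have hfix_v := Finset.piecewise_eq_of_mem _ (F.alt v)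
    ((F.stem w).piecewise (F.alt w) (dropMate F.mate x)) hvS
  rw [((hF.isAlt v hv).fixed_iff v (hF.mem_stem v hv)).2 rfl] at hfix_v
  have hfix_w := Finset.piecewise_eq_of_notMem _ (F.alt v)
    ((F.stem w).piecewise (F.alt w) (dropMate F.mate x)) hwS
  rw [Finset.piecewise_eq_of_mem _ _ _ (hF.mem_stem w hw),
    ((hF.isAlt w hw).fixed_iff w (hF.mem_stem w hw)).2 rfl] at hfix_w
  exact ⟨hmatch.joinMate hfix_v hfix_w hvw, joinMate_left hfix_v, joinMate_right hfix_w,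
    fun y hyv hyw => joinMate_of_ne hmatch.involutive hfix_v hfix_w hyv hyw⟩

theorem bypass_eq_self_iff (hF : IsAltForest G F) (hv : v ∈ F.outer) (hw : w ∈ F.outer)
    (hC : (F.stem v ∩ F.stem w).Nonempty) (hvw : G.Adj v w) (hx : F.Inner x)
    (hxv : x ∈ F.stem v) (hxw : x ∉ F.stem w) (hy : y ∈ F.stem v ∪ F.stem w) :
    F.bypass v w x y = y ↔ y = x := by
  obtain ⟨-, h_v, h_w, h_of_ne⟩ := hF.bypass_spec hv hw hvw hx hxv hxw
  by_cases hyv : y = v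
  · rw [hyv, h_v]
    exact iff_of_false hvw.ne' fun h => hx.1 (h ▸ hv)
  by_cases hyw : y = w
  · rw [hyw, h_w]
    exact iff_of_false hvw.ne fun h => hx.1 (h ▸ hw)
  rw [h_of_ne y hyv hyw]
  by_cases hyS : y ∈ F.stem v \ insert x (F.stem x)
  · obtain ⟨hyv', hyx⟩ := Finset.mem_sdiff.1 hyS
    rw [Finset.piecewise_eq_of_mem _ _ _ hyS, (hF.isAlt v hv).fixed_iff y hyv']
    exact iff_of_false hyv fun h => hyx (h ▸ Finset.mem_insert_self _ _)
  rw [Finset.piecewise_eq_of_notMem _ _ _ hyS]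
  by_cases hyw' : y ∈ F.stem w
  · rw [Finset.piecewise_eq_of_mem _ _ _ hyw', (hF.isAlt w hw).fixed_iff y hyw']
    exact iff_of_false hyw fun h => hxw (h ▸ hyw')
  rw [Finset.piecewise_eq_of_notMem _ _ _ hyw']
  refine ⟨fun h => ?_, fun h => dropMate_of_eq (.inl h)⟩
  by_contra hyx
  have hymate : y ≠ F.mate x := fun h => hyS (h ▸ Finset.mem_sdiff.2
    ⟨hF.mate_mem_stem hv x hxv, hF.mate_notMem_insert_stem hx⟩)
  rw [dropMate_of_ne (not_or.2 ⟨hyx, hymate⟩)] at h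
  exact hyw' (Finset.mem_inter.1 (hF.exposed_mem_inter hv hw hC hy h)).2

theorem isAlt_bypass (hF : IsAltForest G F) (hv : v ∈ F.outer) (hw : w ∈ F.outer)
    (hC : (F.stem v ∩ F.stem w).Nonempty) (hvw : G.Adj v w) (hx : F.Inner x)
    (hxv : x ∈ F.stem v) (hxw : x ∉ F.stem w) :
    IsAlt G (F.contract v w) x (F.bypass v w x) := by
  have hsub := hF.inter_subset_stem hv hw hxv hxw
  have hstem := hF.stem_contract_of_mem hv hw
    (mem_newBlossom.2 ⟨Finset.mem_union_left _ hxv, hsub⟩)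
  obtain ⟨hmatch, -, -, h_of_ne⟩ := hF.bypass_spec hv hw hvw hx hxv hxw
  refine ⟨hmatch, fun y hy => ?_, fun y hy => ?_, fun u hu hinner y hy => ?_⟩
  · exact hF.bypass_eq_self_iff hv hw hC hvw hx hxv hxw (hstem ▸ hy)
  · rw [hstem, Finset.mem_union, not_or] at hy
    rw [h_of_ne y (fun h => hy.1 (h ▸ hF.mem_stem v hv)) (fun h => hy.2 (h ▸ hF.mem_stem w hw)),
      Finset.piecewise_eq_of_notMem _ _ _ fun h => hy.1 (Finset.mem_sdiff.1 h).1,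
      Finset.piecewise_eq_of_notMem _ _ _ hy.2, dropMate_of_ne]
    · rfl
    · rintro (rfl | rfl)
      exacts [hy.1 hxv, hy.1 (hF.mate_mem_stem hv x hxv)]
  · obtain ⟨hinner, huB⟩ := (hF.inner_contract hv hw).1 hinner
    have huD := hstem ▸ hu
    have huC := (hF.mem_newBlossom_or_mem_inter hv hw huD).resolve_left huB
    obtain ⟨huv, huw⟩ := Finset.mem_inter.1 huC
    rw [stem_contract_of_not_subset fun h => huB (mem_newBlossom.2 ⟨huD, h⟩)] at hy ⊢
    have hyC : y ∈ F.stem v ∩ F.stem w :=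
      (Finset.mem_insert.1 hy).elim (· ▸ huC) (hF.stem_subset_inter hv hw huC ·)
    rw [h_of_ne y (fun h => hF.notMem_insert_stem hv hinner huv (h ▸ hy))
        (fun h => hF.notMem_insert_stem hw hinner huw (h ▸ hy)),
      Finset.piecewise_eq_of_notMem _ _ _ fun h => (Finset.mem_sdiff.1 h).2
        (Finset.mem_insert_of_mem (hsub hyC)),
      Finset.piecewise_eq_of_mem _ _ _ (Finset.mem_inter.1 hyC).2]
    exact (hF.isAlt w hw).insert_stem u huw hinner y hy

theorem isAlt_bypass_symm (hF : IsAltForest G F) (hv : v ∈ F.outer) (hw : w ∈ F.outer)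
    (hC : (F.stem v ∩ F.stem w).Nonempty) (hvw : G.Adj v w) (hx : F.Inner x)
    (hxv : x ∉ F.stem v) (hxw : x ∈ F.stem w) :
    IsAlt G (F.contract v w) x (F.bypass w v x) := by
  have hbypass := hF.isAlt_bypass hw hv (Finset.inter_comm (F.stem v) _ ▸ hC) hvw.symm hx hxw hxv
  have hstem : (F.contract w v).stem = (F.contract v w).stem := by
    funext y
    simp only [contract, Finset.inter_comm (F.stem w), Finset.union_comm (F.stem w)]
  refine ⟨hbypass.toIsMate, hstem ▸ hbypass.fixed_iff, hstem ▸ hbypass.eq_mate,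
    fun u hu hinner => ?_⟩
  rw [hF.inner_contract hv hw, newBlossom_comm, ← hF.inner_contract hw hv] at hinner
  exact hstem ▸ hbypass.insert_stem u (hstem ▸ hu) hinner

theorem isAlt_contract (hF : IsAltForest G F) (hv : v ∈ F.outer) (hw : w ∈ F.outer)
    (hC : (F.stem v ∩ F.stem w).Nonempty) (hvw : G.Adj v w)
    (hx : x ∈ (F.contract v w).outer) :
    IsAlt G (F.contract v w) x ((F.contract v w).alt x) := by
  by_cases hxo : x ∈ F.outer
  · rw [show (F.contract v w).alt x = F.alt x from if_pos hxo]
    exact hF.isAlt_contract_of_outer hv hw hC hxo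
  have hxB := (mem_outer_contract.1 hx).resolve_left hxo
  have hxD := (mem_newBlossom.1 hxB).1
  have hxC : x ∉ F.stem v ∩ F.stem w := fun h => hxo (hF.outer_of_mem_newBlossom hv hw hxB h).1
  have hinner := (hF.outer_or_inner_of_mem_union hv hw hxD).resolve_left hxo
  by_cases hxv : x ∈ F.stem v
  · rw [show (F.contract v w).alt x = F.bypass v w x from (if_neg hxo).trans (if_pos hxv)]
    exact hF.isAlt_bypass hv hw hC hvw hinner hxv fun h => hxC (Finset.mem_inter.2 ⟨hxv, h⟩)
  · rw [show (F.contract v w).alt x = F.bypass w v x from (if_neg hxo).trans (if_neg hxv)]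
    exact hF.isAlt_bypass_symm hv hw hC hvw hinner hxv ((Finset.mem_union.1 hxD).resolve_left hxv)

theorem stem_mate_contract (hF : IsAltForest G F) (hv : v ∈ F.outer) (hw : w ∈ F.outer)
    (hx : x ∈ (F.contract v w).outer) (h : F.mate x ∈ (F.contract v w).outer) :
    (F.contract v w).stem (F.mate x) = (F.contract v w).stem x := by
  by_cases hxB : x ∈ F.newBlossom v w
  · have hB : F.mate x ∈ F.newBlossom v w := hF.mate_mem_newBlossom hv hw hxB h
    exact (hF.stem_contract_of_mem hv hw hB).trans (hF.stem_contract_of_mem hv hw hxB).symm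
  · refine stem_contract_congr (hF.stem_mate x ((mem_outer_contract.1 hx).resolve_right hxB) ?_)
    refine (mem_outer_contract.1 h).resolve_right fun hB => hxB ?_
    have hinv := hF.isMate.involutive x
    exact hinv ▸ hF.mate_mem_newBlossom hv hw hB (hinv.symm ▸ hx)

theorem contract (hF : IsAltForest G F) (hv : v ∈ F.outer) (hw : w ∈ F.outer)
    (hC : (F.stem v ∩ F.stem w).Nonempty) (hvw : G.Adj v w) :
    IsAltForest G (F.contract v w) := by
  refine
    { isMate := hF.isMate
      exposed_outer := fun x hx => mem_outer_contract.2 (.inl (hF.exposed_outer x hx))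
      exists_parent := fun u hu => ?_
      notMem_stem := fun u hu => ?_
      mem_stem := fun x hx => ?_
      stem_mate := fun x hx h => hF.stem_mate_contract hv hw hx h
      exists_base := fun x hx => hF.exists_base_contract hv hw hC hx
      base_unique := fun b b' hb hb' h => hF.base_unique_contract hv hw hC hb hb' h
      stem_root := fun b hb => hF.stem_root_contract hv hw hC hb
      stem_base := fun b hb h => ?_
      isAlt := fun x hx => hF.isAlt_contract hv hw hC hvw hx }
  · obtain ⟨p, hp, hup, hpu⟩ := hF.exists_parent u ((hF.inner_contract hv hw).1 hu).1
    exact ⟨p, mem_outer_contract.2 (.inl hp), hup, stem_contract_congr hpu⟩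
  · obtain ⟨hu, huB⟩ := (hF.inner_contract hv hw).1 hu
    have huu := hF.notMem_stem u hu
    by_cases hsub : F.stem v ∩ F.stem w ⊆ F.stem u
    · rw [stem_contract_of_subset hsub, Finset.mem_union, not_or]
      exact ⟨huu, fun h => huB (mem_newBlossom.2 ⟨h, hsub⟩)⟩
    · rwa [stem_contract_of_not_subset hsub]
  · by_cases hxB : x ∈ F.newBlossom v w
    · rw [hF.stem_contract_of_mem hv hw hxB]
      exact (mem_newBlossom.1 hxB).1
    · have hxx := hF.mem_stem x ((mem_outer_contract.1 hx).resolve_right hxB)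
      unfold AltForest.contract
      dsimp only
      split_ifs
      exacts [Finset.mem_union_left _ hxx, hxx]
  · by_cases hbB : b ∈ F.newBlossom v w
    · exact hF.stem_base_contract_of_mem hv hw hC hbB h
    · exact hF.stem_base_contract_of_notMem hv hw hC ((mem_outer_contract.1 hb).resolve_right hbB)
        hbB fun h' => h (mem_outer_contract.2 (.inl h'))

theorem exists_inner_mem_newBlossom (hF : IsAltForest G F) (hv : v ∈ F.outer) (hw : w ∈ F.outer)
    (hC : (F.stem v ∩ F.stem w).Nonempty) (h : v ∉ F.stem w) :
    ∃ u, F.Inner u ∧ u ∈ F.newBlossom v w := by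
  obtain ⟨b, ⟨hb, hbase⟩, hbv⟩ := hF.exists_base v hv
  have hbD : b ∈ F.stem v := hbv ▸ hF.mem_stem b hb
  have hbw : b ∉ F.stem w := fun hbw => h (hF.stem_subset hw b hbw (hbv ▸ hF.mem_stem v hv))
  have hinner := hF.inner_mate hb (hbase.resolve_left fun hmate => hbw (Finset.mem_inter.1
    (hF.exposed_mem_inter hv hw hC (Finset.mem_union_left _ hbD) hmate)).2)
  have hmate := hF.mate_mem_stem hv b hbD
  refine ⟨F.mate b, hinner, mem_newBlossom.2 ⟨Finset.mem_union_left _ hmate,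
    hF.inter_subset_stem hv hw hmate fun hmate => hbw ?_⟩⟩
  rw [← hF.isMate.involutive b]
  exact hF.mate_mem_stem hw _ hmate

theorem outer_ssubset_contract (hF : IsAltForest G F) (hv : v ∈ F.outer) (hw : w ∈ F.outer)
    (hC : (F.stem v ∩ F.stem w).Nonempty) (h : F.stem v ≠ F.stem w) :
    F.outer ⊂ (F.contract v w).outer := by
  obtain ⟨u, hu, huB⟩ : ∃ u, F.Inner u ∧ u ∈ F.newBlossom v w := by
    by_cases hvw : v ∈ F.stem w
    · rw [newBlossom_comm]
      rw [Finset.inter_comm] at hC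
      refine hF.exists_inner_mem_newBlossom hw hv hC fun hwv => h ?_
      exact (hF.stem_subset hw v hvw).antisymm (hF.stem_subset hv w hwv)
    · exact hF.exists_inner_mem_newBlossom hv hw hC hvw
  exact Finset.ssubset_iff_of_subset Finset.subset_union_left |>.2
    ⟨u, mem_outer_contract.2 (.inr huB), hu.1⟩

end IsAltForest

end Contract

section Stuck

variable {V : Type*} {G : SimpleGraph V} {F : AltForest V} {b x : V} {g : V → V}

theorem even_card_of_involutive {f : V → V} {S : Finset V} (hf : Function.Involutive f)
    (hS : ∀ x ∈ S, f x ∈ S) (hne : ∀ x ∈ S, f x ≠ x) : Even S.card := by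
  have hsum : ∑ _x ∈ S, (1 : ZMod 2) = 0 :=
    Finset.sum_involution (fun x _ => f x) (fun _ _ => CharTwo.add_self_eq_zero 1)
      (fun x hx _ => hne x hx) hS fun x _ => hf x
  rwa [Finset.sum_const, nsmul_one, ZMod.natCast_eq_zero_iff_even] at hsum

variable [DecidableEq V]

namespace IsAltForest

theorem mate_mem_blossom_erase (hF : IsAltForest G F) (hb : F.IsBase b)
    (hx : x ∈ (F.blossom b).erase b) : F.mate x ∈ (F.blossom b).erase b ∧ F.mate x ≠ x := by
  obtain ⟨hxb, hx⟩ := Finset.mem_erase.1 hx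
  obtain ⟨hxo, hstem⟩ := mem_blossom.1 hx
  have hbase : ¬F.IsBase x := fun h => hxb (hF.base_unique x b h hb hstem)
  have hmate : F.mate x ∈ F.outer := by_contra fun h => hbase ⟨hxo, .inr h⟩
  refine ⟨Finset.mem_erase.2 ⟨fun h => ?_, mem_blossom.2 ⟨hmate, ?_⟩⟩,
    fun h => hbase ⟨hxo, .inl h⟩⟩
  · have hbx : F.mate b = x := by rw [← h, hF.isMate.involutive]
    rcases hb.2 with h' | h'
    · exact hxb (hbx.symm.trans h')
    · exact h' (hbx ▸ hxo)
  · exact (hF.stem_mate x hxo hmate).trans hstem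

theorem odd_card_blossom (hF : IsAltForest G F) (hb : F.IsBase b) : Odd (F.blossom b).card := by
  rw [← Finset.card_erase_add_one (mem_blossom.2 ⟨hb.1, rfl⟩ : b ∈ F.blossom b)]
  exact (even_card_of_involutive hF.isMate.involutive
    (fun x hx => (hF.mate_mem_blossom_erase hb hx).1)
    fun x hx => (hF.mate_mem_blossom_erase hb hx).2).add_one

theorem exists_mem_blossom_of_stuck (hF : IsAltForest G F)
    (hstuck : ∀ v ∈ F.outer, ∀ w, G.Adj v w → F.Inner w ∨ w ∈ F.outer ∧ F.stem w = F.stem v)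
    (hg : IsMate G g) (hb : F.IsBase b) : ∃ y ∈ F.blossom b, g y = y ∨ F.Inner (g y) := by
  by_contra! h
  refine Nat.not_even_iff_odd.2 (hF.odd_card_blossom hb)
    (even_card_of_involutive hg.involutive (fun y hy => ?_) fun y hy => (h y hy).1)
  obtain ⟨hyo, hstem⟩ := mem_blossom.1 hy
  obtain ⟨ho, hgy⟩ :=
    (hstuck y hyo (g y) (hg.adj y (h y hy).1)).resolve_left (h y hy).2
  exact mem_blossom.2 ⟨ho, hgy.trans hstem⟩

/-- As blossoms are odd, any matching `g` leaves a vertex of each exposed or matches it to an inner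
vertex, while `F.mate` uses up all inner vertices in this way. -/
theorem isMaxMate_of_stuck [Fintype V] (hF : IsAltForest G F)
    (hstuck : ∀ v ∈ F.outer, ∀ w, G.Adj v w → F.Inner w ∨ w ∈ F.outer ∧ F.stem w = F.stem v) :
    IsMaxMate G F.mate := by
  refine ⟨hF.isMate, fun g hg => ?_⟩
  have hinj : Function.Injective F.mate := hF.isMate.involutive.injective
  set inner := Finset.univ.filter fun u => u ∉ F.outer ∧ F.mate u ∈ F.outer
  have hinner : ∀ u, u ∈ inner ↔ F.Inner u := fun u => by
    simp only [inner, Finset.mem_filter_univ, AltForest.Inner]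
  have hbase : ∀ b ∈ exposed F.mate ∪ inner.image F.mate, F.IsBase b := by
    intro b hb
    rcases Finset.mem_union.1 hb with hb | hb
    · have hmate := mem_exposed.1 hb
      exact ⟨hF.exposed_outer b hmate, .inl hmate⟩
    · obtain ⟨u, hu, rfl⟩ := Finset.mem_image.1 hb
      have hu := (hinner u).1 hu
      exact ⟨hu.2, .inr (by rw [hF.isMate.involutive]; exact hu.1)⟩
  have hdisj : Disjoint (exposed F.mate) (inner.image F.mate) := by
    refine Finset.disjoint_left.2 fun b hb hb' => ?_
    obtain ⟨u, hu, rfl⟩ := Finset.mem_image.1 hb'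
    have hu := (hinner u).1 hu
    have hmate : u = F.mate u := hinj (mem_exposed.1 hb).symm
    exact hu.1 (hmate ▸ hu.2)
  choose! y hy hgy using fun b hb => hF.exists_mem_blossom_of_stuck hstuck hg (hbase b hb)
  have hle : (exposed F.mate ∪ inner.image F.mate).card ≤ (exposed g ∪ inner).card := by
    refine Finset.card_le_card_of_injOn (fun b => g (y b)) (fun b hb => ?_) fun b hb b' hb' h => ?_
    · refine Finset.mem_union.2 ((hgy b hb).imp (fun h => ?_) (hinner _).2)
      exact mem_exposed.2 (congrArg g h)
    · have hyy : y b = y b' := hg.involutive.injective h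
      exact hF.base_unique b b' (hbase b hb) (hbase b' hb')
        ((mem_blossom.1 (hy b hb)).2.symm.trans (hyy ▸ (mem_blossom.1 (hy b' hb')).2))
  rw [Finset.card_union_of_disjoint hdisj, Finset.card_image_of_injective _ hinj] at hle
  have := Finset.card_union_le (exposed g) inner
  omega

end IsAltForest

end Stuck

section Search

variable {V : Type*} [Fintype V] [DecidableEq V] {G : SimpleGraph V} [DecidableRel G.Adj]
  {F : AltForest V} {v w : V}

namespace AltForest

/-- One step of the search for a maximum matching: depending on where the edge `vw` leads from the
outer vertex `v`, grow the forest, contract a blossom, or augment the matching and start anew. -/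
def scan (G : SimpleGraph V) [DecidableRel G.Adj] (F : AltForest V) (v w : V) : AltForest V :=
  if G.Adj v w ∧ v ∈ F.outer then
    if w ∈ F.outer then
      if (F.stem v ∩ F.stem w).Nonempty then
        if F.stem v = F.stem w then F else F.contract v w
      else init (F.augment v w)
    else if F.mate w ∈ F.outer then F else F.grow v w
  else F

/-- The termination measure of the search, ordering forests lexicographically by the numbers of
exposed and of non-outer vertices. -/
def rank (F : AltForest V) : ℕ :=
  (Fintype.card V + 1) * (exposed F.mate).card + F.outerᶜ.card

theorem rank_lt_of_outer_ssubset {F' : AltForest V} (hmate : F'.mate = F.mate)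
    (h : F.outer ⊂ F'.outer) : F'.rank < F.rank := by
  rw [rank, rank, hmate]
  exact Nat.add_lt_add_left (Finset.card_lt_card (compl_lt_compl_iff_lt.2 h)) _

theorem rank_lt_of_card_exposed_lt {F' : AltForest V}
    (h : (exposed F'.mate).card < (exposed F.mate).card) : F'.rank < F.rank := by
  have := Finset.card_le_univ F'.outerᶜ
  unfold rank
  nlinarith

end AltForest

namespace IsAltForest

theorem scan_eq_or_rank_lt (hF : IsAltForest G F) (v w : V) : IsAltForest G (F.scan G v w) ∧
    (F.scan G v w = F ∧
        (G.Adj v w → v ∈ F.outer → F.Inner w ∨ w ∈ F.outer ∧ F.stem w = F.stem v) ∨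
      (F.scan G v w).rank < F.rank) := by
  unfold scan
  split_ifs with h hw hC hst hw'
  · exact ⟨hF, .inl ⟨rfl, fun _ _ => .inr ⟨hw, hst.symm⟩⟩⟩
  · exact ⟨hF.contract h.2 hw hC h.1,
      .inr (rank_lt_of_outer_ssubset rfl (hF.outer_ssubset_contract h.2 hw hC hst))⟩
  · have hdisj : Disjoint (F.stem v) (F.stem w) :=
      Finset.disjoint_iff_inter_eq_empty.2 (Finset.not_nonempty_iff_eq_empty.1 hC)
    exact ⟨isAltForest_init (hF.isMate_augment h.2 hw h.1 hdisj),
      .inr (rank_lt_of_card_exposed_lt (hF.card_exposed_augment_lt h.2 hw h.1 hdisj))⟩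
  · exact ⟨hF, .inl ⟨rfl, fun _ _ => .inl ⟨hw, hw'⟩⟩⟩
  · refine ⟨hF.grow h.2 hw hw' h.1, .inr (rank_lt_of_outer_ssubset rfl ?_)⟩
    exact Finset.ssubset_insert hw'
  · exact ⟨hF, .inl ⟨rfl, fun hadj hv => absurd ⟨hadj, hv⟩ h⟩⟩

theorem scan (hF : IsAltForest G F) (v w : V) : IsAltForest G (F.scan G v w) :=
  (hF.scan_eq_or_rank_lt v w).1

theorem rank_scan_lt (hF : IsAltForest G F) (h : F.scan G v w ≠ F) :
    (F.scan G v w).rank < F.rank :=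
  (hF.scan_eq_or_rank_lt v w).2.resolve_left fun h' => h h'.1

theorem isMaxMate_of_scan_eq (hF : IsAltForest G F) (h : ∀ v w, F.scan G v w = F) :
    IsMaxMate G F.mate :=
  hF.isMaxMate_of_stuck fun v hv w hvw =>
    ((hF.scan_eq_or_rank_lt v w).2.resolve_right fun hlt => hlt.ne (congrArg rank (h v w))).2
      hvw hv

end IsAltForest

end Search

section LoopPrograms

open Polynomial

namespace Mem

variable (m : Mem) (a i j x v : ℕ)

theorem setVar_var (y : ℕ) : (m.setVar x v).var y = if y = x then v else m.var y := rfl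

theorem setVar_arr : (m.setVar x v).arr = m.arr := rfl

theorem setArr_var : (m.setArr a i j v).var = m.var := rfl

theorem setArr_arr (b r s : ℕ) :
    (m.setArr a i j v).arr b r s = if b = a ∧ r = i ∧ s = j then v else m.arr b r s := rfl

theorem setArr_arr_of_ne {b : ℕ} (h : b ≠ a) : (m.setArr a i j v).arr b = m.arr b := by
  funext r s
  rw [setArr_arr, if_neg fun h' => h h'.1]

end Mem

/-- Programs whose loops are bounded by variable `0`, which holds the number of vertices: `rep x p`
runs `p` with `x` set to `0, …, n - 1` in turn. They compile to programs that run in polynomial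
time. -/
inductive LoopProg
  | skip
  | set (x : ℕ) (e : Expr)
  | put (a : ℕ) (i j e : Expr)
  | seq (p q : LoopProg)
  | branch (e : Expr) (p q : LoopProg)
  | rep (x : ℕ) (p : LoopProg)

infixr:60 " ⨟ " => LoopProg.seq

namespace LoopProg

/-- The machine program for a loop program. -/
def compile : LoopProg → Prog
  | skip => .skip
  | set x e => .set x e
  | put a i j e => .put a i j e
  | seq p q => .seq p.compile q.compile
  | branch e p q => .branch e p.compile q.compile
  | rep x p => .seq (.set x (.lit 0)) (.loop (.lt (.var x) (.var 0))
      (.seq p.compile (.set x (.add (.var x) (.lit 1)))))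

/-- The effect of a loop program on the memory. -/
def run : LoopProg → Mem → Mem
  | skip, m => m
  | set x e, m => m.setVar x (e.eval m)
  | put a i j e, m => m.setArr a (i.eval m) (j.eval m) (e.eval m)
  | seq p q, m => q.run (p.run m)
  | branch e p q, m => if e.eval m ≠ 0 then p.run m else q.run m
  | rep x p, m =>
    ((List.range (m.var 0)).foldl (fun m' i => p.run (m'.setVar x i)) m).setVar x (m.var 0)

/-- The variables that a program assigns to. -/
def vars : LoopProg → List ℕ
  | skip => []
  | set x _ => [x]
  | put _ _ _ _ => []
  | seq p q => p.vars ++ q.vars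
  | branch _ p q => p.vars ++ q.vars
  | rep x p => x :: p.vars

/-- The arrays that a program assigns to. -/
def arrs : LoopProg → List ℕ
  | skip => []
  | set _ _ => []
  | put a _ _ _ => [a]
  | seq p q => p.arrs ++ q.arrs
  | branch _ p q => p.arrs ++ q.arrs
  | rep _ p => p.arrs

/-- Loop bodies do not assign to the loop variable, and variable `0` may only be changed at the very
end, so that it bounds all loops. -/
def WellFormed : LoopProg → Prop
  | seq p q => p.WellFormed ∧ q.WellFormed ∧ 0 ∉ p.vars
  | branch _ p q => p.WellFormed ∧ q.WellFormed
  | rep x p => p.WellFormed ∧ x ≠ 0 ∧ x ∉ p.vars ∧ 0 ∉ p.vars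
  | _ => True

instance decidableWellFormed : (p : LoopProg) → Decidable p.WellFormed
  | skip | set _ _ | put _ _ _ _ => .isTrue trivial
  | seq p q =>
    have := p.decidableWellFormed
    have := q.decidableWellFormed
    inferInstanceAs (Decidable (_ ∧ _))
  | branch _ p q =>
    have := p.decidableWellFormed
    have := q.decidableWellFormed
    inferInstanceAs (Decidable (_ ∧ _))
  | rep _ p =>
    have := p.decidableWellFormed
    inferInstanceAs (Decidable (_ ∧ _))

/-- A bound on the running time, as a polynomial in the value of variable `0`. -/
noncomputable def time : LoopProg → ℕ[X]
  | skip => 1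
  | set _ e => C (e.cost + 1)
  | put _ i j e => C (i.cost + j.cost + e.cost + 1)
  | seq p q => p.time + q.time
  | branch e p q => C (e.cost + 1) + p.time + q.time
  | rep _ p => X * (p.time + 8) + 6

variable {p : LoopProg} {m m' : Mem} {x a : ℕ}

theorem foldl_induction {P : Mem → Prop} (hP : ∀ m' i, P m' → P (p.run (m'.setVar x i))) (h : P m)
    (l : List ℕ) : P (l.foldl (fun m' i => p.run (m'.setVar x i)) m) :=
  List.foldlRecOn l _ h fun m' hm' i _ => hP m' i hm'

theorem run_var (p : LoopProg) (m : Mem) (hx : x ∉ p.vars) : (p.run m).var x = m.var x := by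
  induction p generalizing m with
  | skip | put => rfl
  | set y e => exact if_neg fun h => hx (List.mem_singleton.2 h)
  | seq p q hp hq =>
    rw [vars, List.mem_append, not_or] at hx
    exact (hq _ hx.2).trans (hp _ hx.1)
  | branch e p q hp hq =>
    rw [vars, List.mem_append, not_or] at hx
    rw [run]
    split_ifs
    exacts [hp _ hx.1, hq _ hx.2]
  | rep y p hp =>
    rw [vars, List.mem_cons, not_or] at hx
    rw [run, Mem.setVar_var, if_neg hx.1]
    refine foldl_induction (P := fun m' => m'.var x = m.var x) (fun m' i h => ?_) rfl _
    rw [hp _ hx.2, Mem.setVar_var, if_neg hx.1, h]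

theorem run_arr (p : LoopProg) (m : Mem) (ha : a ∉ p.arrs) : (p.run m).arr a = m.arr a := by
  induction p generalizing m with
  | skip | set => rfl
  | put b i j e => exact m.setArr_arr_of_ne b _ _ _ fun h => ha (h ▸ List.mem_singleton_self a)
  | seq p q hp hq =>
    rw [arrs, List.mem_append, not_or] at ha
    exact (hq _ ha.2).trans (hp _ ha.1)
  | branch e p q hp hq =>
    rw [arrs, List.mem_append, not_or] at ha
    rw [run]
    split_ifs
    exacts [hp _ ha.1, hq _ ha.2]
  | rep y p hp =>
    exact foldl_induction (P := fun m' => m'.arr a = m.arr a)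
      (fun m' i h => (hp _ ha).trans h) rfl _

theorem exec_loop {n t : ℕ} (hx : x ≠ 0) (hxp : x ∉ p.vars) (h0p : 0 ∉ p.vars)
    (hp : ∀ m', m'.var 0 = n → ∃ s ≤ t, Exec p.compile m' s (p.run m')) (k : ℕ) :
    ∀ i (m : Mem), m.var 0 = n → i + k = n →
      ∃ s ≤ k * (t + 8) + 4, Exec (.loop (.lt (.var x) (.var 0))
        (.seq p.compile (.set x (.add (.var x) (.lit 1))))) (m.setVar x i) s
        (((List.range' i k).foldl (fun m' i => p.run (m'.setVar x i)) m).setVar x n) := by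
  have hguard : ∀ i (m : Mem), m.var 0 = n →
      (Expr.lt (.var x) (.var 0)).eval (m.setVar x i) = if i < n then 1 else 0 := fun i m hm => by
    simp only [Expr.eval, Mem.setVar_var, if_pos, if_neg hx.symm, hm]
  induction k with
  | zero =>
    intro i m hm hi
    obtain rfl : i = n := hi
    exact ⟨4, by omega, .loopFalse ((hguard i m hm).trans (if_neg (lt_irrefl i)))⟩
  | succ k ih =>
    intro i m hm hi
    have hm' : (p.run (m.setVar x i)).var 0 = n := by
      rw [run_var p _ h0p, Mem.setVar_var, if_neg hx.symm, hm]
    obtain ⟨s, hs, hexec⟩ := hp (m.setVar x i) ((if_neg hx.symm).trans hm)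
    obtain ⟨s', hs', hexec'⟩ := ih (i + 1) _ hm' (by omega)
    have hnext : (Expr.add (.var x) (.lit 1)).eval (p.run (m.setVar x i)) = i + 1 := by
      simp only [Expr.eval, run_var p _ hxp, Mem.setVar_var, if_pos]
    have hset := Exec.set (p.run (m.setVar x i)) x (.add (.var x) (.lit 1))
    rw [hnext] at hset
    refine ⟨_, ?_, .loopTrue ?_ (.seq hexec hset) hexec'⟩
    · simp only [Expr.cost]
      rw [add_mul]
      omega
    · rw [hguard i m hm, if_pos (by omega)]
      exact one_ne_zero

theorem exec (p : LoopProg) (h : p.WellFormed) (m : Mem) :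
    ∃ t ≤ p.time.eval (m.var 0), Exec p.compile m t (p.run m) := by
  induction p generalizing m with
  | skip => exact ⟨1, eval_one.ge, .skip m⟩
  | set x e => exact ⟨_, eval_C.ge, .set m x e⟩
  | put a i j e => exact ⟨_, eval_C.ge, .put m a i j e⟩
  | seq p q hp hq =>
    obtain ⟨s, hs, hps⟩ := hp h.1 m
    obtain ⟨t, ht, hqt⟩ := hq h.2.1 (p.run m)
    rw [run_var p m h.2.2] at ht
    exact ⟨s + t, (add_le_add hs ht).trans_eq eval_add.symm, .seq hps hqt⟩
  | branch e p q hp hq =>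
    obtain ⟨s, hs, hps⟩ := hp h.1 m
    obtain ⟨t, ht, hqt⟩ := hq h.2 m
    rw [run, time, eval_add, eval_add, eval_C]
    split_ifs with he
    · exact ⟨_, by omega, .branchTrue he hps⟩
    · exact ⟨_, by omega, .branchFalse (not_not.1 he) hqt⟩
  | rep x p hp =>
    obtain ⟨hp', hx, hxp, h0p⟩ := h
    obtain ⟨s, hs, hexec⟩ := exec_loop (t := p.time.eval (m.var 0)) hx hxp h0p
      (fun m' hm' => by rw [← hm']; exact hp hp' m') (m.var 0) 0 m rfl (zero_add _)
    rw [← List.range_eq_range'] at hexec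
    refine ⟨_, ?_, .seq (.set m x (.lit 0)) hexec⟩
    simp only [time, eval_add, eval_mul, eval_X, eval_ofNat, Expr.cost]
    omega

theorem polyTime {Dom : Inst → Prop} {Post : Inst → Mem → Prop}
    (p : LoopProg) (hp : p.WellFormed) (h : ∀ I, Dom I → Post I (p.run I.input)) :
    PolyTime Dom Post := by
  refine ⟨p.compile, p.time, fun I hI => ?_⟩
  obtain ⟨t, ht, hexec⟩ := p.exec hp I.input
  refine ⟨t, _, hexec, ht.trans ?_, h I hI⟩
  have hle : I.n ≤ I.length := (Nat.le_mul_self I.n).trans (Nat.le_add_right _ _)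
  change p.time.eval I.n ≤ _
  rw [eval_eq_sum_range, eval_eq_sum_range]
  gcongr

/-- `m'` differs from `m` at most in the cells that `p` may write to. -/
structure Frame (p : LoopProg) (m m' : Mem) : Prop where
  var_eq : ∀ x, x ∉ p.vars → m'.var x = m.var x
  arr_eq : ∀ a, a ∉ p.arrs → m'.arr a = m.arr a

theorem Frame.rep_step {m' : Mem} {i : ℕ} (h : Frame (rep x p) m m') :
    Frame (rep x p) m (p.run (m'.setVar x i)) where
  var_eq y hy := by
    rw [vars, List.mem_cons, not_or] at hy
    rw [run_var p _ hy.2, Mem.setVar_var, if_neg hy.1, h.var_eq y (by simp [vars, hy])]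
  arr_eq a ha := by rw [run_arr p _ ha, Mem.setVar_arr, h.arr_eq a ha]

theorem Frame.rep_setVar {v : ℕ} (h : Frame (rep x p) m m') :
    Frame (rep x p) m (m'.setVar x v) where
  var_eq y hy := (if_neg fun h' : y = x => hy (h' ▸ List.mem_cons_self)).trans (h.var_eq y hy)
  arr_eq := h.arr_eq

theorem Frame.trans_rep {m₁ m₂ : Mem} (h : Frame (rep x p) m m₁) (h' : Frame p m₁ m₂) :
    Frame (rep x p) m m₂ where
  var_eq y hy := (h'.var_eq y fun hy' => hy (List.mem_cons_of_mem x hy')).trans (h.var_eq y hy)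
  arr_eq a ha := (h'.arr_eq a ha).trans (h.arr_eq a ha)

theorem run_rep {n : ℕ} {Q : ℕ → Mem → Prop} (hn : m.var 0 = n)
    (hQ : ∀ i m' v, Q i m' → Q i (m'.setVar x v)) (h0 : Q 0 m)
    (hstep : ∀ i < n, ∀ m', m'.var x = i → Frame (rep x p) m m' → Q i m' → Q (i + 1) (p.run m')) :
    Q n ((rep x p).run m) := by
  have main : ∀ k ≤ n, Frame (rep x p) m
      ((List.range k).foldl (fun m' i => p.run (m'.setVar x i)) m) ∧
      Q k ((List.range k).foldl (fun m' i => p.run (m'.setVar x i)) m) := fun k => by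
    induction k with
    | zero => exact fun _ => ⟨⟨fun _ _ => rfl, fun _ _ => rfl⟩, h0⟩
    | succ k ih =>
      intro hk
      obtain ⟨hF, hQk⟩ := ih (by omega)
      rw [List.range_succ, List.foldl_append, List.foldl_cons, List.foldl_nil]
      exact ⟨hF.rep_step, hstep k hk _ (if_pos rfl) (hF.rep_setVar) (hQ _ _ _ hQk)⟩
  rw [run, hn]
  exact hQ _ _ _ (main n le_rfl).2

theorem run_pairs {n y : ℕ} {Q : Finset (Fin n × Fin n) → (ℕ → ℕ → ℕ → ℕ) → Prop}
    (hn : m.var 0 = n) (hx : x ∉ (rep y p).vars) (h0 : 0 ∉ (rep x (rep y p)).vars)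
    (hQ : Q ∅ m.arr)
    (hstep : ∀ (i j : Fin n) (S : Finset (Fin n × Fin n)) (m' : Mem), m'.var x = i → m'.var y = j →
      Frame (rep x (rep y p)) m m' → (i, j) ∉ S → Q S m'.arr → Q (insert (i, j) S) (p.run m').arr) :
    Q Finset.univ ((rep x (rep y p)).run m).arr := by
  have houter := run_rep (x := x) (p := rep y p) (Q := fun i m' => Q {q | q.1 < i} m'.arr) hn
    (fun _ _ _ h => h) (by simpa using hQ) fun i hi m' hxi hF hQi => ?_
  · simpa using houter
  have hn' : m'.var 0 = n := (hF.var_eq 0 h0).trans hn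
  have hinner := run_rep (x := y) (p := p)
    (Q := fun j m'' => Q {q | q.1 < i ∨ q.1 = i ∧ q.2 < j} m''.arr) hn' (fun _ _ _ h => h)
    (by simpa using hQi) fun j hj m'' hyj hF' hQj => ?_
  · simpa [Nat.le_iff_lt_or_eq] using hinner
  have hins : ({q | q.1 < i ∨ q.1 = i ∧ q.2 < j + 1} : Finset (Fin n × Fin n)) =
      insert (⟨i, hi⟩, ⟨j, hj⟩) ({q | q.1 < i ∨ q.1 = i ∧ q.2 < j} : Finset (Fin n × Fin n)) := by
    ext q
    simp only [Finset.mem_filter_univ, Finset.mem_insert, Prod.ext_iff, Fin.ext_iff]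
    omega
  rw [hins]
  exact hstep ⟨i, hi⟩ ⟨j, hj⟩ _ m'' ((hF'.var_eq x hx).trans hxi) hyj (hF.trans_rep hF')
    (by simp) hQj

end LoopProg

end LoopPrograms

namespace Expr

/-- The variables that an expression reads. -/
def vars : Expr → List ℕ
  | lit _ => []
  | var x => [x]
  | get _ e f | add e f | sub e f | lt e f | eq e f => e.vars ++ f.vars

/-- The arrays that an expression reads. -/
def arrs : Expr → List ℕ
  | lit _ | var _ => []
  | get a e f => a :: (e.arrs ++ f.arrs)
  | add e f | sub e f | lt e f | eq e f => e.arrs ++ f.arrs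

theorem eval_congr {m m' : Mem} {e : Expr} (hv : ∀ x ∈ e.vars, m.var x = m'.var x)
    (ha : ∀ a ∈ e.arrs, m.arr a = m'.arr a) : e.eval m = e.eval m' := by
  induction e with
  | lit => rfl
  | var x => exact hv x (List.mem_singleton_self x)
  | get a e f he hf =>
    simp only [vars, arrs, List.mem_append, List.mem_cons] at hv ha
    rw [eval, eval, ha a (.inl rfl),
      he (fun x hx => hv x (.inl hx)) (fun a h => ha a (.inr (.inl h))),
      hf (fun x hx => hv x (.inr hx)) (fun a h => ha a (.inr (.inr h)))]
  | add e f he hf | sub e f he hf | lt e f he hf | eq e f he hf =>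
    simp only [vars, arrs, List.mem_append] at hv ha
    rw [eval, eval, he (fun x hx => hv x (.inl hx)) (fun a h => ha a (.inl h)),
      hf (fun x hx => hv x (.inr hx)) (fun a h => ha a (.inr h))]

/-- Negation of a truth value. -/
def not (e : Expr) : Expr := eq e (lit 0)

/-- Conjunction of truth values. -/
def and (e f : Expr) : Expr := (add e.not f.not).not

variable {m : Mem} {e f : Expr}

theorem eval_eq_ne_zero : (eq e f).eval m ≠ 0 ↔ e.eval m = f.eval m := by simp [eval]

theorem eval_lt_ne_zero : (lt e f).eval m ≠ 0 ↔ e.eval m < f.eval m := by simp [eval]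

theorem eval_not_ne_zero : e.not.eval m ≠ 0 ↔ ¬e.eval m ≠ 0 :=
  eval_eq_ne_zero.trans not_ne_iff.symm

theorem eval_add_ne_zero : (add e f).eval m ≠ 0 ↔ e.eval m ≠ 0 ∨ f.eval m ≠ 0 := by
  rw [eval]
  omega

theorem eval_and_ne_zero : (e.and f).eval m ≠ 0 ↔ e.eval m ≠ 0 ∧ f.eval m ≠ 0 := by
  rw [and, eval_not_ne_zero, eval_add_ne_zero, eval_not_ne_zero, eval_not_ne_zero, not_or,
    not_not, not_not]

end Expr

/-- Decision trees: expressions with case distinctions, for a machine without conditional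
expressions. -/
inductive Choice
  | ret (e : Expr)
  | ite (c : Expr) (t f : Choice)

namespace Choice

/-- The value of a decision tree. -/
def eval (m : Mem) : Choice → ℕ
  | ret e => e.eval m
  | ite c t f => if c.eval m ≠ 0 then t.eval m else f.eval m

/-- The arrays that a decision tree reads. -/
def arrs : Choice → List ℕ
  | ret e => e.arrs
  | ite c t f => c.arrs ++ (t.arrs ++ f.arrs)

/-- The decision tree that exchanges the values of `e` and `f` in the result of another one. -/
def swap (e f : Expr) : Choice → Choice
  | ret g => ite (.eq g e) (ret f) (ite (.eq g f) (ret e) (ret g))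
  | ite c s t => ite c (s.swap e f) (t.swap e f)

/-- The program that stores the value of a decision tree in an array entry. -/
def put (a : ℕ) (i j : Expr) : Choice → LoopProg
  | ret e => .put a i j e
  | ite c t f => .branch c (t.put a i j) (f.put a i j)

variable {m m' : Mem} {t : Choice}

theorem eval_congr (hv : m.var = m'.var) (ha : ∀ a ∈ t.arrs, m.arr a = m'.arr a) :
    t.eval m = t.eval m' := by
  induction t with
  | ret e => exact e.eval_congr (fun x _ => congrFun hv x) ha
  | ite c s t hs ht =>
    simp only [arrs, List.mem_append] at ha
    rw [eval, eval, c.eval_congr (fun x _ => congrFun hv x) fun a h => ha a (.inl h),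
      hs fun a h => ha a (.inr (.inl h)), ht fun a h => ha a (.inr (.inr h))]

theorem eval_swap {e f : Expr} :
    (t.swap e f).eval m = Equiv.swap (e.eval m) (f.eval m) (t.eval m) := by
  induction t with
  | ret g => simp only [swap, eval, Expr.eval_eq_ne_zero, Equiv.swap_apply_def]
  | ite c s t hs ht =>
    rw [swap, eval, eval, hs, ht]
    split_ifs <;> rfl

variable {a : ℕ} {i j : Expr}

theorem run_put : (t.put a i j).run m = m.setArr a (i.eval m) (j.eval m) (t.eval m) := by
  induction t with
  | ret => rfl
  | ite c s t hs ht =>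
    rw [put, LoopProg.run, eval, hs, ht]
    split_ifs <;> rfl

theorem vars_put : (t.put a i j).vars = [] := by
  induction t with
  | ret => rfl
  | ite c s t hs ht => rw [put, LoopProg.vars, hs, ht, List.append_nil]

theorem mem_arrs_put {b : ℕ} : b ∈ (t.put a i j).arrs ↔ b = a := by
  induction t with
  | ret => exact List.mem_singleton
  | ite c s t hs ht => rw [put, LoopProg.arrs, List.mem_append, hs, ht, or_self]

/-- The program that fills array `a` with the values of a decision tree, the row index being in
variable `4` and the column index in variable `5`. -/
def table (a : ℕ) (t : Choice) : LoopProg :=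
  .rep 4 (.rep 5 (t.put a (.var 4) (.var 5)))

variable {n : ℕ}

theorem run_table (hn : m.var 0 = n) (ha : a ∉ t.arrs) (i j : Fin n) :
    ((t.table a).run m).arr a i j = t.eval ((m.setVar 4 i).setVar 5 j) := by
  have hput := vars_put (t := t) (a := a) (i := .var 4) (j := .var 5)
  refine LoopProg.run_pairs (Q := fun S arr => ∀ q ∈ S,
    arr a q.1 q.2 = t.eval ((m.setVar 4 q.1).setVar 5 q.2)) hn (by simp [LoopProg.vars, hput])
    (by simp [LoopProg.vars, hput]) (by simp) (fun i j S m' hi hj hF _ hQ q hq => ?_) (i, j)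
    (Finset.mem_univ _)
  have ht : t.eval m' = t.eval ((m.setVar 4 i).setVar 5 j) := by
    refine eval_congr (funext fun x => ?_) fun b hb =>
      hF.arr_eq b fun h => ha (mem_arrs_put.1 h ▸ hb)
    simp only [Mem.setVar_var]
    split_ifs with h5 h4
    · rw [h5, hj]
    · rw [h4, hi]
    · exact hF.var_eq x (by simp [LoopProg.vars, hput, h4, h5])
  rw [run_put, Mem.setArr_arr, ht]
  simp only [Expr.eval, hi, hj]
  rcases Finset.mem_insert.1 hq with rfl | hq
  · simp
  · split_ifs with h
    · obtain ⟨h1, h2⟩ : q.1 = i ∧ q.2 = j := ⟨Fin.ext h.2.1, Fin.ext h.2.2⟩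
      rw [h1, h2]
    · exact hQ q hq

/-- The program that fills array `a` with the values of a decision tree which may read array `a`
itself: array `9` is a buffer. -/
def fill (a : ℕ) (t : Choice) : LoopProg :=
  .seq (t.table 9) ((ret (.get 9 (.var 4) (.var 5))).table a)

theorem run_fill (hn : m.var 0 = n) (ha : a ≠ 9) (ht : 9 ∉ t.arrs) (i j : Fin n) :
    ((t.fill a).run m).arr a i j = t.eval ((m.setVar 4 i).setVar 5 j) := by
  have hn' : ((t.table 9).run m).var 0 = n := by
    rw [LoopProg.run_var _ _ (by simp [table, LoopProg.vars, vars_put]), hn]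
  rw [fill, LoopProg.run, run_table hn' (by simp [arrs, Expr.arrs, ha]), ← run_table hn ht]
  simp [eval, Expr.eval, Mem.setVar_var, Mem.setVar_arr]

theorem mem_arrs_fill {b : ℕ} : b ∈ (t.fill a).arrs ↔ b = 9 ∨ b = a := by
  simp [fill, table, LoopProg.arrs, mem_arrs_put]

theorem run_fill_arr {b : ℕ} (h9 : b ≠ 9) (ha : b ≠ a) : ((t.fill a).run m).arr b = m.arr b :=
  LoopProg.run_arr _ _ fun h => (mem_arrs_fill.1 h).elim h9 ha

theorem vars_fill : (t.fill a).vars = [4, 5, 4, 5] := by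
  simp [fill, table, LoopProg.vars, vars_put]

theorem run_fill_var {x : ℕ} (h4 : x ≠ 4) (h5 : x ≠ 5) : ((t.fill a).run m).var x = m.var x :=
  LoopProg.run_var _ _ (by simp [vars_fill, h4, h5])

end Choice

namespace LoopProg

/-- The program that counts in variable `x` the values of variable `6` for which `c` is true. -/
def count (x : ℕ) (c : Expr) : LoopProg :=
  set x (.lit 0) ⨟ rep 6 (branch c (set x (.add (.var x) (.lit 1))) skip)

theorem run_count {n x : ℕ} {c : Expr} {m : Mem} {P : Fin n → Prop} [DecidablePred P]
    (hn : m.var 0 = n) (h0 : x ≠ 0) (h6 : x ≠ 6) (hx : x ∉ c.vars)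
    (hc : ∀ z : Fin n, c.eval (m.setVar 6 z) ≠ 0 ↔ P z) :
    ((count x c).run m).var x = (Finset.univ.filter P).card := by
  have hmain := run_rep (x := 6) (p := branch c (set x (.add (.var x) (.lit 1))) skip)
    (m := m.setVar x 0)
    (Q := fun i m' => m'.var x = Nat.count (fun z => c.eval (m.setVar 6 z) ≠ 0) i)
    ((if_neg h0.symm).trans hn) (fun i m' v h => (if_neg h6).trans h) (if_pos rfl)
    fun i _ m' hmi hF hQ => ?_
  · rw [count, run, run, Expr.eval, hmain, Nat.count_eq_card_filter_range, ← Nat.Iio_eq_range,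
      ← Fin.map_valEmbedding_univ, Finset.filter_map, Finset.card_map]
    exact congrArg Finset.card (Finset.filter_congr fun z _ => hc z)
  · have hci : c.eval m' = c.eval (m.setVar 6 i) := by
      refine Expr.eval_congr (fun y hy => ?_) fun b _ => hF.arr_eq b (List.not_mem_nil)
      have hyx : y ≠ x := fun h => hx (h ▸ hy)
      rw [Mem.setVar_var]
      split_ifs with h
      · rw [h, hmi]
      · rw [hF.var_eq y (by simp [vars, h, hyx]), Mem.setVar_var, if_neg hyx]
    rw [Nat.count_succ, ← hQ, run, hci]
    split_ifs
    · exact if_pos rfl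
    · rfl

end LoopProg

section MatchingSearch

open Choice

/-- The truth value of the adjacency of `i` and `j` in the graph that is searched for a matching,
which array `2` holds. -/
def adjE (i j : Expr) : Expr := .get 2 i j

/-- The mate of `i`. Every row of array `3` holds the mates of all vertices. -/
def mateE (i : Expr) : Expr := .get 3 i i

/-- The truth value of `i` being outer. Every row of array `4` holds the set of outer vertices. -/
def outerE (i : Expr) : Expr := .get 4 i i

/-- The truth value of `j` being in the stem of `i`, from array `5`. -/
def stemE (i j : Expr) : Expr := .get 5 i j

/-- The value at `j` of the matching `F.alt i`, from array `6`. -/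
def altE (i j : Expr) : Expr := .get 6 i j

/-- The arrays `2`, …, `6` hold the graph `G` and the alternating forest `F`. -/
structure Stores {n : ℕ} (arr : ℕ → ℕ → ℕ → ℕ) (G : SimpleGraph (Fin n)) (F : AltForest (Fin n)) :
    Prop where
  adj : ∀ i j : Fin n, arr 2 i j ≠ 0 ↔ G.Adj i j
  mate : ∀ i j : Fin n, arr 3 i j = F.mate j
  outer : ∀ i j : Fin n, arr 4 i j ≠ 0 ↔ j ∈ F.outer
  stem : ∀ i j : Fin n, arr 5 i j ≠ 0 ↔ j ∈ F.stem i
  alt : ∀ i j : Fin n, arr 6 i j = F.alt i j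

/-- The memory holds `G` and `F`, the number of vertices in variable `0`, and in the variables `2`
and `3` the vertices `v` and `w` between which the search is looking for an edge. -/
structure Loaded {n : ℕ} (m : Mem) (G : SimpleGraph (Fin n)) (F : AltForest (Fin n)) (v w : Fin n) :
    Prop extends Stores m.arr G F where
  var_n : m.var 0 = n
  var_v : m.var 2 = v
  var_w : m.var 3 = w

variable {n : ℕ} {m m' : Mem} {G : SimpleGraph (Fin n)} {F : AltForest (Fin n)} {v w : Fin n}

namespace Stores

variable (h : Stores m.arr G F) {e f : Expr} {i j : Fin n}
include h

theorem eval_adjE (he : e.eval m = i) (hf : f.eval m = j) :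
    (adjE e f).eval m ≠ 0 ↔ G.Adj i j := by
  rw [adjE, Expr.eval, he, hf, h.adj]

theorem eval_mateE (he : e.eval m = i) : (mateE e).eval m = F.mate i := by
  rw [mateE, Expr.eval, he, h.mate]

theorem eval_outerE (he : e.eval m = i) : (outerE e).eval m ≠ 0 ↔ i ∈ F.outer := by
  rw [outerE, Expr.eval, he, h.outer]

theorem eval_stemE (he : e.eval m = i) (hf : f.eval m = j) :
    (stemE e f).eval m ≠ 0 ↔ j ∈ F.stem i := by
  rw [stemE, Expr.eval, he, hf, h.stem]

theorem eval_altE (he : e.eval m = i) (hf : f.eval m = j) : (altE e f).eval m = F.alt i j := by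
  rw [altE, Expr.eval, he, hf, h.alt]

end Stores

theorem eval_eq_fin {e f : Expr} {i j : Fin n} (he : e.eval m = i) (hf : f.eval m = j) :
    (Expr.eq e f).eval m ≠ 0 ↔ i = j := by
  rw [Expr.eval_eq_ne_zero, he, hf, Fin.val_inj]

theorem eval_ite {c : Expr} {s t : Choice} {P : Prop} [Decidable P] {i j : Fin n}
    (hc : c.eval m ≠ 0 ↔ P) (hs : s.eval m = i) (ht : t.eval m = j) :
    (ite c s t).eval m = (if P then i else j : Fin n) := by
  rw [Choice.eval, hs, ht, apply_ite Fin.val]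
  exact if_congr hc rfl rfl

theorem eval_ite_mem {c : Expr} {s t : Choice} {P : Prop} [Decidable P] {S T : Finset (Fin n)}
    {j : Fin n} (hc : c.eval m ≠ 0 ↔ P) (hs : s.eval m ≠ 0 ↔ j ∈ S) (ht : t.eval m ≠ 0 ↔ j ∈ T) :
    (ite c s t).eval m ≠ 0 ↔ j ∈ if P then S else T := by
  rw [Choice.eval, if_congr hc rfl rfl]
  split_ifs
  exacts [hs, ht]

theorem eval_swap_joinMate {e f : Expr} {t : Choice} {i : Fin n} {g : Fin n → Fin n}
    (he : e.eval m = v) (hf : f.eval m = w) (ht : t.eval m = g i) :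
    (t.swap e f).eval m = joinMate g v w i := by
  rw [eval_swap, he, hf, ht, Fin.val_injective.swap_apply, joinMate]

namespace Loaded

theorem congr (h : Loaded m G F v w) (hvar : ∀ x ∈ [0, 2, 3], m'.var x = m.var x)
    (harr : ∀ a ∈ [2, 3, 4, 5, 6], m'.arr a = m.arr a) : Loaded m' G F v w := by
  simp only [List.forall_mem_cons, List.not_mem_nil, false_imp_iff, implies_true, and_true]
    at hvar harr
  exact ⟨⟨by simpa only [harr] using h.adj, by simpa only [harr] using h.mate,
    by simpa only [harr] using h.outer, by simpa only [harr] using h.stem,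
    by simpa only [harr] using h.alt⟩, by rw [hvar.1, h.var_n], by rw [hvar.2.1, h.var_v],
    by rw [hvar.2.2, h.var_w]⟩

theorem cell (h : Loaded m G F v w) (i j : ℕ) : Loaded ((m.setVar 4 i).setVar 5 j) G F v w :=
  h.congr (by simp [Mem.setVar_var]) fun _ _ => rfl

variable {t : Choice} (h : Loaded m G F v w)
include h

theorem fill_mate {f : Fin n → Fin n}
    (hf : ∀ i j : Fin n, t.eval ((m.setVar 4 i).setVar 5 j) = f j) (ht : 9 ∉ t.arrs := by decide) :
    Loaded ((t.fill 3).run m) G { F with mate := f } v w where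
  adj := by simpa [run_fill_arr] using h.adj
  mate i j := (run_fill h.var_n (by decide) ht i j).trans (hf i j)
  outer := by simpa [run_fill_arr] using h.outer
  stem := by simpa [run_fill_arr] using h.stem
  alt := by simpa [run_fill_arr] using h.alt
  var_n := by simpa [run_fill_var] using h.var_n
  var_v := by simpa [run_fill_var] using h.var_v
  var_w := by simpa [run_fill_var] using h.var_w

theorem fill_outer {S : Finset (Fin n)}
    (hS : ∀ i j : Fin n, t.eval ((m.setVar 4 i).setVar 5 j) ≠ 0 ↔ j ∈ S)
    (ht : 9 ∉ t.arrs := by decide) :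
    Loaded ((t.fill 4).run m) G { F with outer := S } v w where
  adj := by simpa [run_fill_arr] using h.adj
  mate := by simpa [run_fill_arr] using h.mate
  outer i j := by rw [run_fill h.var_n (by decide) ht i j, hS]
  stem := by simpa [run_fill_arr] using h.stem
  alt := by simpa [run_fill_arr] using h.alt
  var_n := by simpa [run_fill_var] using h.var_n
  var_v := by simpa [run_fill_var] using h.var_v
  var_w := by simpa [run_fill_var] using h.var_w

theorem fill_stem {S : Fin n → Finset (Fin n)}
    (hS : ∀ i j : Fin n, t.eval ((m.setVar 4 i).setVar 5 j) ≠ 0 ↔ j ∈ S i)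
    (ht : 9 ∉ t.arrs := by decide) :
    Loaded ((t.fill 5).run m) G { F with stem := S } v w where
  adj := by simpa [run_fill_arr] using h.adj
  mate := by simpa [run_fill_arr] using h.mate
  outer := by simpa [run_fill_arr] using h.outer
  stem i j := by rw [run_fill h.var_n (by decide) ht i j, hS]
  alt := by simpa [run_fill_arr] using h.alt
  var_n := by simpa [run_fill_var] using h.var_n
  var_v := by simpa [run_fill_var] using h.var_v
  var_w := by simpa [run_fill_var] using h.var_w

theorem fill_alt {f : Fin n → Fin n → Fin n}
    (hf : ∀ i j : Fin n, t.eval ((m.setVar 4 i).setVar 5 j) = f i j)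
    (ht : 9 ∉ t.arrs := by decide) :
    Loaded ((t.fill 6).run m) G { F with alt := f } v w where
  adj := by simpa [run_fill_arr] using h.adj
  mate := by simpa [run_fill_arr] using h.mate
  outer := by simpa [run_fill_arr] using h.outer
  stem := by simpa [run_fill_arr] using h.stem
  alt i j := (run_fill h.var_n (by decide) ht i j).trans (hf i j)
  var_n := by simpa [run_fill_var] using h.var_n
  var_v := by simpa [run_fill_var] using h.var_v
  var_w := by simpa [run_fill_var] using h.var_w

end Loaded

/-- The program that turns the matching in memory into the initial forest of the search. -/
def LoopProg.initForest : LoopProg :=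
  (ret (.eq (mateE (.var 5)) (.var 5))).fill 4 ⨟ (ret (.eq (.var 4) (.var 5))).fill 5 ⨟
    (ret (mateE (.var 5))).fill 6

theorem Loaded.initForest (h : Loaded m G F v w) :
    Loaded (LoopProg.initForest.run m) G (AltForest.init F.mate) v w := by
  have houter : Loaded (((ret (.eq (mateE (.var 5)) (.var 5))).fill 4).run m) G
      { F with outer := exposed F.mate } v w := h.fill_outer fun i j => by
    rw [mem_exposed]
    exact eval_eq_fin ((h.cell i j).eval_mateE rfl) rfl
  have hstem := houter.fill_stem (t := ret (.eq (.var 4) (.var 5))) (S := fun x => {x}) fun i j =>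
    (eval_eq_fin rfl rfl).trans (eq_comm.trans Finset.mem_singleton.symm)
  exact hstem.fill_alt fun i j => (hstem.cell i j).eval_mateE rfl

/-- The decision tree for `AltForest.augment`. -/
def Choice.augment : Choice :=
  (ite (stemE (.var 2) (.var 5)) (ret (altE (.var 2) (.var 5)))
    (ite (stemE (.var 3) (.var 5)) (ret (altE (.var 3) (.var 5)))
      (ret (mateE (.var 5))))).swap (.var 2) (.var 3)

theorem Loaded.augment (h : Loaded m G F v w) :
    Loaded ((Choice.augment.fill 3).run m) G { F with mate := F.augment v w } v w :=
  h.fill_mate fun i j => by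
    have h' := h.cell i j
    exact eval_swap_joinMate h'.var_v h'.var_w <|
      eval_ite (h'.eval_stemE h'.var_v rfl) (h'.eval_altE h'.var_v rfl) <|
      eval_ite (h'.eval_stemE h'.var_w rfl) (h'.eval_altE h'.var_w rfl) (h'.eval_mateE rfl)

/-- The decision tree for `AltForest.growMate`. -/
def Choice.growMate : Choice :=
  (ite (.add (.eq (.var 5) (.var 3)) (.eq (.var 5) (altE (.var 2) (.var 3)))) (ret (.var 5))
    (ret (altE (.var 2) (.var 5)))).swap (.var 2) (.var 3)

theorem Loaded.eval_growMate {j : Fin n} (h : Loaded m G F v w) (hj : m.var 5 = j) :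
    Choice.growMate.eval m = F.growMate v w j :=
  eval_swap_joinMate h.var_v h.var_w <|
    eval_ite (Expr.eval_add_ne_zero.trans <| or_congr (eval_eq_fin hj h.var_w) <|
      eval_eq_fin hj (h.eval_altE h.var_v h.var_w)) hj (h.eval_altE h.var_v hj)

/-- The decision tree for the matchings `alt` of `AltForest.grow`. -/
def Choice.growAlt : Choice :=
  ite (.eq (.var 4) (mateE (.var 3))) growMate (ret (altE (.var 4) (.var 5)))

/-- The decision tree for the stems of `AltForest.grow`. -/
def Choice.growStem : Choice :=
  ite (.eq (.var 4) (mateE (.var 3)))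
    (ret (.add (.eq (.var 5) (mateE (.var 3)))
      (.add (.eq (.var 5) (.var 3)) (stemE (.var 2) (.var 5)))))
    (ite (.eq (.var 4) (.var 3)) (ret (stemE (.var 2) (.var 5))) (ret (stemE (.var 4) (.var 5))))

/-- The decision tree for the outer vertices of `AltForest.grow`. -/
def Choice.growOuter : Choice :=
  ret (.add (.eq (.var 5) (mateE (.var 3))) (outerE (.var 5)))

theorem Loaded.grow (h : Loaded m G F v w) :
    Loaded ((growAlt.fill 6 ⨟ growStem.fill 5 ⨟ growOuter.fill 4).run m) G (F.grow v w) v w := by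
  have halt := h.fill_alt (t := growAlt)
    (f := Function.update F.alt (F.mate w) (F.growMate v w)) fun i j => by
      have h' := h.cell i j
      rw [Function.update_apply, ite_apply]
      exact eval_ite (eval_eq_fin rfl (h'.eval_mateE h'.var_w)) (h'.eval_growMate rfl)
        (h'.eval_altE rfl rfl)
  have hstem := halt.fill_stem (t := growStem) (S := (F.grow v w).stem) fun i j => by
    have h' := halt.cell i j
    have hj : j ∈ insert (F.mate w) (insert w (F.stem v)) ↔
        j = F.mate w ∨ j = w ∨ j ∈ F.stem v := by
      rw [Finset.mem_insert, Finset.mem_insert]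
    simp only [AltForest.grow, Function.update_apply]
    refine eval_ite_mem (eval_eq_fin rfl (h'.eval_mateE h'.var_w)) (Iff.trans ?_ hj.symm) <|
      eval_ite_mem (eval_eq_fin rfl h'.var_w) (h'.eval_stemE h'.var_v rfl) (h'.eval_stemE rfl rfl)
    exact Expr.eval_add_ne_zero.trans <| or_congr (eval_eq_fin rfl (h'.eval_mateE h'.var_w)) <|
      Expr.eval_add_ne_zero.trans <|
        or_congr (eval_eq_fin rfl h'.var_w) (h'.eval_stemE h'.var_v rfl)
  refine hstem.fill_outer (t := growOuter) fun i j => ?_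
  have h' := hstem.cell i j
  rw [Finset.mem_insert]
  exact Expr.eval_add_ne_zero.trans <|
    or_congr (eval_eq_fin rfl (h'.eval_mateE h'.var_w)) (h'.eval_outerE rfl)

/-- The program that stores in array `7` for each vertex `x` the number of common vertices of the
stems of `v` and `w` that are not in the stem of `x`. -/
def LoopProg.tallyMissing : LoopProg :=
  .rep 4 (.count 10 (.and (.and (stemE (.var 2) (.var 6)) (stemE (.var 3) (.var 6)))
    (stemE (.var 4) (.var 6)).not) ⨟ .put 7 (.var 4) (.lit 0) (.var 10))

theorem Loaded.tallyMissing (h : Loaded m G F v w) :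
    Loaded (LoopProg.tallyMissing.run m) G F v w :=
  h.congr (fun x hx => LoopProg.run_var _ _ (by revert x; decide)) fun a ha =>
    LoopProg.run_arr _ _ (by revert a; decide)

theorem Loaded.tallyMissing_arr (h : Loaded m G F v w) (x : Fin n) :
    (LoopProg.tallyMissing.run m).arr 7 x 0 ≠ 0 ↔ ¬ F.stem v ∩ F.stem w ⊆ F.stem x := by
  refine LoopProg.run_rep (Q := fun i m' => ∀ x : Fin n, (x : ℕ) < i →
    (m'.arr 7 x 0 ≠ 0 ↔ ¬ F.stem v ∩ F.stem w ⊆ F.stem x)) h.var_n (fun _ _ _ h => h)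
    (fun x hx => absurd hx x.1.not_lt_zero) (fun i hi m' hmi hF hQ x hx => ?_) x x.2
  have h' : Loaded m' G F v w :=
    h.congr (fun y hy => hF.var_eq y (by revert y; decide)) fun a ha =>
      hF.arr_eq a (by revert a; decide)
  have hcount := LoopProg.run_count (n := n) (x := 10) (m := m') (c := .and (.and
    (stemE (.var 2) (.var 6)) (stemE (.var 3) (.var 6))) (stemE (.var 4) (.var 6)).not)
    (P := fun z => (z ∈ F.stem v ∧ z ∈ F.stem w) ∧ z ∉ F.stem ⟨i, hi⟩) h'.var_n
    (by decide) (by decide) (by decide) fun z => ?_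
  · have h4 : ∀ c, ((LoopProg.count 10 c).run m').var 4 = i := fun c =>
      (LoopProg.run_var _ _ (by simp [LoopProg.count, LoopProg.vars])).trans hmi
    have h7 : ∀ c, ((LoopProg.count 10 c).run m').arr 7 = m'.arr 7 := fun c =>
      LoopProg.run_arr _ _ (by simp [LoopProg.count, LoopProg.arrs])
    simp only [LoopProg.run, Expr.eval, Mem.setArr_arr, h4, h7, hcount, true_and, and_true]
    rcases (Nat.lt_succ_iff_lt_or_eq.1 hx) with hx | rfl
    · rw [if_neg hx.ne, hQ x hx]
    · simp [Finset.not_subset, and_assoc]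
  · have h'' : Loaded (m'.setVar 6 z) G F v w := h'.congr (by simp [Mem.setVar_var]) fun _ _ => rfl
    exact Expr.eval_and_ne_zero.trans <| and_congr (Expr.eval_and_ne_zero.trans <|
      and_congr (h''.eval_stemE h''.var_v rfl) (h''.eval_stemE h''.var_w rfl)) <|
      Expr.eval_not_ne_zero.trans <| not_congr <|
        h''.eval_stemE (e := .var 4) (i := ⟨i, hi⟩) hmi rfl

/-- The truth value of the stem of `x` containing those vertices that are common to the stems of
`v` and `w`, after `tallyMissing`. -/
def interE (x : Expr) : Expr := .not (.get 7 x (.lit 0))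

/-- The decision tree for `AltForest.bypass`, with the variables that hold `v` and `w` as
arguments. -/
def Choice.bypass (x y : ℕ) : Choice :=
  (ite (.and (stemE (.var x) (.var 5)) (.not (.add (.eq (.var 5) (.var 4))
      (stemE (.var 4) (.var 5))))) (ret (altE (.var x) (.var 5))) <|
    ite (stemE (.var y) (.var 5)) (ret (altE (.var y) (.var 5))) <|
    ite (.add (.eq (.var 5) (.var 4)) (.eq (.var 5) (mateE (.var 4)))) (ret (.var 5)) <|
    ret (mateE (.var 5))).swap (.var x) (.var y)

theorem Stores.eval_bypass {x y : ℕ} {i j : Fin n} (h : Stores m.arr G F) (hx : m.var x = v)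
    (hy : m.var y = w) (hi : (Expr.var 4).eval m = i) (hj : (Expr.var 5).eval m = j) :
    (Choice.bypass x y).eval m = F.bypass v w i j :=
  eval_swap_joinMate hx hy <| eval_ite
    (Expr.eval_and_ne_zero.trans <| Iff.trans (and_congr (h.eval_stemE hx hj) <|
      Expr.eval_not_ne_zero.trans <| not_congr <| Expr.eval_add_ne_zero.trans <|
        (or_congr (eval_eq_fin hj hi) (h.eval_stemE hi hj)).trans Finset.mem_insert.symm)
      Finset.mem_sdiff.symm) (h.eval_altE hx hj) <|
    eval_ite (h.eval_stemE hy hj) (h.eval_altE hy hj) <|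
    eval_ite (Expr.eval_add_ne_zero.trans <|
      or_congr (eval_eq_fin hj hi) (eval_eq_fin hj (h.eval_mateE hi))) hj (h.eval_mateE hj)

theorem Stores.eval_stemE_add {e e' f : Expr} {i i' j : Fin n} (h : Stores m.arr G F)
    (he : e.eval m = i) (he' : e'.eval m = i') (hf : f.eval m = j) :
    (Expr.add (stemE e f) (stemE e' f)).eval m ≠ 0 ↔ j ∈ F.stem i ∪ F.stem i' := by
  rw [Expr.eval_add_ne_zero, h.eval_stemE he hf, h.eval_stemE he' hf, Finset.mem_union]

/-- The decision tree for the matchings `alt` of `AltForest.contract`. -/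
def Choice.contractAlt : Choice :=
  ite (outerE (.var 4)) (ret (altE (.var 4) (.var 5))) <|
    ite (stemE (.var 2) (.var 4)) (bypass 2 3) (bypass 3 2)

/-- The decision tree for the outer vertices of `AltForest.contract`. -/
def Choice.contractOuter : Choice :=
  ret (.add (outerE (.var 5)) (.and (.add (stemE (.var 2) (.var 5)) (stemE (.var 3) (.var 5)))
    (interE (.var 5))))

/-- The decision tree for the stems of `AltForest.contract`. -/
def Choice.contractStem : Choice :=
  ite (interE (.var 4)) (ret (.add (stemE (.var 4) (.var 5))
    (.add (stemE (.var 2) (.var 5)) (stemE (.var 3) (.var 5))))) (ret (stemE (.var 4) (.var 5)))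

/-- The program for `AltForest.contract`. -/
def LoopProg.contract : LoopProg :=
  tallyMissing ⨟ contractAlt.fill 6 ⨟ contractOuter.fill 4 ⨟ contractStem.fill 5

theorem Loaded.contract (h : Loaded m G F v w) :
    Loaded (LoopProg.contract.run m) G (F.contract v w) v w := by
  have htally := h.tallyMissing
  have halt := htally.fill_alt (t := contractAlt) (f := (F.contract v w).alt) fun i j => by
    have h' := htally.cell i j
    simp only [AltForest.contract, ite_apply]
    exact eval_ite (h'.eval_outerE rfl) (h'.eval_altE rfl rfl) <|
      eval_ite (h'.eval_stemE h'.var_v rfl) (h'.eval_bypass h'.var_v h'.var_w rfl rfl)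
        (h'.eval_bypass h'.var_w h'.var_v rfl rfl)
  have hinter : ∀ {m' : Mem} {e : Expr} {x : Fin n},
      m'.arr 7 = (LoopProg.tallyMissing.run m).arr 7 → e.eval m' = x →
      ((interE e).eval m' ≠ 0 ↔ F.stem v ∩ F.stem w ⊆ F.stem x) := fun {m' e x} h7 hx => by
    rw [interE, Expr.eval_not_ne_zero, Expr.eval, h7, hx, Expr.eval, h.tallyMissing_arr, not_not]
  have houter := halt.fill_outer (t := contractOuter) (S := (F.contract v w).outer) fun i j => by
    have h' := halt.cell i j
    rw [AltForest.contract, Finset.mem_union, AltForest.mem_newBlossom]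
    exact Expr.eval_add_ne_zero.trans <| or_congr (h'.eval_outerE rfl) <|
      Expr.eval_and_ne_zero.trans <| and_congr (h'.eval_stemE_add h'.var_v h'.var_w rfl) <|
        hinter (run_fill_arr (by decide) (by decide)) rfl
  refine houter.fill_stem (t := contractStem) fun i j => ?_
  have h' := houter.cell i j
  refine eval_ite_mem (hinter ?_ rfl) (Iff.trans ?_ Finset.mem_union.symm) (h'.eval_stemE rfl rfl)
  · exact (run_fill_arr (by decide) (by decide)).trans (run_fill_arr (by decide) (by decide))
  · exact Expr.eval_add_ne_zero.trans <|
      or_congr (h'.eval_stemE rfl rfl) (h'.eval_stemE_add h'.var_v h'.var_w rfl)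

/-- The program that counts in variable `11` the common vertices of the stems of `v` and `w`, and
in variable `12` the vertices in exactly one of them. -/
def LoopProg.compareStems : LoopProg :=
  count 11 (.and (stemE (.var 2) (.var 6)) (stemE (.var 3) (.var 6))) ⨟
    count 12 (.add (.and (stemE (.var 2) (.var 6)) (.not (stemE (.var 3) (.var 6))))
      (.and (stemE (.var 3) (.var 6)) (.not (stemE (.var 2) (.var 6)))))

theorem Loaded.compareStems (h : Loaded m G F v w) :
    Loaded (LoopProg.compareStems.run m) G F v w ∧
      ((LoopProg.compareStems.run m).var 11 ≠ 0 ↔ (F.stem v ∩ F.stem w).Nonempty) ∧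
      ((LoopProg.compareStems.run m).var 12 ≠ 0 ↔ F.stem v ≠ F.stem w) := by
  have hloaded : ∀ {p : LoopProg} {m : Mem}, Loaded m G F v w → (∀ x ∈ [0, 2, 3], x ∉ p.vars) →
      p.arrs = [] → Loaded (p.run m) G F v w := fun {p m} h hvars harrs =>
    h.congr (fun x hx => p.run_var m (hvars x hx)) fun a _ => p.run_arr m (by simp [harrs])
  have hv : ∀ {m : Mem} (z : Fin n), Loaded m G F v w →
      ((stemE (.var 2) (.var 6)).eval (m.setVar 6 z) ≠ 0 ↔ z ∈ F.stem v) := fun z h =>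
    h.eval_stemE (m := Mem.setVar _ 6 z) h.var_v rfl
  have hw : ∀ {m : Mem} (z : Fin n), Loaded m G F v w →
      ((stemE (.var 3) (.var 6)).eval (m.setVar 6 z) ≠ 0 ↔ z ∈ F.stem w) := fun z h =>
    h.eval_stemE (m := Mem.setVar _ 6 z) h.var_w rfl
  have h₁ := hloaded (p := .count 11 (.and (stemE (.var 2) (.var 6)) (stemE (.var 3) (.var 6)))) h
    (by decide) rfl
  refine ⟨hloaded h (by decide) rfl, ?_, ?_⟩
  · rw [LoopProg.compareStems, LoopProg.run, LoopProg.run_var _ _ (by decide),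
      LoopProg.run_count (P := (· ∈ F.stem v ∩ F.stem w)) h.var_n (by decide) (by decide)
        (by decide) fun z => ?_]
    · rw [Finset.filter_univ_mem, Finset.card_ne_zero]
    · rw [Finset.mem_inter]
      exact Expr.eval_and_ne_zero.trans (and_congr (hv z h) (hw z h))
  · rw [LoopProg.compareStems, LoopProg.run,
      LoopProg.run_count (P := fun z => z ∈ F.stem v ∧ z ∉ F.stem w ∨ z ∈ F.stem w ∧ z ∉ F.stem v)
        h₁.var_n (by decide) (by decide) (by decide) fun z => ?_]
    · rw [Finset.card_ne_zero, Finset.Nonempty, ne_eq, Finset.ext_iff, not_forall]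
      refine exists_congr fun z => ?_
      rw [Finset.mem_filter_univ]
      tauto
    · exact Expr.eval_add_ne_zero.trans <| or_congr
        (Expr.eval_and_ne_zero.trans <|
          and_congr (hv z h₁) <| Expr.eval_not_ne_zero.trans <| not_congr <| hw z h₁)
        (Expr.eval_and_ne_zero.trans <|
          and_congr (hw z h₁) <| Expr.eval_not_ne_zero.trans <| not_congr <| hv z h₁)

/-- The program for `AltForest.scan`. -/
def LoopProg.scan : LoopProg :=
  branch (.and (adjE (.var 2) (.var 3)) (outerE (.var 2)))
    (branch (outerE (.var 3))
      (compareStems ⨟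
        branch (.var 11) (branch (.var 12) contract skip) (augment.fill 3 ⨟ initForest))
      (branch (outerE (mateE (.var 3))) skip
        (growAlt.fill 6 ⨟ growStem.fill 5 ⨟ growOuter.fill 4)))
    skip

theorem Loaded.scan [DecidableRel G.Adj] (h : Loaded m G F v w) :
    Loaded (LoopProg.scan.run m) G (F.scan G v w) v w := by
  have hv : (Expr.var 2).eval m = v := h.var_v
  have hw : (Expr.var 3).eval m = w := h.var_w
  have hvw := Expr.eval_and_ne_zero.trans (and_congr (h.eval_adjE hv hw) (h.eval_outerE hv))
  obtain ⟨hcmp, hinter, hstem⟩ := h.compareStems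
  simp only [AltForest.scan, LoopProg.scan, LoopProg.run, Expr.eval, hvw, h.eval_outerE hw,
    hinter, hstem, h.eval_outerE (h.eval_mateE hw), ite_not]
  split_ifs
  exacts [hcmp, hcmp.contract, hcmp.augment.initForest, h, h.grow, h]

theorem AltForest.rank_init_id {V : Type*} [Fintype V] [DecidableEq V] :
    (init (id : V → V)).rank = (Fintype.card V + 1) * Fintype.card V := by
  simp [rank, init, exposed]

theorem IsMaxMate.of_card_exposed_le {V : Type*} [Fintype V] [DecidableEq V] {G : SimpleGraph V}
    {f g : V → V} (hf : IsMaxMate G f) (hg : IsMate G g)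
    (h : (exposed g).card ≤ (exposed f).card) : IsMaxMate G g :=
  ⟨hg, fun _ hg' => h.trans (hf.card_exposed_le _ hg')⟩

/-- The program that scans all pairs of vertices, in the variables `2` and `3`. -/
def LoopProg.sweep : LoopProg := rep 2 (rep 3 scan)

theorem Stores.sweep [DecidableRel G.Adj] (hn : m.var 0 = n) (h : Stores m.arr G F)
    (hF : IsAltForest G F) :
    ∃ F', Stores (LoopProg.sweep.run m).arr G F' ∧ IsAltForest G F' ∧
      (F'.rank < F.rank ∨ F' = F ∧ ∀ v w, F.scan G v w = F) := by
  have hsweep := LoopProg.run_pairs (x := 2) (y := 3) (p := LoopProg.scan)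
    (Q := fun S arr => ∃ F', Stores arr G F' ∧ IsAltForest G F' ∧
      (F'.rank < F.rank ∨ F' = F ∧ ∀ q ∈ S, F.scan G q.1 q.2 = F)) hn (by decide) (by decide)
    ⟨F, h, hF, .inr ⟨rfl, by simp⟩⟩ ?_
  · simpa only [LoopProg.sweep, Finset.mem_univ, true_imp_iff, Prod.forall] using hsweep
  rintro v w S m' hv hw hframe - ⟨F', hm', hF', hrank⟩
  have hload : Loaded m' G F' v w := ⟨hm', (hframe.var_eq 0 (by decide)).trans hn, hv, hw⟩
  refine ⟨_, hload.scan.toStores, hF'.scan v w, ?_⟩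
  by_cases hscan : F'.scan G v w = F'
  · refine hrank.imp (hscan.symm ▸ ·) ?_
    rintro ⟨rfl, hS⟩
    exact ⟨hscan, (Finset.forall_mem_insert _ _ _).2 ⟨hscan, hS⟩⟩
  · have hlt := hF'.rank_scan_lt hscan
    rcases hrank with hrank | ⟨rfl, -⟩
    exacts [.inl (hlt.trans hrank), .inl hlt]

/-- The program that repeats `sweep` as often as there are pairs of vertices. -/
def LoopProg.search : LoopProg := rep 7 (rep 8 sweep)

theorem Stores.search (hn : m.var 0 = n) (h : Stores m.arr G (AltForest.init id)) :
    ∃ F, Stores (LoopProg.search.run m).arr G F ∧ IsMaxMate G F.mate := by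
  classical
  have hsearch := LoopProg.run_pairs (x := 7) (y := 8) (p := LoopProg.sweep)
    (Q := fun S arr => ∃ F, Stores arr G F ∧ IsAltForest G F ∧
      (IsMaxMate G F.mate ∨ F.rank + S.card ≤ (n + 1) * n)) hn (by decide) (by decide)
    ⟨_, h, isAltForest_init (.id G), .inr (by simp [AltForest.rank_init_id])⟩ ?_
  · obtain ⟨F, hstore, hF, hmax⟩ := hsearch
    refine ⟨F, hstore, hmax.elim id fun hrank => ⟨hF.isMate, fun g _ => ?_⟩⟩
    rw [AltForest.rank, Finset.card_univ, Fintype.card_prod, Fintype.card_fin] at hrank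
    have hexposed : (exposed F.mate).card = 0 := by
      by_contra hne
      nlinarith [Nat.one_le_iff_ne_zero.2 hne]
    exact hexposed.trans_le (Nat.zero_le _)
  rintro i j S m' - - hframe hij ⟨F, hm', hF, hmax⟩
  obtain ⟨F', hstore, hF', hsweep⟩ := hm'.sweep ((hframe.var_eq 0 (by decide)).trans hn) hF
  refine ⟨F', hstore, hF', ?_⟩
  rw [Finset.card_insert_of_notMem hij]
  rcases hsweep with hlt | ⟨rfl, hscan⟩
  · refine hmax.imp (fun hmax => hmax.of_card_exposed_le hF'.isMate ?_) fun hrank => by omega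
    exact not_lt.1 fun hlt' => (AltForest.rank_lt_of_card_exposed_lt hlt').not_gt hlt
  · exact .inl (hF'.isMaxMate_of_scan_eq hscan)

/-- The expression for adjacency in the complement of the graph stored in array `0`. -/
def complE (e f : Expr) : Expr := .and (.not (.eq e f)) (.not (.get 0 e f))

/-- The program that stores the complement of the graph in array `0`, and the initial forest of the
empty matching. -/
def LoopProg.loadCompl : LoopProg :=
  (ret (complE (.var 4) (.var 5))).fill 2 ⨟ (ret (.var 5)).fill 3 ⨟ (ret (.lit 1)).fill 4 ⨟
    (ret (.eq (.var 5) (.var 4))).fill 5 ⨟ (ret (.var 5)).fill 6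

theorem stores_loadCompl (hn : m.var 0 = n) (hG : ∀ i j : Fin n, m.arr 0 i j ≠ 0 ↔ G.Adj i j) :
    Stores (LoopProg.loadCompl.run m).arr Gᶜ (AltForest.init id) := by
  refine ⟨fun i j => ?_, fun i j => ?_, fun i j => ?_, fun i j => ?_, fun i j => ?_⟩
  · have hget : (Expr.get 0 (.var 4) (.var 5)).eval ((m.setVar 4 i).setVar 5 j) ≠ 0 ↔ G.Adj i j :=
      hG i j
    have hcompl : (complE (.var 4) (.var 5)).eval ((m.setVar 4 i).setVar 5 j) ≠ 0 ↔ Gᶜ.Adj i j :=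
      Expr.eval_and_ne_zero.trans <| (and_congr
        (Expr.eval_not_ne_zero.trans <| not_congr <| eval_eq_fin rfl rfl)
        (Expr.eval_not_ne_zero.trans <| not_congr hget)).trans (G.compl_adj i j).symm
    rw [← hcompl, ← Choice.eval, ← run_fill hn (a := 2) (by decide) (by decide)]
    simp [LoopProg.loadCompl, LoopProg.run, run_fill_arr]
  all_goals
    simp [LoopProg.loadCompl, LoopProg.run, run_fill_arr, run_fill, run_fill_var, hn, Choice.arrs,
      Expr.arrs, Choice.eval, Expr.eval, Mem.setVar_var, AltForest.init, mem_exposed, Fin.val_inj]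

/-- The program that finds a maximum matching of the complement of the graph in array `0`, and
counts the exposed vertices in variable `10`. -/
def LoopProg.maxMatching : LoopProg :=
  loadCompl ⨟ search ⨟ count 10 (.eq (mateE (.var 6)) (.var 6))

theorem exists_isMaxMate_run_maxMatching (hn : m.var 0 = n)
    (hG : ∀ i j : Fin n, m.arr 0 i j ≠ 0 ↔ G.Adj i j) :
    ∃ f, IsMaxMate Gᶜ f ∧ (LoopProg.maxMatching.run m).var 10 = (exposed f).card := by
  have hn_load : (LoopProg.loadCompl.run m).var 0 = n := (LoopProg.run_var _ _ (by decide)).trans hn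
  have hn_search : (LoopProg.search.run (LoopProg.loadCompl.run m)).var 0 = n :=
    (LoopProg.run_var _ _ (by decide)).trans hn_load
  obtain ⟨F, hstore, hmax⟩ := (stores_loadCompl hn hG).search hn_load
  refine ⟨F.mate, hmax, ?_⟩
  rw [LoopProg.maxMatching, LoopProg.run, LoopProg.run]
  generalize LoopProg.search.run (LoopProg.loadCompl.run m) = m' at hstore hn_search
  exact LoopProg.run_count hn_search (by decide) (by decide) (by decide) fun z =>
    eval_eq_fin (Stores.eval_mateE (m := m'.setVar 6 z) hstore rfl) rfl

end MatchingSearch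

section Greedy

section

variable {V : Type*} [DecidableEq V] {G : SimpleGraph V} [DecidableRel G.Adj] {U : Finset V}
  {u v : V}

/-- The set of removed vertices after the greedy procedure has tried to remove `u` and `v`. -/
def greedyRemove (G : SimpleGraph V) [DecidableRel G.Adj] (U : Finset V) (u v : V) : Finset V :=
  if u ∈ U ∨ v ∈ U ∨ u = v ∨ G.Adj u v then U else insert u (insert v U)

theorem GreedyRemoved.greedyRemove (h : GreedyRemoved G U) (u v : V) :
    GreedyRemoved G (greedyRemove G U u v) := by
  rw [EqCol.greedyRemove]
  split_ifs with huv
  · exact h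
  · simp only [not_or] at huv
    exact h.step huv.1 huv.2.1 huv.2.2.1 huv.2.2.2

theorem subset_greedyRemove : U ⊆ greedyRemove G U u v := by
  rw [greedyRemove]
  split_ifs
  exacts [subset_rfl, (Finset.subset_insert v U).trans (Finset.subset_insert u _)]

theorem adj_of_notMem_greedyRemove (hu : u ∉ greedyRemove G U u v) (hv : v ∉ greedyRemove G U u v)
    (huv : u ≠ v) : G.Adj u v := by
  rw [greedyRemove] at hu hv
  split_ifs at hu hv with h
  · tauto
  · exact absurd (Finset.mem_insert_self u _) hu

end

variable {n : ℕ} {m : Mem} {G : SimpleGraph (Fin n)} [DecidableRel G.Adj] {U : Finset (Fin n)}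
  {u v : Fin n}

/-- The program for `greedyRemove` with the vertices in the variables `2` and `3`, for the graph in
array `0` and the set in row `0` of array `1`. -/
def LoopProg.greedyRemove : LoopProg :=
  branch (.add (.add (.get 1 (.lit 0) (.var 2)) (.get 1 (.lit 0) (.var 3)))
      (.add (.eq (.var 2) (.var 3)) (.get 0 (.var 2) (.var 3)))) skip
    (put 1 (.lit 0) (.var 2) (.lit 1) ⨟ put 1 (.lit 0) (.var 3) (.lit 1))

theorem Mem.HoldsSet.eval_get_ne_zero {e : Expr} (hU : m.HoldsSet U) (he : e.eval m = u) :
    (Expr.get 1 (.lit 0) e).eval m ≠ 0 ↔ u ∈ U := by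
  rw [Expr.eval, he, Expr.eval, hU u, Ne, ite_eq_right_iff, not_forall]
  simp

theorem run_greedyRemove (hG : ∀ i j : Fin n, m.arr 0 i j ≠ 0 ↔ G.Adj i j) (hU : m.HoldsSet U)
    (hu : m.var 2 = u) (hv : m.var 3 = v) :
    (LoopProg.greedyRemove.run m).HoldsSet (greedyRemove G U u v) := by
  have hadj : (Expr.get 0 (.var 2) (.var 3)).eval m ≠ 0 ↔ G.Adj u v := by
    simp only [Expr.eval, hu, hv, hG]
  have hskip : (Expr.add (.add (.get 1 (.lit 0) (.var 2)) (.get 1 (.lit 0) (.var 3)))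
      (.add (.eq (.var 2) (.var 3)) (.get 0 (.var 2) (.var 3)))).eval m ≠ 0 ↔
      u ∈ U ∨ v ∈ U ∨ u = v ∨ G.Adj u v := by
    rw [Expr.eval_add_ne_zero, Expr.eval_add_ne_zero, Expr.eval_add_ne_zero,
      hU.eval_get_ne_zero (e := .var 2) hu, hU.eval_get_ne_zero (e := .var 3) hv, hadj,
      eval_eq_fin (e := .var 2) (f := .var 3) hu hv, or_assoc]
  rw [LoopProg.greedyRemove, LoopProg.run, greedyRemove, if_congr hskip rfl rfl]
  split_ifs
  · exact hU
  · intro x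
    simp only [LoopProg.run, Mem.setArr_arr, Mem.setArr_var, Expr.eval, hu, hv, hU x, true_and,
      Fin.val_inj, Finset.mem_insert]
    split_ifs <;> tauto

/-- The program for the greedy procedure, which leaves the removed set in row `0` of array `1`. -/
def LoopProg.greedy : LoopProg := rep 2 (rep 3 greedyRemove)

theorem Mem.HoldsInst.arr_ne_zero {I : Inst} (h : m.HoldsInst I) (i j : Fin I.n) :
    m.arr 0 i j ≠ 0 ↔ I.G.Adj i j := by
  classical
  simp [h.2.2 i j]

theorem Inst.holdsInst_input (I : Inst) : I.input.HoldsInst I :=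
  ⟨rfl, rfl, fun i j => by classical exact if_congr (by simp) rfl rfl⟩

theorem Inst.exists_isGreedyModulator_run_greedy (I : Inst) :
    ∃ U, IsGreedyModulator I.G U ∧ (LoopProg.greedy.run I.input).HoldsSet U := by
  classical
  have hgreedy := LoopProg.run_pairs (m := I.input) (x := 2) (y := 3)
    (p := LoopProg.greedyRemove)
    (Q := fun S arr => ∃ U, GreedyRemoved I.G U ∧ (⟨I.input.var, arr⟩ : Mem).HoldsSet U ∧
      ∀ q ∈ S, q.1 ∉ U → q.2 ∉ U → q.1 ≠ q.2 → I.G.Adj q.1 q.2) rfl (by decide) (by decide)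
    ⟨∅, .start, fun i => by simp [Inst.input], by simp⟩ ?_
  · obtain ⟨U, hU, hset, hadj⟩ := hgreedy
    exact ⟨U, ⟨hU, fun u hu v hv => hadj (u, v) (Finset.mem_univ _) hu hv⟩, hset⟩
  rintro u v S m' hu hv hframe - ⟨U, hU, hset, hadj⟩
  have hG' : ∀ i j : Fin I.n, m'.arr 0 i j ≠ 0 ↔ I.G.Adj i j := by
    simpa only [hframe.arr_eq 0 (by decide)] using I.holdsInst_input.arr_ne_zero
  refine ⟨_, hU.greedyRemove u v, run_greedyRemove hG' hset hu hv, ?_⟩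
  refine (Finset.forall_mem_insert _ _ _).2 ⟨adj_of_notMem_greedyRemove, fun q hq h₁ h₂ => ?_⟩
  exact hadj q hq (fun h => h₁ (subset_greedyRemove h)) fun h => h₂ (subset_greedyRemove h)

theorem polyTime_greedy : PolyTime (fun _ => True)
    (fun I m => ∃ U : Finset (Fin I.n), IsGreedyModulator I.G U ∧ m.HoldsSet U) :=
  LoopProg.greedy.polyTime (by decide) fun I _ => I.exists_isGreedyModulator_run_greedy

end Greedy

section Kernel

variable {I : Inst} {U : Finset (Fin I.n)} {m : Mem}

/-- The expression that is true if the number of vertices in variable `0` and that of exposed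
vertices in variable `10` are too large for an equitable coloring with the number of colours in
variable `1`. -/
def tooLargeE : Expr := .lt (.add (.var 1) (.var 1)) (.add (.var 0) (.var 10))

theorem IsCliqueModulator.eval_tooLargeE_ne_zero (hU : IsCliqueModulator I.G U) (hUk : U.card < I.k)
    (hI : m.HoldsInst I) : tooLargeE.eval (LoopProg.maxMatching.run m) ≠ 0 ↔ ¬ I.Yes := by
  classical
  obtain ⟨f, hf, hcard⟩ := exists_isMaxMate_run_maxMatching hI.1 hI.arr_ne_zero
  have h0 : (LoopProg.maxMatching.run m).var 0 = I.n :=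
    (LoopProg.run_var _ _ (by decide)).trans hI.1
  have h1 : (LoopProg.maxMatching.run m).var 1 = I.k :=
    (LoopProg.run_var _ _ (by decide)).trans hI.2.1
  rw [Inst.Yes, hf.equitablyColorable_iff hU hUk, tooLargeE, Expr.eval_lt_ne_zero, not_le,
    Fintype.card_fin, two_mul]
  simp only [Expr.eval, h0, h1, hcard]

theorem polyTime_decide :
    PolyTime (fun I => ∃ U : Finset (Fin I.n), IsCliqueModulator I.G U ∧ U.card < I.k)
      (fun I m => m.HoldsAnswer I.Yes) := by
  refine (LoopProg.maxMatching ⨟ .set 0 tooLargeE.not).polyTime (by decide) ?_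
  rintro I ⟨U, hU, hUk⟩
  have hno := hU.eval_tooLargeE_ne_zero hUk I.holdsInst_input
  classical
  rw [Mem.HoldsAnswer, LoopProg.run, LoopProg.run, Mem.setVar_var, if_pos rfl]
  exact if_congr (not_iff_not.1 hno) rfl rfl

/-- A yes-instance. -/
def yesInst : Inst := ⟨0, ⊥, 1, le_rfl⟩

/-- A no-instance. -/
def noInst : Inst := ⟨2, ⊤, 1, le_rfl⟩

theorem yes_yesInst : yesInst.Yes := equitablyColorable_of_card_lt Nat.zero_lt_one

theorem not_yes_noInst : ¬ noInst.Yes := by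
  rintro ⟨C, -⟩
  exact C.valid (v := (0 : Fin 2)) (w := (1 : Fin 2)) Fin.zero_ne_one
    (Subsingleton.elim (α := Fin 1) _ _)

/-- The program that writes `yesInst`. -/
def LoopProg.writeYes : LoopProg := set 1 (.lit 1) ⨟ set 0 (.lit 0)

theorem holdsInst_run_writeYes (m : Mem) : (LoopProg.writeYes.run m).HoldsInst yesInst :=
  ⟨rfl, rfl, fun i => i.elim0⟩

/-- The program that writes `noInst`. -/
def LoopProg.writeNo : LoopProg :=
  put 0 (.lit 0) (.lit 0) (.lit 0) ⨟ put 0 (.lit 0) (.lit 1) (.lit 1) ⨟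
    put 0 (.lit 1) (.lit 0) (.lit 1) ⨟ put 0 (.lit 1) (.lit 1) (.lit 0) ⨟
    set 1 (.lit 1) ⨟ set 0 (.lit 2)

theorem holdsInst_run_writeNo (m : Mem) : (LoopProg.writeNo.run m).HoldsInst noInst := by
  refine ⟨rfl, rfl, Fin.forall_fin_two.2 ⟨Fin.forall_fin_two.2 ⟨?_, ?_⟩,
    Fin.forall_fin_two.2 ⟨?_, ?_⟩⟩⟩
  exacts [(if_neg (SimpleGraph.irrefl _)).symm, (if_pos Fin.zero_ne_one).symm,
    (if_pos Fin.zero_ne_one.symm).symm, (if_neg (SimpleGraph.irrefl _)).symm]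

open Classical in
/-- The kernel of the instance `I` obtained from the greedy modulator `U`: the instance itself,
unless it is solved. -/
noncomputable def Inst.kernelize (I : Inst) (U : Finset (Fin I.n)) : Inst :=
  if U.card < I.k then if I.Yes then yesInst else noInst
  else if U.card + I.k < I.n then noInst else I

theorem IsCliqueModulator.yes_kernelize (hU : IsCliqueModulator I.G U) :
    (I.kernelize U).Yes ↔ I.Yes := by
  rw [Inst.kernelize]
  split_ifs with hk hyes hn
  · exact iff_of_true yes_yesInst hyes
  · exact iff_of_false not_yes_noInst hyes
  · exact iff_of_false not_yes_noInst (hU.not_equitablyColorable (by rwa [Fintype.card_fin]))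
  · rfl

theorem IsGreedyModulator.kernelize_cases (hU : IsGreedyModulator I.G U) :
    I.kernelize U = yesInst ∨ I.kernelize U = noInst ∨ I.kernelize U = I ∧
      I.k ≤ 2 * distToClique I.G ∧ I.n ≤ 4 * distToClique I.G := by
  have := hU.card_le
  rw [Inst.kernelize]
  split_ifs
  exacts [.inl rfl, .inr (.inl rfl), .inr (.inl rfl), .inr (.inr ⟨rfl, by omega, by omega⟩)]

theorem IsGreedyModulator.n_kernelize_le (hU : IsGreedyModulator I.G U) :
    (I.kernelize U).n ≤ max (4 * distToClique I.G) 2 := by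
  rcases hU.kernelize_cases with h | h | ⟨h, -, hn⟩
  · exact h ▸ Nat.zero_le _
  · exact h ▸ le_max_right _ _
  · exact h.symm ▸ le_max_of_le_left hn

theorem IsGreedyModulator.length_kernelize_le (hU : IsGreedyModulator I.G U) :
    (I.kernelize U).length ≤
      (4 * distToClique I.G) * (4 * distToClique I.G) + Nat.size (2 * distToClique I.G) + 5 := by
  rcases hU.kernelize_cases with h | h | ⟨h, hk, hn⟩ <;> rw [h]
  · simp [Inst.length, yesInst]
  · simp [Inst.length, noInst]
  · exact (Nat.add_le_add (Nat.mul_le_mul hn hn) (Nat.size_le_size hk)).trans (Nat.le_add_right _ 5)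

/-- The program that counts in variable `13` the vertices of the modulator in row `0` of array `1`,
computes a maximum matching of the complement, and writes the kernel for this modulator. -/
def LoopProg.kernelize : LoopProg :=
  count 13 (.get 1 (.lit 0) (.var 6)) ⨟ maxMatching ⨟
    branch (.lt (.var 13) (.var 1)) (branch tooLargeE writeNo writeYes)
      (branch (.lt (.add (.var 13) (.var 1)) (.var 0)) writeNo skip)

theorem Mem.HoldsInst.run (hI : m.HoldsInst I) {p : LoopProg} (h0 : 0 ∉ p.vars) (h1 : 1 ∉ p.vars)
    (ha : 0 ∉ p.arrs) : (p.run m).HoldsInst I :=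
  ⟨(p.run_var m h0).trans hI.1, (p.run_var m h1).trans hI.2.1,
    fun i j => p.run_arr m ha ▸ hI.2.2 i j⟩

theorem IsCliqueModulator.holdsInst_run_kernelize (hU : IsCliqueModulator I.G U)
    (hI : m.HoldsInst I) (hset : m.HoldsSet U) :
    (LoopProg.kernelize.run m).HoldsInst (I.kernelize U) := by
  have hcard : ((LoopProg.count 13 (.get 1 (.lit 0) (.var 6))).run m).var 13 = U.card := by
    rw [LoopProg.run_count (P := (· ∈ U)) hI.1 (by decide) (by decide) (by decide)
      fun z => Mem.HoldsSet.eval_get_ne_zero (m := m.setVar 6 z) hset rfl, Finset.filter_univ_mem]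
  have hIcount : ((LoopProg.count 13 (.get 1 (.lit 0) (.var 6))).run m).HoldsInst I :=
    hI.run (by decide) (by decide) (by decide)
  rw [LoopProg.kernelize, LoopProg.run, LoopProg.run]
  generalize (LoopProg.count 13 (.get 1 (.lit 0) (.var 6))).run m = m' at hcard hIcount
  have hno := fun hUk => hU.eval_tooLargeE_ne_zero hUk hIcount
  have hImax : (LoopProg.maxMatching.run m').HoldsInst I :=
    hIcount.run (by decide) (by decide) (by decide)
  rw [← LoopProg.run_var LoopProg.maxMatching m' (by decide)] at hcard
  generalize LoopProg.maxMatching.run m' = m at hcard hImax hno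
  have hk : (Expr.lt (.var 13) (.var 1)).eval m ≠ 0 ↔ U.card < I.k := by
    rw [Expr.eval_lt_ne_zero, Expr.eval, Expr.eval, hcard, hImax.2.1]
  have hn : (Expr.lt (.add (.var 13) (.var 1)) (.var 0)).eval m ≠ 0 ↔ U.card + I.k < I.n := by
    rw [Expr.eval_lt_ne_zero, Expr.eval, Expr.eval, Expr.eval, Expr.eval, hcard, hImax.1,
      hImax.2.1]
  rw [LoopProg.run, LoopProg.run, LoopProg.run, Inst.kernelize, if_congr hk rfl rfl,
    if_congr hn rfl rfl]
  split_ifs with hUk hT hyes hyes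
  · exact absurd hyes ((hno hUk).1 hT)
  · exact holdsInst_run_writeNo m
  · exact holdsInst_run_writeYes m
  · exact absurd (not_not.1 (mt (hno hUk).2 hT)) hyes
  · exact holdsInst_run_writeNo m
  · exact hImax

theorem hasKernel : HasKernel (fun I => distToClique I.G) (fun d => max (4 * d) 2) := by
  choose U hU hset using Inst.exists_isGreedyModulator_run_greedy
  refine ⟨fun I => I.kernelize (U I), ?_, fun I => (hU I).2.yes_kernelize,
    fun I => (hU I).n_kernelize_le, fun d => (4 * d) * (4 * d) + Nat.size (2 * d) + 5,
    fun I => (hU I).length_kernelize_le⟩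
  refine (LoopProg.greedy ⨟ LoopProg.kernelize).polyTime (by decide) fun I _ => ?_
  refine (hU I).2.holdsInst_run_kernelize ?_ (hset I)
  exact I.holdsInst_input.run (by decide) (by decide) (by decide)

end Kernel

end EqCol

theorem mainTheorem6 :
    -- the kernel; for `d = 0` a no-instance needs two vertices, for `d ≥ 1` the bound is `4 * d`
    EqCol.HasKernel (fun I => EqCol.distToClique I.G) (fun d => max (4 * d) 2) ∧
    -- a greedy modulator is computed in polynomial time
    EqCol.PolyTime (fun _ => True)
      (fun I m => ∃ U : Finset (Fin I.n), EqCol.IsGreedyModulator I.G U ∧ m.HoldsSet U) ∧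
    -- instances with a clique modulator of fewer than `k` vertices are solved in polynomial time
    EqCol.PolyTime (fun I => ∃ U : Finset (Fin I.n), EqCol.IsCliqueModulator I.G U ∧ U.card < I.k)
      (fun I m => m.HoldsAnswer I.Yes) ∧
    -- such an instance is decided by the size of a maximum matching of the complement
    (∀ (I : EqCol.Inst) (U : Finset (Fin I.n)), EqCol.IsCliqueModulator I.G U → U.card < I.k →
      (I.Yes ↔ I.n ≤ I.k + EqCol.matchingNumber I.Gᶜ)) ∧
    -- a greedy modulator has at most `2 * d` vertices, and if it has at least `k` vertices,
    -- then the graph has at most `4 * d` vertices, unless the answer is trivially no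
    (∀ (I : EqCol.Inst) (U : Finset (Fin I.n)), EqCol.IsGreedyModulator I.G U →
      U.card ≤ 2 * EqCol.distToClique I.G ∧
      (I.k ≤ U.card →
        U.card + I.k ≤ 4 * EqCol.distToClique I.G ∧ (U.card + I.k < I.n → ¬ I.Yes))) := by
  refine ⟨EqCol.hasKernel, EqCol.polyTime_greedy, EqCol.polyTime_decide, fun I U hU hk => ?_,
    fun I U hU => ⟨hU.card_le, fun hk => ⟨?_, fun hn => ?_⟩⟩⟩
  · simpa only [EqCol.Inst.Yes, Fintype.card_fin] using
      EqCol.equitablyColorable_iff_matchingNumber hU hk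
  · have := hU.card_le
    omega
  · exact hU.2.not_equitablyColorable (by rwa [Fintype.card_fin])
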